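/- **Proposition 1.** Write $\Sigma=\{z=0\}$, $\Sigma^{+}=\{z\ge 0\}$, $\Sigma^{-}=\{z\le 0\}$ in $\mathbb R^3$, and $f(x,y,z)=z$. Let $M\subset\mathbb R^3$ be a compact region (a compact set that is the closure of its interior, the interior being connected), and let $Z=(X,Y)$ be a piecewise $C^r$ vector field on $M$, $1\le r\le\infty$ or $r=\omega$: $X$ is of class $C^r$ on a neighbourhood of $M\cap\Sigma^+$ and $Y$ on a neighbourhood of $M\cap\Sigma^-$. For a vector field $V$ put $V.g=\langle\nabla g,V\rangle$ and $V^2.f=V.(V.f)$. Assume that every point $p\in M\cap\Sigma$ is either a crossing point, $X.f(p)\,Y.f(p)>0$, or an invisible–invisible two-fold point, $X.f(p)=Y.f(p)=0$, $X^2.f(p)<0<Y^2.f(p)$. A trajectory of $Z$ is a curve that near every time, on each side of that time, is an integral curve of $X$ in $\Sigma^+$ or of $Y$ in $\Sigma^-$; a periodic orbit is the image of a non-constant periodic trajectory. Suppose that $M$ is a continuum of nested topological cylinders filled by periodic orbits around a curve of invisible–invisible two-fold points, that is, there is a continuous surjection $\Phi:S^1\times[0,1]\times[0,1]\to M$ such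 that - $\Phi(\theta,u,s)=\Phi(\theta',u',s')$ if and only if $u=u'$, $s=s'$, and $s=0$ or $\theta=\theta'$; - every point $\Phi(\theta,u,0)$ is an invisible–invisible two-fold point of $Z$; - for all $u\in[0,1]$ and $s\in(0,1]$ the circle $\Phi(S^1\times\{u\}\times\{s\})$ is a periodic orbit of $Z$. (The cylinders are the sets $\Phi(S^1\times[0,1]\times\{s\})$, $0<s\le1$.) Let $Z_0=(X_0,Y_0)$ be the normal form $X_0=(0,-1,2y)$ on $\Sigma^+$, $Y_0=(0,1,2y)$ on $\Sigma^-$, and for $a<b$, $c>0$ let $M_0=\{(x,y,z): a\le x\le b,\ |z|+y^2\le c\}$, a compact region filled by cylinders of periodic orbits of $Z_0$. Then, for all $a<b$ and $c>0$, $Z$ on $M$ is $\Sigma$-equivalent to $Z_0$ on $M_0$: there is a homeomorphism $h:M\to M_0$ that preserves the orientation of space (it has local degree $+1$ at every interior point of $M$), sends $M\cap\Sigma$ onto $M_0\cap\Sigma$, sends the orbits of $X$ restricted to $M\cap\Sigma^+$ onto the orbits of $X_0$ restricted to $M_0\cap\Sigma^+$, and sends the orbits of $Y$ restricted to $M\cap\Sigma^-$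 onto the orbits of $Y_0$ restricted to $M_0\cap\Sigma^-$; moreover $h$ preserves the sense in which these orbits are traversed. -/

import Mathlib

noncomputable section

namespace PSVF

open Set Metric

/-- Three-dimensional Euclidean space; coordinates `0, 1, 2` are `x, y, z`. -/
abbrev E3 : Type := EuclideanSpace ℝ (Fin 3)

/-- The function `f(x,y,z) = z` defining the switching manifold. -/
def height (p : E3) : ℝ := p 2

/-- The switching manifold `Σ = {z = 0}`. -/
def switching : Set E3 := {p | height p = 0}

/-- The closed upper side `Σ⁺ = {z ≥ 0}`. -/
def upperSide : Set E3 := {p | 0 ≤ height p}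

/-- The closed lower side `Σ⁻ = {z ≤ 0}`. -/
def lowerSide : Set E3 := {p | height p ≤ 0}

/-- A piecewise vector field `Z = (X, Y)`: only the values of `X` on (a neighbourhood of) the part
of the domain in `Σ⁺`, and of `Y` on (a neighbourhood of) the part in `Σ⁻`, are ever used. -/
structure PiecewiseField where
  X : E3 → E3
  Y : E3 → E3

/-- `Z = (X, Y)` is a piecewise `C^r` vector field on `M`: each half is of class `C^r` on the
corresponding part of `M`, that is, on an open neighbourhood of that part. -/
def PiecewiseField.SmoothOn (Z : PiecewiseField) (r : WithTop ℕ∞) (M : Set E3) : Prop :=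
  (∃ U : Set E3, IsOpen U ∧ M ∩ upperSide ⊆ U ∧ ContDiffOn ℝ r Z.X U) ∧
  (∃ U : Set E3, IsOpen U ∧ M ∩ lowerSide ⊆ U ∧ ContDiffOn ℝ r Z.Y U)

/-- The derivative `V.g(p) = ⟨∇g(p), V(p)⟩` of a function along a vector field. -/
def lieDeriv (V : E3 → E3) (g : E3 → ℝ) (p : E3) : ℝ := fderiv ℝ g p (V p)

/-- A crossing point of `Σ`: both halves are transversal to `Σ` and point to the same side. -/
def PiecewiseField.IsCrossing (Z : PiecewiseField) (p : E3) : Prop :=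
  p ∈ switching ∧ 0 < lieDeriv Z.X height p * lieDeriv Z.Y height p

/-- An invisible-invisible two-fold point of `Σ`: the parabolic tangency of `X` (which acts in
`Σ⁺`) bends into `Σ⁻`, and that of `Y` (which acts in `Σ⁻`) bends into `Σ⁺`. -/
def PiecewiseField.IsInvisibleTwoFold (Z : PiecewiseField) (p : E3) : Prop :=
  p ∈ switching ∧
  lieDeriv Z.X height p = 0 ∧ lieDeriv Z.X (lieDeriv Z.X height) p < 0 ∧
  lieDeriv Z.Y height p = 0 ∧ 0 < lieDeriv Z.Y (lieDeriv Z.Y height) p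

/-- `γ` restricted to the time interval `I` is an integral curve of `V` contained in `S`. -/
def IsArc (V : E3 → E3) (S : Set E3) (γ : ℝ → E3) (I : Set ℝ) : Prop :=
  ∀ t ∈ I, γ t ∈ S ∧ HasDerivWithinAt γ (V (γ t)) I t

/-- A trajectory of `Z`, defined for all times: just after and just before each time it is
an arc of `X` in `Σ⁺` or an arc of `Y` in `Σ⁻`. -/
def PiecewiseField.IsTrajectory (Z : PiecewiseField) (γ : ℝ → E3) : Prop :=
  ∀ t : ℝ, ∃ ε > 0,
    (IsArc Z.X upperSide γ (Icc t (t + ε)) ∨ IsArc Z.Y lowerSide γ (Icc t (t + ε))) ∧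
    (IsArc Z.X upperSide γ (Icc (t - ε) t) ∨ IsArc Z.Y lowerSide γ (Icc (t - ε) t))

/-- `Γ` is a (non-constant) periodic orbit of `Z`. -/
def PiecewiseField.IsPeriodicOrbit (Z : PiecewiseField) (Γ : Set E3) : Prop :=
  Γ.Nontrivial ∧ ∃ (γ : ℝ → E3) (T : ℝ),
    0 < T ∧ Z.IsTrajectory γ ∧ Function.Periodic γ T ∧ range γ = Γ

/-- A compact region: a compact set that is the closure of a connected open set (its interior). -/
def IsCompactRegion (M : Set E3) : Prop :=
  IsCompact M ∧ closure (interior M) = M ∧ IsConnected (interior M)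

/-- `M` is filled by a continuum of nested topological cylinders `Φ(S¹ × [0,1] × {s})`,
`0 < s ≤ 1`, which depend continuously on `s`, are pairwise disjoint, and shrink for `s → 0` to a
curve `u ↦ Φ(·, u, 0)` of invisible-invisible two-fold points. Each cylinder is filled by periodic
orbits of `Z`, namely the circles `Φ(S¹ × {u} × {s})`. -/
def PiecewiseField.HasCylinderContinuum (Z : PiecewiseField) (M : Set E3) : Prop :=
  ∃ Φ : Circle × unitInterval × unitInterval → E3,
    Continuous Φ ∧ range Φ = M ∧
    (∀ θ θ' u u' s s', Φ (θ, u, s) = Φ (θ', u', s') ↔ u = u' ∧ s = s' ∧ (s = 0 ∨ θ = θ')) ∧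
    (∀ θ u, Z.IsInvisibleTwoFold (Φ (θ, u, 0))) ∧
    (∀ u s, s ≠ 0 → Z.IsPeriodicOrbit (range fun θ => Φ (θ, u, s)))

/-- The integral curve of `V` restricted to `S` leads from `p` to `q` in non-negative time. -/
def Reaches (V : E3 → E3) (S : Set E3) (p q : E3) : Prop :=
  ∃ (γ : ℝ → E3) (T : ℝ), 0 ≤ T ∧ IsArc V S γ (Icc 0 T) ∧ γ 0 = p ∧ γ T = q

/-- The orbit through `p` of `V` restricted to `S` (empty if `p ∉ S`). -/
def orbitIn (V : E3 → E3) (S : Set E3) (p : E3) : Set E3 :=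
  {q | Reaches V S p q ∨ Reaches V S q p}

/-- `h` preserves the orientation of space: at each interior point `p` of its domain it has local
degree `+1`, that is, on a punctured ball around `p` the map `q ↦ h(q) - h(p)` is homotopic to
`q ↦ q - p` as a map into `ℝ³ \ {0}`. -/
def OrientationPreserving {U V : Set E3} (h : U ≃ₜ V) : Prop :=
  ∀ p : U, (p : E3) ∈ interior U → ∃ ρ > 0, closedBall (p : E3) ρ ⊆ U ∧
    ∃ H : unitInterval × U → E3,
      ContinuousOn H {w | (w.2 : E3) ∈ closedBall (p : E3) ρ ∧ w.2 ≠ p} ∧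
      (∀ t, ∀ q : U, (q : E3) ∈ closedBall (p : E3) ρ → q ≠ p → H (t, q) ≠ 0) ∧
      (∀ q : U, (q : E3) ∈ closedBall (p : E3) ρ → q ≠ p →
        H (0, q) = (h q : E3) - (h p : E3) ∧ H (1, q) = (q : E3) - (p : E3))

/-- `Z` on `U` and `W` on `V` are `Σ`-equivalent: there is a homeomorphism `h : U → V` that
preserves the orientation of space, sends `U ∩ Σ` to `V ∩ Σ`, orbits of `Z.X` restricted to
`U ∩ Σ⁺` to orbits of `W.X` restricted to `V ∩ Σ⁺`, and orbits of `Z.Y` restricted to `U ∩ Σ⁻`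
to orbits of `W.Y` restricted to `V ∩ Σ⁻`; it also preserves the sense of all orbits. -/
def SigmaEquivalent (Z : PiecewiseField) (U : Set E3) (W : PiecewiseField) (V : Set E3) : Prop :=
  ∃ h : U ≃ₜ V, OrientationPreserving h ∧
    (∀ p : U, (p : E3) ∈ switching ↔ (h p : E3) ∈ switching) ∧
    (∀ p q : U, (q : E3) ∈ orbitIn Z.X (U ∩ upperSide) p ↔
      (h q : E3) ∈ orbitIn W.X (V ∩ upperSide) (h p)) ∧
    (∀ p q : U, (q : E3) ∈ orbitIn Z.Y (U ∩ lowerSide) p ↔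
      (h q : E3) ∈ orbitIn W.Y (V ∩ lowerSide) (h p)) ∧
    (∀ p q : U, Reaches Z.X (U ∩ upperSide) p q →
      Reaches W.X (V ∩ upperSide) (h p) (h q)) ∧
    (∀ p q : U, Reaches Z.Y (U ∩ lowerSide) p q →
      Reaches W.Y (V ∩ lowerSide) (h p) (h q))

/-- The normal form `Z₀ = (X₀, Y₀)`, `X₀ = (0, -1, 2y)`, `Y₀ = (0, 1, 2y)`. -/
def normalForm : PiecewiseField where
  X := fun p => !₂[0, -1, 2 * p 1]
  Y := fun p => !₂[0, 1, 2 * p 1]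

/-- The compact region `{a ≤ x ≤ b, |z| + y² ≤ c}`, bounded laterally by one of the cylinders of
the normal form. -/
def normalRegion (a b c : ℝ) : Set E3 :=
  {p | a ≤ p 0 ∧ p 0 ≤ b ∧ |p 2| + p 1 ^ 2 ≤ c}

end PSVF

end

noncomputable section

namespace PSVF

open Set Metric Filter Topology

/-! The point is that every orbit on the cylinders crosses Σ exactly twice, once upwards and once
downwards; after that the equivalence can be written down.

Off the axis all points of Σ in `M` are crossings, because no trajectory passes through an invisible
two-fold. Take a continuous function `c` with the sign of `X.f` on the crossing points. The complex
function `c + iz` does not vanish off the axis, and its argument, pulled back to the angle `θ ∈ ℝ`,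
is a coordinate `α` whose levels `kπ` are exactly the crossings: upwards for even `k`, downwards for
odd `k`. In either case `α` increases in time, so a trajectory passes each level once. Let `m` be
the index of `α`, that is, `α` grows by `2πm` when `θ` makes one turn.

The index is not zero (`index_ne_zero`). With `m = 0` no orbit could return after a crossing, and a
periodic orbit near the axis cannot avoid Σ, since `X.f` or `Y.f` would be strictly monotone along
it. The index is `±1` (`index_eq_one`). Near a point of the axis, Σ has the injective chart `(ξ,
X.f)`, where the axis lies on the real line and upward crossings lie in the upper half-plane. By a
winding argument (`half_disc_subset_image`) the sheet `α = 0` already fills a half-disc there, so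
the sheet `α = 2π` meets it, and injectivity of the cylinders forces `|m| = 1`. Thus an orbit
consists of an arc of `X` from angle `A` to `B` and an arc of `Y` from `B` to `A + 2π`, with `A`,
`B` continuous in `(u, s)` (`Meridians`).

For the normal form `x` and `|z| + y²` are constant on orbits, and `y` is monotone in time on each
side. Sending `x` to `u`, `(|z| + y²)/c` to `s`, and the relative position `y/√(|z| + y²)` affinely
to the angle between `A` and `B` gives a continuous bijection of compact spaces that respects the
time order (`reaches_cylinderMap_iff`).

There remains a sign `e = ±1`, the sense in which `x` runs along the axis. The local degree is
constant on the connected interior of `M`, so one ball suffices. In a ball where the height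
increases along orbits, `(u, s)` restricted to a horizontal disc is injective with a neighbourhood
as image, hence has winding number `±1` (`exists_angular_homotopy`); `e` is chosen to compensate it
(`exists_orientationPreserving`). -/

/-! ### Continuous logarithms, monodromy and winding numbers in the plane -/

/-- Lifting through the covering `exp`. All angles and winding numbers below come from such a lift.
-/
theorem exists_continuous_log {A : Type*} [TopologicalSpace A] [SimplyConnectedSpace A]
    [LocallyPathConnectedSpace A] {f : A → ℂ} (hf : Continuous f) (h0 : ∀ x, f x ≠ 0) :
    ∃ L : A → ℂ, Continuous L ∧ ∀ x, Complex.exp (L x) = f x := by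
  obtain ⟨a₀⟩ : Nonempty A := inferInstance
  obtain ⟨F, ⟨-, hF⟩, -⟩ := Complex.isCoveringMapOn_exp.existsUnique_continuousMap_lifts
    (⟨f, hf⟩ : C(A, ℂ)) (a₀ := a₀) (e₀ := Complex.log (f a₀)) (Complex.exp_log (h0 a₀))
    (fun a => h0 a)
  exact ⟨F, F.continuous, fun x => congrFun hF x⟩

theorem IsPreconnected.eq_of_int_valued {A : Type*} [TopologicalSpace A] {S : Set A}
    (hS : IsPreconnected S) {f : A → ℝ} (hf : ContinuousOn f S)
    (h : ∀ x ∈ S, ∃ n : ℤ, f x = n) {x y : A} (hx : x ∈ S) (hy : y ∈ S) : f x = f y := by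
  have hT : IsDiscrete (range ((↑) : ℤ → ℝ)) := by
    rw [isDiscrete_iff_discreteTopology]
    exact (Int.isClosedEmbedding_coe_real.isEmbedding.toHomeomorph.symm.isEmbedding).discreteTopology
  refine hS.constant_of_mapsTo hT hf (fun z hz => ?_) hx hy
  obtain ⟨n, hn⟩ := h z hz
  exact ⟨n, hn.symm⟩

/-- Two continuous logarithms of the same function on a preconnected set differ by a constant. -/
theorem IsPreconnected.log_sub_eq {A : Type*} [TopologicalSpace A] {S : Set A}
    (hS : IsPreconnected S) {f g : A → ℂ} (hf : ContinuousOn f S) (hg : ContinuousOn g S)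
    (h : ∀ x ∈ S, Complex.exp (f x) = Complex.exp (g x)) {x y : A} (hx : x ∈ S) (hy : y ∈ S) :
    f x - g x = f y - g y := by
  have key : ∀ x ∈ S, ∃ n : ℤ, f x - g x = n * (2 * Real.pi * Complex.I) := by
    intro x hx
    obtain ⟨n, hn⟩ := Complex.exp_eq_exp_iff_exists_int.1 (h x hx)
    exact ⟨n, by rw [hn]; ring⟩
  have him : ∀ x ∈ S, ∀ n : ℤ, f x - g x = n * (2 * Real.pi * Complex.I) →
      (f x - g x).im / (2 * Real.pi) = n := by
    intro x _ n hn
    rw [hn]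
    have : ((n : ℂ) * (2 * Real.pi * Complex.I)).im = n * (2 * Real.pi) := by
      simp
    rw [this]
    field_simp
  have hc : ContinuousOn (fun x => (f x - g x).im / (2 * Real.pi)) S :=
    (Complex.continuous_im.comp_continuousOn (hf.sub hg)).div_const _
  have := IsPreconnected.eq_of_int_valued hS hc (fun x hx => by
    obtain ⟨n, hn⟩ := key x hx
    exact ⟨n, him x hx n hn⟩) hx hy
  obtain ⟨n, hn⟩ := key x hx
  obtain ⟨k, hk⟩ := key y hy
  rw [him x hx n hn, him y hy k hk] at this
  have hnk : n = k := by exact_mod_cast this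
  rw [hn, hk, hnk]

/-- A map of a rectangle into the closed upper half-plane which maps the bottom edge across `0`
on the real axis and the other edges away from `0` covers a half-disc. -/
theorem half_disc_subset_image {b : ℝ × ℝ → ℂ} {x₀ x₁ y₁ r₀ : ℝ} (hx : x₀ ≤ x₁) (hy : 0 ≤ y₁)
    (hb : ContinuousOn b (Icc x₀ x₁ ×ˢ Icc 0 y₁))
    (hbot : ∀ x ∈ Icc x₀ x₁, (b (x, 0)).im = 0)
    (him : ∀ p ∈ Icc x₀ x₁ ×ˢ Icc 0 y₁, 0 ≤ (b p).im)
    (hl : (b (x₀, 0)).re < 0) (hr : 0 < (b (x₁, 0)).re)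
    (hfar : ∀ p ∈ Icc x₀ x₁ ×ˢ Icc 0 y₁, (p.1 = x₀ ∨ p.1 = x₁ ∨ p.2 = y₁) → r₀ ≤ ‖b p‖)
    {q : ℂ} (hq : 0 < q.im) (hqr : ‖q‖ < r₀) : ∃ p ∈ Icc x₀ x₁ ×ˢ Icc 0 y₁, b p = q := by
  -- If `q` is missed, `b - q` has a continuous logarithm `L` on the rectangle. The change of `L`
  -- between the two lower corners is then computed in two ways: along the bottom edge, where `b -
  -- q` stays in the lower half-plane, and along the other three edges, where `b - q` avoids the ray
  -- going down from `0`. The results are incompatible.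
  by_contra hne
  push Not at hne
  set R : Set (ℝ × ℝ) := Icc x₀ x₁ ×ˢ Icc 0 y₁
  -- Clamping to the rectangle gives a function on the whole plane, which is simply connected.
  set cl : ℝ × ℝ → ℝ × ℝ := fun p => (projIcc x₀ x₁ hx p.1, projIcc 0 y₁ hy p.2) with hcl
  have hclc : Continuous cl := by
    apply Continuous.prodMk
    · exact continuous_subtype_val.comp (continuous_projIcc.comp continuous_fst)
    · exact continuous_subtype_val.comp (continuous_projIcc.comp continuous_snd)
  have hclm : ∀ p, cl p ∈ R := fun p => ⟨(projIcc x₀ x₁ hx p.1).2, (projIcc 0 y₁ hy p.2).2⟩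
  have hcle : ∀ p ∈ R, cl p = p := by
    rintro ⟨x, y⟩ ⟨h1, h2⟩
    simp only [hcl]
    rw [projIcc_of_mem hx h1, projIcc_of_mem hy h2]
  obtain ⟨L, hL, hLe⟩ := exists_continuous_log (f := fun p => b (cl p) - q)
    ((hb.comp_continuous hclc hclm).sub continuous_const)
    (fun p => sub_ne_zero.2 (hne _ (hclm p)))
  have hLe' : ∀ p ∈ R, Complex.exp (L p) = b p - q := fun p hp => by rw [hLe, hcle p hp]
  have hP0 : (x₀, (0:ℝ)) ∈ R := ⟨⟨le_rfl, hx⟩, ⟨le_rfl, hy⟩⟩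
  have hP1 : (x₁, (0:ℝ)) ∈ R := ⟨⟨hx, le_rfl⟩, ⟨le_rfl, hy⟩⟩
  have hnq := Complex.abs_re_le_norm q
  -- the bottom edge
  have e1 : L (x₀, 0) - Complex.log (Complex.I * (b (x₀, 0) - q)) =
      L (x₁, 0) - Complex.log (Complex.I * (b (x₁, 0) - q)) := by
    have hS : IsPreconnected (Icc x₀ x₁ ×ˢ {(0:ℝ)}) :=
      isPreconnected_Icc.prod isPreconnected_singleton
    have hsub : Icc x₀ x₁ ×ˢ {(0:ℝ)} ⊆ R :=
      prod_mono Subset.rfl (singleton_subset_iff.2 ⟨le_rfl, hy⟩)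
    have := IsPreconnected.log_sub_eq hS (f := fun p => L p + Complex.log Complex.I)
      (g := fun p => Complex.log (Complex.I * (b p - q)))
      (hL.add continuous_const).continuousOn
      (ContinuousOn.clog (continuousOn_const.mul ((hb.mono hsub).sub continuousOn_const)) ?_) ?_
      (x := (x₀, 0)) (y := (x₁, 0)) ⟨⟨le_rfl, hx⟩, rfl⟩ ⟨⟨hx, le_rfl⟩, rfl⟩
    · linear_combination this
    · rintro ⟨x, y⟩ ⟨h1, h2⟩
      simp only [mem_singleton_iff] at h2
      subst h2
      left
      simp [hbot x h1, hq]
    · rintro p hp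
      rw [Complex.exp_add, Complex.exp_log Complex.I_ne_zero, hLe' p (hsub hp), Complex.exp_log]
      · ring
      · exact mul_ne_zero Complex.I_ne_zero (sub_ne_zero.2 (hne _ (hsub hp)))
  -- the other three edges
  have e2 : L (x₀, 0) - Complex.log (-Complex.I * (b (x₀, 0) - q)) =
      L (x₁, 0) - Complex.log (-Complex.I * (b (x₁, 0) - q)) := by
    set S : Set (ℝ × ℝ) := ({x₀} ×ˢ Icc 0 y₁ ∪ Icc x₀ x₁ ×ˢ {y₁}) ∪ {x₁} ×ˢ Icc 0 y₁
    have hS : IsPreconnected S := by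
      refine IsPreconnected.union (x₁, y₁) (Or.inr ⟨⟨hx, le_rfl⟩, rfl⟩) ⟨rfl, hy, le_rfl⟩ ?_
        (isPreconnected_singleton.prod isPreconnected_Icc)
      exact IsPreconnected.union (x₀, y₁) ⟨rfl, hy, le_rfl⟩ ⟨⟨le_rfl, hx⟩, rfl⟩
        (isPreconnected_singleton.prod isPreconnected_Icc)
        (isPreconnected_Icc.prod isPreconnected_singleton)
    have hsub : ∀ p ∈ S, p ∈ R ∧ (p.1 = x₀ ∨ p.1 = x₁ ∨ p.2 = y₁) := by
      rintro ⟨x, y⟩ ((⟨h1, h2⟩ | ⟨h1, h2⟩) | ⟨h1, h2⟩)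
      · simp only [mem_singleton_iff] at h1; subst h1
        exact ⟨⟨⟨le_rfl, hx⟩, h2⟩, Or.inl rfl⟩
      · simp only [mem_singleton_iff] at h2; subst h2
        exact ⟨⟨h1, ⟨hy, le_rfl⟩⟩, Or.inr (Or.inr rfl)⟩
      · simp only [mem_singleton_iff] at h1; subst h1
        exact ⟨⟨⟨hx, le_rfl⟩, h2⟩, Or.inr (Or.inl rfl)⟩
    have := IsPreconnected.log_sub_eq hS (f := fun p => L p + Complex.log (-Complex.I))
      (g := fun p => Complex.log (-Complex.I * (b p - q)))
      (hL.add continuous_const).continuousOn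
      (ContinuousOn.clog (continuousOn_const.mul
        ((hb.mono fun p hp => (hsub p hp).1).sub continuousOn_const)) ?_) ?_
      (x := (x₀, 0)) (y := (x₁, 0)) (Or.inl (Or.inl ⟨rfl, le_rfl, hy⟩)) (Or.inr ⟨rfl, le_rfl, hy⟩)
    · linear_combination this
    · intro p hp
      obtain ⟨hpR, hpe⟩ := hsub p hp
      rw [Complex.mem_slitPlane_iff]
      -- Otherwise `b p` lies on the vertical line below `q` and in the closed upper half-plane, so
      -- `‖b p‖ ≤ ‖q‖ < r₀`, against the bound on these edges.
      by_contra hcon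
      push Not at hcon
      obtain ⟨h1, h2⟩ := hcon
      simp at h1 h2
      have h3 := hfar p hpR hpe
      have h4 := him p hpR
      have h5 : ‖b p‖ ^ 2 ≤ ‖q‖ ^ 2 := by
        rw [← Complex.normSq_eq_norm_sq, ← Complex.normSq_eq_norm_sq, Complex.normSq_apply,
          Complex.normSq_apply]
        have : (b p).re = q.re := by linarith
        rw [this]
        nlinarith
      have h6 : ‖b p‖ ≤ ‖q‖ := by
        exact (pow_le_pow_iff_left₀ (norm_nonneg _) (norm_nonneg _) two_ne_zero).1 h5
      linarith
    · rintro p hp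
      rw [Complex.exp_add, Complex.exp_log (neg_ne_zero.2 Complex.I_ne_zero),
        hLe' p (hsub p hp).1, Complex.exp_log]
      · ring
      · exact mul_ne_zero (neg_ne_zero.2 Complex.I_ne_zero)
          (sub_ne_zero.2 (hne _ (hsub p hp).1))
  -- comparison of the branches
  have a1 : (b (x₁, 0) - q).im < 0 := by simp [hbot x₁ ⟨hx, le_rfl⟩, hq]
  have a0 : (b (x₀, 0) - q).im < 0 := by simp [hbot x₀ ⟨le_rfl, hx⟩, hq]
  have n0 : ‖b (x₀, 0)‖ = -(b (x₀, 0)).re := by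
    have : b (x₀, 0) = (((b (x₀, 0)).re : ℝ) : ℂ) := by
      apply Complex.ext <;> simp [hbot x₀ ⟨le_rfl, hx⟩]
    rw [this, Complex.norm_real, Real.norm_eq_abs, abs_of_neg (by simpa using hl)]
    simp
  have n1 : ‖b (x₁, 0)‖ = (b (x₁, 0)).re := by
    have : b (x₁, 0) = (((b (x₁, 0)).re : ℝ) : ℂ) := by
      apply Complex.ext <;> simp [hbot x₁ ⟨hx, le_rfl⟩]
    rw [this, Complex.norm_real, Real.norm_eq_abs, abs_of_pos (by simpa using hr)]
    simp
  have f0 := hfar (x₀, 0) hP0 (Or.inl rfl)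
  have f1 := hfar (x₁, 0) hP1 (Or.inr (Or.inl rfl))
  rw [abs_le] at hnq
  have r0 : (b (x₀, 0) - q).re < 0 := by rw [Complex.sub_re]; linarith
  have r1 : 0 < (b (x₁, 0) - q).re := by rw [Complex.sub_re]; linarith
  set P := b (x₁, 0) - q
  set Q := b (x₀, 0) - q
  have harg : ∀ w : ℂ, w.im < 0 → (Complex.log (Complex.I * w)).im = w.arg + Real.pi / 2 := by
    intro w hw
    have hw0 : w ≠ 0 := by rintro rfl; simp at hw
    rw [Complex.log_im, mul_comm, Complex.arg_mul_eq_add_arg_iff hw0 Complex.I_ne_zero |>.2]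
    · rw [Complex.arg_I]
    · rw [Complex.arg_I]
      have := Complex.arg_neg_iff.2 hw
      have := Complex.neg_pi_lt_arg w
      constructor <;> linarith [Real.pi_pos]
  have hargP : (Complex.log (-Complex.I * P)).im = P.arg - Real.pi / 2 := by
    have hw0 : P ≠ 0 := by intro h; rw [h] at r1; simp at r1
    rw [Complex.log_im, mul_comm, Complex.arg_mul_eq_add_arg_iff hw0 (neg_ne_zero.2 Complex.I_ne_zero) |>.2]
    · rw [Complex.arg_neg_I]; ring
    · rw [Complex.arg_neg_I]
      have h1 := Complex.arg_neg_iff.2 a1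
      have h2 : |P.arg| < Real.pi / 2 := Complex.abs_arg_lt_pi_div_two_iff.2 (Or.inl r1)
      rw [abs_lt] at h2
      constructor <;> linarith [Real.pi_pos, h2.1]
  have hargQ : 0 < (Complex.log (-Complex.I * Q)).im := by
    rw [Complex.log_im]
    rcases lt_or_ge 0 (Complex.arg (-Complex.I * Q)) with h | h
    · exact h
    · exfalso
      have : (-Complex.I * Q).im = -Q.re := by simp
      rcases h.lt_or_eq with h | h
      · rw [Complex.arg_neg_iff, this] at h
        linarith
      · rw [Complex.arg_eq_zero_iff, this] at h
        linarith [h.2]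
  have i1 := congrArg Complex.im e1
  have i2 := congrArg Complex.im e2
  simp only [Complex.sub_im, harg P a1, harg Q a0, hargP] at i1 i2
  have b0 := Complex.arg_neg_iff.2 a0
  linarith [Real.pi_pos]

/-- The monodromy of a logarithm of a function that is periodic in its last variable. -/
theorem exists_monodromy {A : Type*} [TopologicalSpace A] [PreconnectedSpace A] [Nonempty A]
    {L : A × ℝ → ℂ} (hL : Continuous L)
    (h : ∀ x θ, Complex.exp (L (x, θ + 2 * Real.pi)) = Complex.exp (L (x, θ))) :
    ∃ n : ℤ, ∀ (x : A) (θ : ℝ) (k : ℤ),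
      L (x, θ + k * (2 * Real.pi)) = L (x, θ) + (k * n : ℤ) * (2 * Real.pi * Complex.I) := by
  obtain ⟨x₀⟩ : Nonempty A := inferInstance
  obtain ⟨n, hn⟩ := Complex.exp_eq_exp_iff_exists_int.1 (h x₀ 0)
  have step : ∀ (x : A) (θ : ℝ), L (x, θ + 2 * Real.pi) = L (x, θ) + n * (2 * Real.pi * Complex.I) := by
    intro x θ
    have := IsPreconnected.log_sub_eq (isPreconnected_univ (α := A × ℝ))
      (f := fun p : A × ℝ => L (p.1, p.2 + 2 * Real.pi)) (g := L)
      (by fun_prop) hL.continuousOn (fun p _ => h p.1 p.2) (mem_univ (x, θ)) (mem_univ (x₀, 0))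
    simp only at this
    rw [hn] at this
    linear_combination this
  refine ⟨n, fun x θ k => ?_⟩
  induction k with
  | zero => simp
  | succ i ih =>
    have e : θ + ((i + 1 : ℤ) : ℝ) * (2 * Real.pi) = (θ + (i : ℤ) * (2 * Real.pi)) + 2 * Real.pi := by
      push_cast; ring
    rw [e, step, ih]; push_cast; ring
  | pred i ih =>
    have e : θ + ((-i : ℤ) : ℝ) * (2 * Real.pi) =
        (θ + ((-i - 1 : ℤ) : ℝ) * (2 * Real.pi)) + 2 * Real.pi := by
      push_cast; ring
    rw [e, step] at ih
    push_cast at ih ⊢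
    linear_combination ih

theorem norm_exp_ofReal_add_mul_I (x θ : ℝ) :
    ‖Complex.exp (x + θ * Complex.I)‖ = Real.exp x := by
  rw [Complex.norm_exp]; simp

theorem exp_add_two_pi_mul_I (x θ : ℝ) :
    Complex.exp (x + ((θ + 2 * Real.pi : ℝ) : ℂ) * Complex.I) = Complex.exp (x + θ * Complex.I) := by
  rw [Complex.exp_eq_exp_iff_exists_int]
  exact ⟨1, by push_cast; ring⟩

/-- A continuous injective map of the disc onto a neighbourhood of the image of the centre has
winding number `1` or `-1` around that image. -/
theorem exists_angular_homotopy {g : ℂ → ℂ} (hg : ContinuousOn g (closedBall 0 1))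
    (hinj : InjOn g (closedBall 0 1)) (hnhds : g '' closedBall 0 1 ∈ 𝓝 (g 0)) :
    ∃ N : ℝ × ℂ → ℂ, ContinuousOn N (univ ×ˢ (closedBall 0 1 \ {0})) ∧
      (∀ t, ∀ w ∈ closedBall (0 : ℂ) 1 \ {0}, ‖N (t, w)‖ = 1) ∧
      (∀ w ∈ closedBall (0 : ℂ) 1 \ {0}, N (0, w) = (g w - g 0) / ‖g w - g 0‖) ∧
      ((∀ w ∈ closedBall (0 : ℂ) 1 \ {0}, N (1, w) = w / ‖w‖) ∨
       (∀ w ∈ closedBall (0 : ℂ) 1 \ {0}, N (1, w) = (starRingEnd ℂ) w / ‖w‖)) := by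
  have h0 : (0 : ℂ) ∈ closedBall (0 : ℂ) 1 := by simp
  have hG0 : ∀ w ∈ closedBall (0 : ℂ) 1 \ {0}, g w - g 0 ≠ 0 := fun w hw =>
    sub_ne_zero.2 fun h => hw.2 (hinj hw.1 h0 h)
  have hexpm : ∀ (x θ : ℝ), x ≤ 0 → Complex.exp (x + θ * Complex.I) ∈ closedBall (0 : ℂ) 1 := by
    intro x θ hx
    rw [mem_closedBall_zero_iff, norm_exp_ofReal_add_mul_I]
    exact Real.exp_le_one_iff.2 hx
  obtain ⟨F, hF, hFe⟩ := exists_continuous_log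
    -- Polar coordinates `w = exp (x + iθ)` unroll the punctured disc to the half-plane `x ≤ 0`; the
    -- `min` extends the function to the whole plane.
    (f := fun p : ℝ × ℝ => g (Complex.exp ((min p.1 0 : ℝ) + p.2 * Complex.I)) - g 0)
    ((hg.comp_continuous (by fun_prop) fun p => hexpm _ _ (min_le_right _ _)).sub continuous_const)
    (fun p => hG0 _ ⟨hexpm _ _ (min_le_right _ _), Complex.exp_ne_zero _⟩)
  have hFe' : ∀ x θ : ℝ, x ≤ 0 →
      Complex.exp (F (x, θ)) = g (Complex.exp (x + θ * Complex.I)) - g 0 := by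
    intro x θ hx
    rw [hFe]; simp only [min_eq_left hx]
  obtain ⟨n, hn⟩ := exists_monodromy hF (fun x θ => by
    rw [hFe, hFe]; simp only; rw [exp_add_two_pi_mul_I])
  -- the inverse map
  obtain ⟨κ, hκ, hκg⟩ : ∃ κ : ℂ → ℂ, ContinuousOn κ (g '' closedBall 0 1) ∧
      ∀ w ∈ closedBall (0 : ℂ) 1, κ (g w) = w := by
    refine ⟨Function.invFunOn g (closedBall 0 1), ?_, fun w hw => hinj.leftInvOn_invFunOn hw⟩
    have hc := isCompact_closedBall (0 : ℂ) 1
    rw [continuousOn_iff_isClosed]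
    intro t ht
    refine ⟨g '' (closedBall 0 1 ∩ t), ?_, ?_⟩
    · exact ((hc.inter_right ht).image_of_continuousOn (hg.mono inter_subset_left)).isClosed
    · ext y
      constructor
      · rintro ⟨hy, w, hw, rfl⟩
        rw [mem_preimage, hinj.leftInvOn_invFunOn hw] at hy
        exact ⟨⟨w, ⟨hw, hy⟩, rfl⟩, ⟨w, hw, rfl⟩⟩
      · rintro ⟨⟨w, ⟨hw, hy⟩, rfl⟩, -⟩
        exact ⟨by rw [mem_preimage, hinj.leftInvOn_invFunOn hw]; exact hy, ⟨w, hw, rfl⟩⟩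
  obtain ⟨r, hr, hrs⟩ := nhds_basis_closedBall.mem_iff.1 hnhds
  have hexpr : ∀ (x θ : ℝ), x ≤ Real.log r →
      g 0 + Complex.exp (x + θ * Complex.I) ∈ g '' closedBall (0 : ℂ) 1 := by
    intro x θ hx
    apply hrs
    rw [mem_closedBall, dist_self_add_left, norm_exp_ofReal_add_mul_I]
    exact (Real.le_log_iff_exp_le hr).1 hx
  obtain ⟨K, hK, hKe⟩ := exists_continuous_log
    (f := fun p : ℝ × ℝ => κ (g 0 + Complex.exp ((min p.1 (Real.log r) : ℝ) + p.2 * Complex.I)))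
    (hκ.comp_continuous (by fun_prop) fun p => hexpr _ _ (min_le_right _ _))
    (fun p => by
      obtain ⟨w, hw, hwe⟩ := hexpr (min p.1 (Real.log r)) p.2 (min_le_right _ _)
      rw [← hwe, hκg w hw]
      rintro rfl
      exact Complex.exp_ne_zero _ (left_eq_add.1 hwe))
  obtain ⟨m, hm⟩ := exists_monodromy hK (fun x θ => by
    rw [hKe, hKe]; simp only; rw [exp_add_two_pi_mul_I])
  -- On a small circle `K ∘ F` is a logarithm of `κ (g w) = w`. One turn of `θ` changes it by `n *
  -- m` times `2πi` according to the two monodromies, and by `2πi` according to the identity.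
  have hmn : n * m = 1 := by
    obtain ⟨δ, hδ, hδg⟩ := Metric.continuousWithinAt_iff.1 (hg 0 h0) r hr
    set x₀ : ℝ := min 0 (Real.log (δ / 2))
    have hx₀ : x₀ ≤ 0 := min_le_left _ _
    have hFr : ∀ θ : ℝ, (F (x₀, θ)).re ≤ Real.log r := by
      intro θ
      rw [Real.le_log_iff_exp_le hr, ← Complex.norm_exp, hFe' x₀ θ hx₀, ← dist_eq_norm]
      refine (hδg (hexpm x₀ θ hx₀) ?_).le
      rw [dist_zero_right, norm_exp_ofReal_add_mul_I]
      have : x₀ ≤ Real.log (δ / 2) := min_le_right _ _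
      rw [Real.le_log_iff_exp_le (by positivity)] at this
      linarith
    have hcomp : ∀ θ : ℝ, Complex.exp (K ((F (x₀, θ)).re, (F (x₀, θ)).im)) =
        Complex.exp (x₀ + θ * Complex.I) := by
      intro θ
      rw [hKe]
      simp only [min_eq_left (hFr θ)]
      rw [Complex.re_add_im, hFe' x₀ θ hx₀, add_sub_cancel, hκg _ (hexpm x₀ θ hx₀)]
    have := IsPreconnected.log_sub_eq (isPreconnected_univ (α := ℝ))
      (f := fun θ : ℝ => K ((F (x₀, θ)).re, (F (x₀, θ)).im)) (g := fun θ : ℝ => x₀ + θ * Complex.I)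
      (by fun_prop) (by fun_prop) (fun θ _ => hcomp θ)
      (mem_univ (0 + (1 : ℤ) * (2 * Real.pi))) (mem_univ 0)
    rw [hn x₀ 0 1] at this
    have e1 : (F (x₀, 0) + ((1 * n : ℤ) : ℂ) * (2 * Real.pi * Complex.I)).re = (F (x₀, 0)).re := by
      simp
    have e2 : (F (x₀, 0) + ((1 * n : ℤ) : ℂ) * (2 * Real.pi * Complex.I)).im =
        (F (x₀, 0)).im + n * (2 * Real.pi) := by
      simp
    rw [e1, e2, hm] at this
    have h3 : ((n * m : ℤ) : ℂ) * (2 * Real.pi * Complex.I) = 1 * (2 * Real.pi * Complex.I) := by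
      push_cast at this ⊢
      linear_combination this
    have h4 := mul_right_cancel₀ Complex.two_pi_I_ne_zero h3
    exact_mod_cast h4
  -- the periodic part of the angle
  set D : ℝ × ℝ → ℝ := fun p => (F p).im - n * p.2 with hD
  have hDc : Continuous D := by fun_prop
  have hDp : ∀ x θ (k : ℤ), D (x, θ + k * (2 * Real.pi)) = D (x, θ) := by
    intro x θ k
    simp only [hD, hn]
    simp
    ring
  set d : ℂ → ℝ := fun w => D (Real.log ‖w‖, w.arg) with hd
  -- Since `D` is periodic, the branch of the argument does not matter. This second formula shows
  -- that `d` is continuous also across the cut of `arg`.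
  have hd' : ∀ w : ℂ, w ≠ 0 → d w = D (Real.log ‖w‖, (-w).arg + Real.pi) := by
    intro w hw
    have h1 : Complex.exp (w.arg * Complex.I) = Complex.exp (((-w).arg + Real.pi : ℝ) * Complex.I) := by
      have e1 := Complex.norm_mul_exp_arg_mul_I w
      have e2 := Complex.norm_mul_exp_arg_mul_I (-w)
      rw [norm_neg] at e2
      push_cast
      rw [add_mul, Complex.exp_add, Complex.exp_pi_mul_I]
      have : (‖w‖ : ℂ) ≠ 0 := by simpa using hw
      apply mul_left_cancel₀ this
      linear_combination e1 + e2
    obtain ⟨k, hk⟩ := Complex.exp_eq_exp_iff_exists_int.1 h1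
    have h2 : w.arg = ((-w).arg + Real.pi) + k * (2 * Real.pi) := by
      have h3 : (w.arg : ℂ) * Complex.I =
          ((((-w).arg + Real.pi) + k * (2 * Real.pi) : ℝ) : ℂ) * Complex.I := by
        rw [hk]; push_cast; ring
      exact_mod_cast mul_right_cancel₀ Complex.I_ne_zero h3
    rw [hd]
    simp only
    rw [h2, hDp]
  have hdc : ∀ w : ℂ, w ≠ 0 → ContinuousAt d w := by
    intro w hw
    have hlog : ContinuousAt (fun w : ℂ => Real.log ‖w‖) w :=
      continuous_norm.continuousAt.log (by simpa using hw)
    by_cases hs : w ∈ Complex.slitPlane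
    · exact hDc.continuousAt.comp (hlog.prodMk (Complex.continuousAt_arg hs))
    · have hs' : -w ∈ Complex.slitPlane :=
        ((Complex.mem_slitPlane_or_neg_mem_slitPlane hw).resolve_left hs)
      have : ContinuousAt (fun w : ℂ => D (Real.log ‖w‖, (-w).arg + Real.pi)) w := by
        refine hDc.continuousAt.comp (hlog.prodMk (ContinuousAt.add ?_ continuousAt_const))
        exact ContinuousAt.comp (f := fun w : ℂ => -w) (Complex.continuousAt_arg hs')
          continuousAt_neg
      refine this.congr ?_
      filter_upwards [isOpen_ne.mem_nhds hw] with v hv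
      exact (hd' v hv).symm
  have hpolar : ∀ w ∈ closedBall (0 : ℂ) 1 \ {0}, (g w - g 0) / ‖g w - g 0‖ =
      Complex.exp ((F (Real.log ‖w‖, w.arg)).im * Complex.I) := by
    intro w hw
    have hw0 : w ≠ 0 := hw.2
    have hle : Real.log ‖w‖ ≤ 0 := Real.log_nonpos (norm_nonneg _) (by simpa using hw.1)
    have e := hFe' (Real.log ‖w‖) w.arg hle
    have e2 : Complex.exp ((Real.log ‖w‖ : ℝ) + w.arg * Complex.I) = w := by
      rw [Complex.exp_add, ← Complex.ofReal_exp, Real.exp_log (norm_pos_iff.2 hw0)]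
      exact Complex.norm_mul_exp_arg_mul_I w
    rw [e2] at e
    rw [← e, Complex.norm_exp, Complex.ofReal_exp, ← Complex.exp_sub]
    congr 1
    apply Complex.ext <;> simp
  -- The direction of `g w - g 0` has angle `n * arg w + d w` with `d` single-valued. Turning it
  -- back by `t * d w` leaves `exp (i n arg w)` at `t = 1`, with `n = ±1`.
  refine ⟨fun p => (g p.2 - g 0) / ‖g p.2 - g 0‖ * Complex.exp (-(p.1 * d p.2 : ℝ) * Complex.I),
    ?_, ?_, ?_, ?_⟩
  · have hgc : ContinuousOn (fun p : ℝ × ℂ => g p.2 - g 0) (univ ×ˢ (closedBall 0 1 \ {0})) :=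
      (hg.comp continuousOn_snd fun p hp => hp.2.1).sub continuousOn_const
    have hdc' : ContinuousOn (fun p : ℝ × ℂ => d p.2) (univ ×ˢ (closedBall 0 1 \ {0})) :=
      ContinuousOn.comp (t := {w | w ≠ 0})
        (fun w hw => (hdc w hw).continuousWithinAt) continuousOn_snd fun p hp => hp.2.2
    refine (hgc.div ?_ fun p hp => ?_).mul ?_
    · exact Complex.continuous_ofReal.comp_continuousOn hgc.norm
    · simpa using hG0 _ hp.2
    · refine Complex.continuous_exp.comp_continuousOn ?_
      refine ContinuousOn.mul (ContinuousOn.neg ?_) continuousOn_const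
      exact Complex.continuous_ofReal.comp_continuousOn (continuousOn_fst.mul hdc')
  · intro t w hw
    simp only
    rw [hpolar w hw, ← Complex.exp_add, Complex.norm_exp]
    simp
  · intro w hw
    simp
  · have hN1 : ∀ w ∈ closedBall (0 : ℂ) 1 \ {0},
        (g w - g 0) / ‖g w - g 0‖ * Complex.exp (-((1 : ℝ) * d w : ℝ) * Complex.I) =
          Complex.exp ((n * w.arg : ℝ) * Complex.I) := by
      intro w hw
      rw [hpolar w hw, ← Complex.exp_add]
      congr 1
      simp only [hd, hD]
      push_cast
      ring
    have hw1 : ∀ w ∈ closedBall (0 : ℂ) 1 \ {0}, Complex.exp (w.arg * Complex.I) = w / ‖w‖ := by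
      intro w hw
      have : (‖w‖ : ℂ) ≠ 0 := by simpa using hw.2
      rw [eq_div_iff this, mul_comm]
      exact Complex.norm_mul_exp_arg_mul_I w
    rcases Int.eq_one_or_neg_one_of_mul_eq_one hmn with h | h
    · left
      intro w hw
      simp only
      rw [hN1 w hw, h, ← hw1 w hw]
      simp
    · right
      intro w hw
      simp only
      rw [hN1 w hw, h]
      have := congrArg (starRingEnd ℂ) (hw1 w hw)
      rw [← Complex.exp_conj] at this
      simp only [map_mul, map_div₀, Complex.conj_ofReal, Complex.conj_I] at this
      rw [← this]
      congr 1
      push_cast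
      ring

/-! ### Arcs and trajectories on the two sides of the switching manifold -/

/-- The closed side `{ε z ≥ 0}` of the switching manifold. -/
def side (ε : ℝ) : Set E3 := {p | 0 ≤ ε * p 2}

theorem upperSide_eq_side : upperSide = side 1 := by
  ext p; simp [upperSide, side, height]

theorem lowerSide_eq_side : lowerSide = side (-1) := by
  ext p; simp [lowerSide, side, height]

theorem isClosed_side (ε : ℝ) : IsClosed (side ε) :=
  isClosed_le continuous_const (by fun_prop)

theorem lieDeriv_height (V : E3 → E3) : lieDeriv V height = fun p => V p 2 := by
  funext p
  have : HasFDerivAt height (EuclideanSpace.proj 2 : E3 →L[ℝ] ℝ) p :=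
    (EuclideanSpace.proj 2 : E3 →L[ℝ] ℝ).hasFDerivAt
  rw [lieDeriv, this.fderiv]
  rfl

/-- `V` is of class `C¹` on a neighbourhood of `K`. -/
def RegularOn (V : E3 → E3) (K : Set E3) : Prop :=
  ∃ U : Set E3, IsOpen U ∧ K ⊆ U ∧ ContDiffOn ℝ 1 V U

theorem RegularOn.contDiffAt {V : E3 → E3} {K : Set E3} (h : RegularOn V K) {p : E3} (hp : p ∈ K) :
    ContDiffAt ℝ 1 V p := by
  obtain ⟨U, hU, hKU, hV⟩ := h
  exact hV.contDiffAt (hU.mem_nhds (hKU hp))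

theorem RegularOn.continuousAt {V : E3 → E3} {K : Set E3} (h : RegularOn V K) {p : E3}
    (hp : p ∈ K) : ContinuousAt V p :=
  (h.contDiffAt hp).continuousAt

theorem RegularOn.exists_lipschitzOnWith {V : E3 → E3} {K : Set E3} (h : RegularOn V K)
    (hK : IsCompact K) : ∃ C, LipschitzOnWith C V K := by
  refine LocallyLipschitzOn.exists_lipschitzOnWith_of_compact hK fun p hp => ?_
  obtain ⟨C, t, ht, hC⟩ := (h.contDiffAt hp).exists_lipschitzOnWith
  exact ⟨C, t, mem_nhdsWithin_of_mem_nhds ht, hC⟩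

theorem IsArc.coord {V : E3 → E3} {S : Set E3} {γ : ℝ → E3} {I : Set ℝ} (h : IsArc V S γ I)
    {t : ℝ} (ht : t ∈ I) (i : Fin 3) : HasDerivWithinAt (fun t => γ t i) (V (γ t) i) I t :=
  (EuclideanSpace.proj i : E3 →L[ℝ] ℝ).hasFDerivAt.comp_hasDerivWithinAt t (h t ht).2

theorem IsArc.mono {V : E3 → E3} {S S' : Set E3} {γ : ℝ → E3} {I J : Set ℝ} (h : IsArc V S γ I)
    (hS : S ⊆ S') (hJ : J ⊆ I) : IsArc V S' γ J :=
  fun t ht => ⟨hS (h t (hJ ht)).1, (h t (hJ ht)).2.mono hJ⟩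

theorem IsArc.continuousOn {V : E3 → E3} {S : Set E3} {γ : ℝ → E3} {I : Set ℝ}
    (h : IsArc V S γ I) : ContinuousOn γ I :=
  fun t ht => (h t ht).2.continuousWithinAt

theorem IsArc.shift {V : E3 → E3} {S : Set E3} {γ : ℝ → E3} {a b : ℝ}
    (h : IsArc V S γ (Icc a b)) (c : ℝ) :
    IsArc V S (fun t => γ (t + c)) (Icc (a - c) (b - c)) := by
  intro t ht
  have ht' : t + c ∈ Icc a b := ⟨by linarith [ht.1], by linarith [ht.2]⟩
  refine ⟨(h _ ht').1, ?_⟩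
  have h1 := (h _ ht').2
  have h2 : HasDerivWithinAt (fun t : ℝ => t + c) 1 (Icc (a - c) (b - c)) t :=
    ((hasDerivAt_id t).add_const c).hasDerivWithinAt
  have := HasDerivWithinAt.scomp (g₁ := γ) t h1 h2
    (t' := Icc a b) (fun s hs => ⟨by linarith [hs.1], by linarith [hs.2]⟩)
  rw [one_smul] at this
  exact this

theorem IsArc.reaches {V : E3 → E3} {S : Set E3} {γ : ℝ → E3} {a b : ℝ}
    (h : IsArc V S γ (Icc a b)) (hab : a ≤ b) : Reaches V S (γ a) (γ b) := by
  refine ⟨fun t => γ (t + a), b - a, by linarith, ?_, by simp, by simp⟩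
  simpa using h.shift a

theorem IsArc.hasDerivWithinAt_Ici {V : E3 → E3} {S : Set E3} {γ : ℝ → E3} {a b t : ℝ}
    (h : IsArc V S γ (Icc a b)) (ht : t ∈ Ico a b) : HasDerivWithinAt γ (V (γ t)) (Ici t) t :=
  (h t ⟨ht.1, ht.2.le⟩).2.mono_of_mem_nhdsWithin (by
    filter_upwards [self_mem_nhdsWithin, mem_nhdsWithin_of_mem_nhds (Iio_mem_nhds ht.2)]
      with s hs hs'
    exact ⟨ht.1.trans hs, le_of_lt hs'⟩)

/-- Uniqueness for the differential equation needs the Lipschitz bound only on a set containing both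
curves, so it holds in a closed side of `M`, including its boundary. -/
theorem IsArc.eqOn {V : E3 → E3} {S : Set E3} {C : NNReal} (hC : LipschitzOnWith C V S)
    {γ δ : ℝ → E3} {a b : ℝ} (h : IsArc V S γ (Icc a b)) (h' : IsArc V S δ (Icc a b))
    (h0 : γ a = δ a) : EqOn γ δ (Icc a b) :=
  ODE_solution_unique_of_mem_Icc_right (v := fun _ => V) (s := fun _ => S) (K := C)
    (fun _ _ => hC) h.continuousOn (fun _ ht => h.hasDerivWithinAt_Ici ht)
    (fun t ht => (h t ⟨ht.1, ht.2.le⟩).1) h'.continuousOn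
    (fun _ ht => h'.hasDerivWithinAt_Ici ht) (fun t ht => (h' t ⟨ht.1, ht.2.le⟩).1) h0

theorem eventually_pos_right_of_hasDerivWithinAt {f : ℝ → ℝ} {d t δ : ℝ} (hδ : 0 < δ)
    (h : HasDerivWithinAt f d (Icc t (t + δ)) t) (h0 : f t = 0) (hd : 0 < d) :
    ∀ᶠ s in 𝓝[>] t, 0 < f s := by
  have h1 : HasDerivWithinAt f d (Ioi t) t := h.mono_of_mem_nhdsWithin (by
    filter_upwards [self_mem_nhdsWithin,
      mem_nhdsWithin_of_mem_nhds (Iio_mem_nhds (show t < t + δ by linarith))] with s hs hs'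
    exact ⟨le_of_lt hs, le_of_lt hs'⟩)
  rw [hasDerivWithinAt_iff_tendsto_slope' (by simp)] at h1
  filter_upwards [h1.eventually (lt_mem_nhds hd), self_mem_nhdsWithin] with s hs hs'
  rw [slope_def_field, h0, sub_zero] at hs
  have : 0 < s - t := sub_pos.2 hs'
  exact (div_pos_iff_of_pos_right this).1 hs

theorem eventually_neg_left_of_hasDerivWithinAt {f : ℝ → ℝ} {d t δ : ℝ} (hδ : 0 < δ)
    (h : HasDerivWithinAt f d (Icc (t - δ) t) t) (h0 : f t = 0) (hd : 0 < d) :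
    ∀ᶠ s in 𝓝[<] t, f s < 0 := by
  have h1 : HasDerivWithinAt f d (Iio t) t := h.mono_of_mem_nhdsWithin (by
    filter_upwards [self_mem_nhdsWithin,
      mem_nhdsWithin_of_mem_nhds (Ioi_mem_nhds (show t - δ < t by linarith))] with s hs hs'
    exact ⟨le_of_lt hs', le_of_lt hs⟩)
  rw [hasDerivWithinAt_iff_tendsto_slope' (by simp)] at h1
  filter_upwards [h1.eventually (lt_mem_nhds hd), self_mem_nhdsWithin] with s hs hs'
  rw [slope_def_field, h0, sub_zero] at hs
  have : s - t < 0 := sub_neg.2 hs'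
  rcases div_pos_iff.1 hs with h | h
  · linarith [h.2]
  · exact h.1

/-- No arc on the side `ε` starts at a fold that bends to the other side. -/
theorem not_isArc_of_fold {V : E3 → E3} {ε δ t : ℝ} {γ : ℝ → E3} (hδ : 0 < δ)
    (hV : DifferentiableAt ℝ V (γ t)) (h0 : γ t 2 = 0) (h1 : V (γ t) 2 = 0)
    (h2 : ε * lieDeriv V (lieDeriv V height) (γ t) < 0) :
    ¬ IsArc V (side ε) γ (Icc t (t + δ)) := by
  intro h
  have htt : t ∈ Icc t (t + δ) := ⟨le_rfl, by linarith⟩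
  have hg : HasFDerivAt (fun p => V p 2) (fderiv ℝ (fun p => V p 2) (γ t)) (γ t) :=
    (((EuclideanSpace.proj 2 : E3 →L[ℝ] ℝ).differentiableAt).comp (γ t) hV).hasFDerivAt
  have hd : HasDerivWithinAt (fun s => -ε * V (γ s) 2)
      (-ε * lieDeriv V (lieDeriv V height) (γ t)) (Icc t (t + δ)) t := by
    refine HasDerivWithinAt.const_mul _ ?_
    rw [lieDeriv_height, lieDeriv]
    exact hg.comp_hasDerivWithinAt t (h t htt).2
  -- The component `ε V.f` vanishes at `t` and has negative derivative there, so it is negative just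
  -- after `t`. Then `ε z` decreases from `0` and the curve leaves the side.
  have hneg := eventually_pos_right_of_hasDerivWithinAt hδ hd (by simp [h1]) (by linarith)
  obtain ⟨c, hc, hcs⟩ := (mem_nhdsGT_iff_exists_Ioo_subset).1 hneg
  simp only [mem_Ioi] at hc
  set b := min c (t + δ)
  have htb : t < b := lt_min hc (by linarith)
  have hsub : Icc t b ⊆ Icc t (t + δ) := Icc_subset_Icc_right (min_le_right _ _)
  have hanti : StrictAntiOn (fun s => ε * γ s 2) (Icc t b) := by
    refine strictAntiOn_of_hasDerivWithinAt_neg (f' := fun s => ε * V (γ s) 2) (convex_Icc _ _) ?_ ?_ ?_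
    · intro s hs
      exact ((h.coord (hsub hs) 2).continuousWithinAt.mono hsub).const_mul ε
    · intro s hs
      rw [interior_Icc] at hs ⊢
      exact ((h.coord (hsub ⟨hs.1.le, hs.2.le⟩) 2).mono
        (Ioo_subset_Icc_self.trans hsub)).const_mul ε
    · intro s hs
      rw [interior_Icc] at hs
      have := hcs ⟨hs.1, hs.2.trans_le (min_le_left _ _)⟩
      simp only [mem_ofPred_eq] at this
      linarith
  have h3 := hanti ⟨le_rfl, htb.le⟩ ⟨htb.le, le_rfl⟩ htb
  have h4 : 0 ≤ ε * γ b 2 := (h b (hsub ⟨htb.le, le_rfl⟩)).1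
  simp only [h0, mul_zero] at h3
  linarith

/-- Near every time, on each side of it, `γ` is an arc of `V` in the side `ε` or an arc of `V'` in
the opposite side. -/
def FollowsSides (V V' : E3 → E3) (ε : ℝ) (γ : ℝ → E3) : Prop :=
  ∀ t : ℝ, ∃ δ > 0,
    (IsArc V (side ε) γ (Icc t (t + δ)) ∨ IsArc V' (side (-ε)) γ (Icc t (t + δ))) ∧
    (IsArc V (side ε) γ (Icc (t - δ) t) ∨ IsArc V' (side (-ε)) γ (Icc (t - δ) t))

theorem PiecewiseField.IsTrajectory.followsSides {Z : PiecewiseField} {γ : ℝ → E3}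
    (h : Z.IsTrajectory γ) : FollowsSides Z.X Z.Y 1 γ := by
  intro t
  obtain ⟨δ, hδ, h⟩ := h t
  rw [upperSide_eq_side, lowerSide_eq_side] at h
  exact ⟨δ, hδ, h⟩

theorem FollowsSides.symm {V V' : E3 → E3} {ε : ℝ} {γ : ℝ → E3} (h : FollowsSides V V' ε γ) :
    FollowsSides V' V (-ε) γ := by
  intro t
  obtain ⟨δ, hδ, h1, h2⟩ := h t
  rw [neg_neg]
  exact ⟨δ, hδ, h1.symm, h2.symm⟩

theorem FollowsSides.continuous {V V' : E3 → E3} {ε : ℝ} {γ : ℝ → E3}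
    (h : FollowsSides V V' ε γ) : Continuous γ := by
  rw [continuous_iff_continuousAt]
  intro t
  obtain ⟨δ, hδ, h1, h2⟩ := h t
  have c1 : ContinuousWithinAt γ (Icc t (t + δ)) t := by
    rcases h1 with h1 | h1 <;> exact h1.continuousOn t ⟨le_rfl, by linarith⟩
  have c2 : ContinuousWithinAt γ (Icc (t - δ) t) t := by
    rcases h2 with h2 | h2 <;> exact h2.continuousOn t ⟨by linarith, le_rfl⟩
  have := c2.union c1
  rw [Icc_union_Icc_eq_Icc (by linarith) (by linarith)] at this
  exact this.continuousAt (Icc_mem_nhds (by linarith) (by linarith))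

/-- A trajectory changes sides at a crossing point. -/
theorem FollowsSides.crosses {V V' : E3 → E3} {ε κ : ℝ} {γ : ℝ → E3}
    (h : FollowsSides V V' ε γ) {t : ℝ} (h0 : γ t 2 = 0) (h1 : 0 < κ * V (γ t) 2)
    (h2 : 0 < κ * V' (γ t) 2) :
    (∀ᶠ s in 𝓝[>] t, 0 < κ * γ s 2) ∧ (∀ᶠ s in 𝓝[<] t, κ * γ s 2 < 0) := by
  obtain ⟨δ, hδ, hr, hl⟩ := h t
  have m1 : t ∈ Icc t (t + δ) := ⟨le_rfl, by linarith⟩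
  have m2 : t ∈ Icc (t - δ) t := ⟨by linarith, le_rfl⟩
  constructor
  · rcases hr with hr | hr
    · exact eventually_pos_right_of_hasDerivWithinAt hδ ((hr.coord m1 2).const_mul κ)
        (by simp [h0]) h1
    · exact eventually_pos_right_of_hasDerivWithinAt hδ ((hr.coord m1 2).const_mul κ)
        (by simp [h0]) h2
  · rcases hl with hl | hl
    · exact eventually_neg_left_of_hasDerivWithinAt hδ ((hl.coord m2 2).const_mul κ)
        (by simp [h0]) h1
    · exact eventually_neg_left_of_hasDerivWithinAt hδ ((hl.coord m2 2).const_mul κ)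
        (by simp [h0]) h2

/-- Between two times a trajectory that is on the open side `ε` is an arc of `V`. -/
theorem FollowsSides.isArc {V V' : E3 → E3} {ε : ℝ} {γ : ℝ → E3} (h : FollowsSides V V' ε γ)
    {M : Set E3} (hM : ∀ t, γ t ∈ M) {t₁ t₂ : ℝ} (ht : t₁ < t₂)
    (hpos : ∀ t ∈ Ioo t₁ t₂, 0 < ε * γ t 2) : IsArc V (M ∩ side ε) γ (Icc t₁ t₂) := by
  have hside : ∀ t ∈ Icc t₁ t₂, γ t ∈ side ε := by
    intro t htt
    have hcl : IsClosed (γ ⁻¹' side ε) := (isClosed_side ε).preimage h.continuous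
    rw [← closure_Ioo ht.ne] at htt
    exact closure_minimal (fun s hs => (hpos s hs).le) hcl htt
  intro t htt
  refine ⟨⟨hM t, hside t htt⟩, ?_⟩
  obtain ⟨δ, hδ, hr, hl⟩ := h t
  have d1 : HasDerivWithinAt γ (V (γ t)) (Icc t t₂) t := by
    rcases htt.2.eq_or_lt with rfl | hlt
    · rw [Icc_self]; exact HasFDerivWithinAt.singleton
    · rcases hr with hr | hr
      · exact (hr t ⟨le_rfl, by linarith⟩).2.mono_of_mem_nhdsWithin (by
          filter_upwards [self_mem_nhdsWithin,
            mem_nhdsWithin_of_mem_nhds (Iio_mem_nhds (show t < t + δ by linarith))] with s hs hs'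
          exact ⟨hs.1, le_of_lt hs'⟩)
      -- An arc of `V'` would have `ε z ≤ 0` just after `t`. The midpoint in `s` keeps the test time
      -- inside the open interval.
      · exfalso
        set s := min (t + δ) ((t + t₂) / 2)
        have hs1 : t < s := lt_min (by linarith) (by linarith)
        have hs2 : s ≤ (t + t₂) / 2 := min_le_right _ _
        have a1 := hpos s ⟨by linarith [htt.1], by linarith⟩
        have a2 : 0 ≤ -ε * γ s 2 := (hr s ⟨hs1.le, min_le_left _ _⟩).1
        linarith
  have d2 : HasDerivWithinAt γ (V (γ t)) (Icc t₁ t) t := by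
    rcases htt.1.eq_or_lt with rfl | hlt
    · rw [Icc_self]; exact HasFDerivWithinAt.singleton
    · rcases hl with hl | hl
      · exact (hl t ⟨by linarith, le_rfl⟩).2.mono_of_mem_nhdsWithin (by
          filter_upwards [self_mem_nhdsWithin,
            mem_nhdsWithin_of_mem_nhds (Ioi_mem_nhds (show t - δ < t by linarith))] with s hs hs'
          exact ⟨le_of_lt hs', hs.2⟩)
      · exfalso
        set s := max (t - δ) ((t + t₁) / 2)
        have hs1 : s < t := max_lt (by linarith) (by linarith)
        have hs2 : (t + t₁) / 2 ≤ s := le_max_right _ _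
        have a1 := hpos s ⟨by linarith, by linarith [htt.2]⟩
        have a2 : 0 ≤ -ε * γ s 2 := (hl s ⟨le_max_left _ _, hs1.le⟩).1
        linarith
  have := d2.union d1
  rwa [Icc_union_Icc_eq_Icc htt.1 htt.2] at this

/-- The part of a trajectory on one side, between consecutive crossings. Here `f` parametrizes the
trajectory as `γ = f ∘ τ`; the parameter `τ` is increasing in time, and it describes which points
are reached from which. -/
theorem FollowsSides.orbit_arc {V V' : E3 → E3} {ε : ℝ} {γ : ℝ → E3}
    (h : FollowsSides V V' ε γ) {M : Set E3} (hM : ∀ t, γ t ∈ M) {C : NNReal}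
    (hC : LipschitzOnWith C V (M ∩ side ε)) {t₁ t₂ : ℝ} (ht : t₁ < t₂)
    (hpos : ∀ t ∈ Ioo t₁ t₂, 0 < ε * γ t 2) {f : ℝ → E3} {τ : ℝ → ℝ} (hτ : Continuous τ)
    (hfτ : ∀ t, γ t = f (τ t)) (hτI : ∀ t ∈ Ioo t₁ t₂, τ t ∈ Ioo (τ t₁) (τ t₂))
    (h2 : f (τ t₂) 2 = 0) (hne : f (τ t₁) ≠ f (τ t₂)) (hexit : ε * V (f (τ t₂)) 2 < 0) :
    (∀ θ ∈ Icc (τ t₁) (τ t₂), ∀ θ' ∈ Icc (τ t₁) (τ t₂), θ ≤ θ' →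
      Reaches V (M ∩ side ε) (f θ) (f θ')) ∧
    (∀ θ ∈ Icc (τ t₁) (τ t₂), ∀ q, Reaches V (M ∩ side ε) (f θ) q →
      ∃ θ' ∈ Icc θ (τ t₂), q = f θ') ∧
    (∀ θ ∈ Icc (τ t₁) (τ t₂), ∀ θ' ∈ Icc (τ t₁) (τ t₂), θ < θ' →
      (∀ x ∈ Icc θ θ', 0 < V (f x) 2) → f θ 2 < f θ' 2) := by
  have harc := h.isArc hM ht hpos
  have hinj : InjOn τ (Icc t₁ t₂) := by
    -- If `τ s = τ t` with `s < t`, the arcs from `γ s` and `γ t` coincide, so the curve is at the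
    -- end point `f (τ t₂)` already at time `s + (t₂ - t) < t₂`. That point is on Σ, which excludes
    -- interior times, and it is not the initial point, which excludes `t₁`.
    have key : ∀ s ∈ Icc t₁ t₂, ∀ t ∈ Icc t₁ t₂, s < t → τ s ≠ τ t := by
      intro s hs t ht' hst heq
      have a1 := (harc.mono Subset.rfl (Icc_subset_Icc_left ht'.1)).shift t
      have a2 := (harc.mono Subset.rfl (show Icc s (s + (t₂ - t)) ⊆ Icc t₁ t₂ from
        Icc_subset_Icc hs.1 (by linarith))).shift s
      rw [sub_self] at a1 a2
      rw [show s + (t₂ - t) - s = t₂ - t by ring] at a2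
      have e := a1.eqOn hC a2 (by simp [hfτ, heq]) (show t₂ - t ∈ Icc 0 (t₂ - t) from
        ⟨by linarith [ht'.2], le_rfl⟩)
      simp only [sub_add_cancel] at e
      rcases (show t₁ ≤ t₂ - t + s by linarith [hs.1, ht'.2]).eq_or_lt with h3 | h3
      · rw [← h3, hfτ, hfτ] at e
        exact hne e.symm
      · have := hpos _ ⟨h3, by linarith⟩
        rw [← e, hfτ, h2] at this
        simp at this
    intro s hs t ht' heq
    rcases lt_trichotomy s t with h3 | h3 | h3
    · exact absurd heq (key s hs t ht' h3)
    · exact h3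
    · exact absurd heq.symm (key t ht' s hs h3)
  have hle : τ t₁ ≤ τ t₂ := by
    have := hτI ((t₁ + t₂) / 2) ⟨by linarith, by linarith⟩
    exact (this.1.trans this.2).le
  have hmono : StrictMonoOn τ (Icc t₁ t₂) :=
    ContinuousOn.strictMonoOn_of_injOn_Icc ht.le hle hτ.continuousOn hinj
  have hsurj : ∀ θ ∈ Icc (τ t₁) (τ t₂), ∃ t ∈ Icc t₁ t₂, τ t = θ := fun θ hθ =>
    intermediate_value_Icc ht.le hτ.continuousOn hθ
  refine ⟨?_, ?_, ?_⟩
  · intro θ hθ θ' hθ' hθθ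
    obtain ⟨s, hs, rfl⟩ := hsurj θ hθ
    obtain ⟨s', hs', rfl⟩ := hsurj θ' hθ'
    rw [← hfτ, ← hfτ]
    exact (harc.mono Subset.rfl (Icc_subset_Icc hs.1 hs'.2)).reaches
      ((hmono.le_iff_le hs hs').1 hθθ)
  · rintro θ hθ q ⟨δ, T, hT, hδ, h0, rfl⟩
    obtain ⟨s, hs, rfl⟩ := hsurj θ hθ
    have a1 := (harc.mono Subset.rfl (Icc_subset_Icc_left hs.1)).shift s
    rw [sub_self] at a1
    -- A competing arc agrees with `γ` up to the exit point, where `ε V.f < 0`; continuing further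
    -- would take it out of the side.
    have hTle : T ≤ t₂ - s := by
      by_contra hcon
      push Not at hcon
      have e := (hδ.mono Subset.rfl (Icc_subset_Icc_right hcon.le)).eqOn hC a1
        (by simp [h0, hfτ]) (show t₂ - s ∈ Icc 0 (t₂ - s) from ⟨by linarith [hs.2], le_rfl⟩)
      simp only [sub_add_cancel] at e
      rw [hfτ] at e
      have hd := (hδ.mono Subset.rfl (show Icc (t₂ - s) (t₂ - s + (T - (t₂ - s))) ⊆ Icc 0 T from
        Icc_subset_Icc (by linarith [hs.2]) (by linarith))).coord (t := t₂ - s)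
        ⟨le_rfl, by linarith⟩ 2
      have hev := eventually_pos_right_of_hasDerivWithinAt (by linarith)
        (hd.const_mul (-ε)) (by rw [e, h2, mul_zero]) (by rw [e]; linarith)
      have hev2 : ∀ᶠ x in 𝓝[>] (t₂ - s), x ∈ Icc 0 T := by
        filter_upwards [self_mem_nhdsWithin, mem_nhdsWithin_of_mem_nhds (Iio_mem_nhds hcon)]
          with x hx hx'
        exact ⟨by linarith [hs.2, mem_Ioi.1 hx], le_of_lt hx'⟩
      obtain ⟨x, hx, hx'⟩ := (hev.and hev2).exists
      have : 0 ≤ ε * δ x 2 := (hδ x hx').1.2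
      linarith
    have e := hδ.eqOn hC (a1.mono Subset.rfl (Icc_subset_Icc_right hTle)) (by simp [h0, hfτ])
      (show T ∈ Icc 0 T from ⟨hT, le_rfl⟩)
    have hm : T + s ∈ Icc t₁ t₂ := ⟨by linarith [hs.1], by linarith⟩
    refine ⟨τ (T + s), ⟨hmono.monotoneOn hs hm (by linarith),
      hmono.monotoneOn hm ⟨ht.le, le_rfl⟩ hm.2⟩, ?_⟩
    rw [e]
    exact hfτ _
  · intro θ hθ θ' hθ' hθθ hV
    obtain ⟨s, hs, rfl⟩ := hsurj θ hθ
    obtain ⟨s', hs', rfl⟩ := hsurj θ' hθ'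
    have hss : s < s' := (hmono.lt_iff_lt hs hs').1 hθθ
    have hsub : Icc s s' ⊆ Icc t₁ t₂ := Icc_subset_Icc hs.1 hs'.2
    have hm : StrictMonoOn (fun t => γ t 2) (Icc s s') := by
      refine strictMonoOn_of_hasDerivWithinAt_pos (f' := fun t => V (γ t) 2) (convex_Icc _ _) ?_ ?_ ?_
      · intro t ht'
        exact (harc.coord (hsub ht') 2).continuousWithinAt.mono hsub
      · intro t ht'
        rw [interior_Icc] at ht' ⊢
        exact (harc.coord (hsub ⟨ht'.1.le, ht'.2.le⟩) 2).mono
          (Ioo_subset_Icc_self.trans hsub)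
      · intro t ht'
        rw [interior_Icc] at ht'
        have ht'' : t ∈ Icc t₁ t₂ := hsub ⟨ht'.1.le, ht'.2.le⟩
        rw [hfτ]
        exact hV _ ⟨hmono.monotoneOn hs ht'' ht'.1.le, hmono.monotoneOn ht'' hs' ht'.2.le⟩
    have := hm ⟨le_rfl, hss.le⟩ ⟨hss.le, le_rfl⟩ hss
    simpa only [hfτ] using this

/-! ### Cylinders of periodic orbits in coordinates `θ`, `u`, `s` -/

/-- A continuum of cylinders of periodic orbits around a curve of folds, parametrized by an angle
`θ ∈ ℝ` instead of a point of the circle. -/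
structure Cylinders (Z : PiecewiseField) (M : Set E3) (φ : ℝ → ℝ → ℝ → E3) : Prop where
  compact : IsCompact M
  regX : RegularOn Z.X (M ∩ side 1)
  regY : RegularOn Z.Y (M ∩ side (-1))
  cross : ∀ p ∈ M, p 2 = 0 → Z.IsCrossing p ∨ Z.IsInvisibleTwoFold p
  cont : Continuous fun p : ℝ × ℝ × ℝ => φ p.1 p.2.1 p.2.2
  mem : ∀ θ u s, φ θ u s ∈ M
  surj : ∀ p ∈ M, ∃ θ, ∃ u ∈ Icc (0 : ℝ) 1, ∃ s ∈ Icc (0 : ℝ) 1, p = φ θ u s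
  inj : ∀ θ θ', ∀ u ∈ Icc (0 : ℝ) 1, ∀ u' ∈ Icc (0 : ℝ) 1, ∀ s ∈ Icc (0 : ℝ) 1,
    ∀ s' ∈ Icc (0 : ℝ) 1, φ θ u s = φ θ' u' s' →
      u = u' ∧ s = s' ∧ (s = 0 ∨ ∃ n : ℤ, θ' = θ + n * (2 * Real.pi))
  periodic : ∀ u s, Function.Periodic (fun θ => φ θ u s) (2 * Real.pi)
  axis : ∀ θ u, φ θ u 0 = φ 0 u 0
  fold : ∀ u ∈ Icc (0 : ℝ) 1, Z.IsInvisibleTwoFold (φ 0 u 0)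
  orbit : ∀ u ∈ Icc (0 : ℝ) 1, ∀ s ∈ Ioc (0 : ℝ) 1, ∃ (γ : ℝ → E3) (T : ℝ), 0 < T ∧
    Z.IsTrajectory γ ∧ Function.Periodic γ T ∧ range γ = range fun θ => φ θ u s
  lift : ∀ u ∈ Icc (0 : ℝ) 1, ∀ s ∈ Ioc (0 : ℝ) 1, ∀ γ : ℝ → E3, Continuous γ →
    (∀ t, ∃ θ, γ t = φ θ u s) → ∃ τ : ℝ → ℝ, Continuous τ ∧ ∀ t, γ t = φ (τ t) u s

theorem exists_cylinders {r : WithTop ℕ∞} (hr : 1 ≤ r) {Z : PiecewiseField} {M : Set E3}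
    (hM : IsCompactRegion M) (hZ : Z.SmoothOn r M)
    (hcross : ∀ p ∈ M ∩ switching, Z.IsCrossing p ∨ Z.IsInvisibleTwoFold p)
    (hcyl : Z.HasCylinderContinuum M) : ∃ φ, Cylinders Z M φ := by
  obtain ⟨Φ, hΦ, hrange, hinj, hfold, horb⟩ := hcyl
  have h01 : (0 : ℝ) ≤ 1 := zero_le_one
  have hs0 : ∀ s ∈ Ioc (0 : ℝ) 1, projIcc 0 1 h01 s ≠ 0 := by
    intro s hs h
    rw [projIcc_of_mem h01 ⟨hs.1.le, hs.2⟩] at h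
    have := congrArg Subtype.val h
    simp only at this
    exact hs.1.ne' this
  have hrng : ∀ u s, (range fun θ : Circle => Φ (θ, u, s)) =
      range fun θ : ℝ => Φ (Circle.exp θ, u, s) := by
    intro u s
    ext p
    constructor
    · rintro ⟨θ, rfl⟩
      exact ⟨Complex.arg θ, by simp [Circle.exp_arg]⟩
    · rintro ⟨θ, rfl⟩
      exact ⟨_, rfl⟩
  -- Clamping `u` and `s` makes `φ` continuous on all of `ℝ³`, so that continuity needs no domain.
  refine ⟨fun θ u s => Φ (Circle.exp θ, projIcc 0 1 h01 u, projIcc 0 1 h01 s), ?_⟩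
  constructor
  · exact hM.1
  · obtain ⟨U, hU, hMU, hX⟩ := hZ.1
    exact ⟨U, hU, by rwa [← upperSide_eq_side], hX.of_le hr⟩
  · obtain ⟨U, hU, hMU, hX⟩ := hZ.2
    exact ⟨U, hU, by rwa [← lowerSide_eq_side], hX.of_le hr⟩
  · exact fun p hp h0 => hcross p ⟨hp, h0⟩
  · refine hΦ.comp (Continuous.prodMk ?_ (Continuous.prodMk ?_ ?_))
    · exact Circle.exp.continuous.comp continuous_fst
    · exact continuous_projIcc.comp (by fun_prop)
    · exact continuous_projIcc.comp (by fun_prop)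
  · intro θ u s
    rw [← hrange]
    exact mem_range_self _
  · intro p hp
    rw [← hrange] at hp
    obtain ⟨⟨θ, u, s⟩, rfl⟩ := hp
    refine ⟨Complex.arg θ, u, u.2, s, s.2, ?_⟩
    rw [Circle.exp_arg, projIcc_val, projIcc_val]
  · intro θ θ' u hu u' hu' s hs s' hs' h
    rw [hinj, projIcc_of_mem h01 hu, projIcc_of_mem h01 hu', projIcc_of_mem h01 hs,
      projIcc_of_mem h01 hs'] at h
    obtain ⟨h1, h2, h3⟩ := h
    refine ⟨congrArg Subtype.val h1, congrArg Subtype.val h2, ?_⟩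
    rcases h3 with h3 | h3
    · exact Or.inl (congrArg Subtype.val h3)
    · right
      obtain ⟨n, hn⟩ := Circle.exp_eq_exp.1 h3.symm
      exact ⟨n, hn⟩
  · intro u s θ
    simp only [Circle.periodic_exp θ]
  · intro θ u
    rw [hinj]
    exact ⟨rfl, rfl, Or.inl (by ext; simp)⟩
  · intro u hu
    have : projIcc 0 1 h01 (0 : ℝ) = 0 := by ext; simp
    rw [this]
    exact hfold _ _
  · intro u hu s hs
    obtain ⟨-, γ, T, hT, h1, h2, h3⟩ := horb (projIcc 0 1 h01 u) (projIcc 0 1 h01 s) (hs0 s hs)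
    exact ⟨γ, T, hT, h1, h2, by rw [h3, hrng]⟩
  · intro u hu s hs γ hγ hγr
    -- For `s > 0` the circle is embedded by compactness, so the point of `Circle` depends
    -- continuously on time, and its logarithm provides the lifted angle `τ`.
    have hce : IsClosedEmbedding fun θ : Circle => Φ (θ, projIcc 0 1 h01 u, projIcc 0 1 h01 s) := by
      refine Continuous.isClosedEmbedding (by fun_prop) fun θ θ' h => ?_
      exact ((hinj _ _ _ _ _ _).1 h).2.2.resolve_left (hs0 s hs)
    choose e he using hγr
    have hec : Continuous fun t => Circle.exp (e t) := by
      rw [hce.isInducing.continuous_iff]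
      convert hγ using 1
      funext t
      exact (he t).symm
    obtain ⟨L, hL, hLe⟩ := exists_continuous_log (f := fun t : ℝ => ((Circle.exp (e t) : Circle) : ℂ))
      (Continuous.comp (by fun_prop) hec) (fun t => Circle.coe_ne_zero _)
    refine ⟨fun t => (L t).im, Complex.continuous_im.comp hL, fun t => ?_⟩
    rw [he t]
    congr 2
    ext
    rw [← hLe t, Circle.coe_exp]
    have hre : (L t).re = 0 := by
      have h1 : ‖Complex.exp (L t)‖ = 1 := by rw [hLe t]; exact Circle.norm_coe _
      rw [Complex.norm_exp, Real.exp_eq_one_iff] at h1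
      exact h1
    congr 1
    apply Complex.ext <;> simp [hre]

namespace Cylinders

variable {Z : PiecewiseField} {M : Set E3} {φ : ℝ → ℝ → ℝ → E3}

/-- The same cylinders, with the circles traversed backwards. -/
theorem reverse (H : Cylinders Z M φ) : Cylinders Z M (fun θ => φ (-θ)) where
  compact := H.compact
  regX := H.regX
  regY := H.regY
  cross := H.cross
  cont := H.cont.comp (f := fun p : ℝ × ℝ × ℝ => (-p.1, p.2.1, p.2.2)) (by fun_prop)
  mem θ := H.mem (-θ)
  surj p hp := by
    obtain ⟨θ, u, hu, s, hs, h⟩ := H.surj p hp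
    exact ⟨-θ, u, hu, s, hs, by rw [neg_neg]; exact h⟩
  inj θ θ' u hu u' hu' s hs s' hs' h := by
    obtain ⟨h1, h2, h3⟩ := H.inj _ _ u hu u' hu' s hs s' hs' h
    refine ⟨h1, h2, h3.imp_right ?_⟩
    rintro ⟨n, hn⟩
    exact ⟨-n, by push_cast; linarith⟩
  periodic u s θ := by
    have := H.periodic u s (-(θ + 2 * Real.pi))
    simp only at this ⊢
    rw [← this]; congr 1; ring
  axis θ u := by rw [H.axis, H.axis (-0)]
  fold u hu := by rw [H.axis]; exact H.fold u hu
  orbit u hu s hs := by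
    obtain ⟨γ, T, hT, h1, h2, h3⟩ := H.orbit u hu s hs
    refine ⟨γ, T, hT, h1, h2, ?_⟩
    rw [h3]
    exact ((Equiv.neg ℝ).surjective.range_comp (fun θ => φ θ u s)).symm
  lift u hu s hs γ hγ h := by
    obtain ⟨τ, hτ, hτe⟩ := H.lift u hu s hs γ hγ (fun t => by
      obtain ⟨θ, hθ⟩ := h t
      exact ⟨-θ, hθ⟩)
    exact ⟨fun t => -τ t, hτ.neg, fun t => by rw [neg_neg]; exact hτe t⟩

/-- Compactness of one period of `θ`: the circles shrink to the axis uniformly in the angle. This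
replaces continuity of the angle at the axis, where it has no limit. -/
theorem eventually_forall_mem (H : Cylinders Z M φ) (u₀ : ℝ) {W : Set E3}
    (hW : W ∈ 𝓝 (φ 0 u₀ 0)) : ∀ᶠ p : ℝ × ℝ in 𝓝 (u₀, 0), ∀ θ, φ θ p.1 p.2 ∈ W := by
  have h := (isCompact_Icc (a := (0 : ℝ)) (b := 2 * Real.pi)).eventually_forall_of_forall_eventually
    (x₀ := (u₀, (0 : ℝ))) (P := fun p θ => φ θ p.1 p.2 ∈ W) (by
      intro θ _
      have hc : Continuous fun z : (ℝ × ℝ) × ℝ => φ z.2 z.1.1 z.1.2 :=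
        H.cont.comp (f := fun z : (ℝ × ℝ) × ℝ => (z.2, z.1.1, z.1.2)) (by fun_prop)
      refine hc.continuousAt.preimage_mem_nhds ?_
      simp only
      rwa [H.axis])
  filter_upwards [h] with p hp θ
  obtain ⟨y, hy, hye⟩ := (H.periodic p.1 p.2).exists_mem_Ico₀ Real.two_pi_pos θ
  rw [hye]
  exact hp y ⟨hy.1, hy.2.le⟩

/-- At an invisible two-fold each field bends out of its own side, so no arc of either can start
there. -/
theorem orbit_not_fold (H : Cylinders Z M φ) {u s : ℝ} (hu : u ∈ Icc (0 : ℝ) 1)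
    (hs : s ∈ Ioc (0 : ℝ) 1) (θ : ℝ) : ¬ Z.IsInvisibleTwoFold (φ θ u s) := by
  rintro ⟨h0, h1, h2, h3, h4⟩
  obtain ⟨γ, T, hT, hγ, -, hr⟩ := H.orbit u hu s hs
  obtain ⟨t, ht⟩ : φ θ u s ∈ range γ := by rw [hr]; exact ⟨θ, rfl⟩
  have hm := H.mem θ u s
  rw [← ht] at h0 h1 h2 h3 h4 hm
  have h0' : γ t 2 = 0 := h0
  rw [lieDeriv_height] at h1 h3
  obtain ⟨δ, hδ, h5, -⟩ := hγ.followsSides t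
  rcases h5 with h5 | h5
  · exact not_isArc_of_fold hδ ((H.regX.contDiffAt ⟨hm, by simp [side, h0']⟩).differentiableAt
      one_ne_zero) h0' h1 (by linarith) h5
  · exact not_isArc_of_fold hδ ((H.regY.contDiffAt ⟨hm, by simp [side, h0']⟩).differentiableAt
      one_ne_zero) h0' h3 (by linarith) h5

theorem crossing (H : Cylinders Z M φ) {u s : ℝ} (hu : u ∈ Icc (0 : ℝ) 1)
    (hs : s ∈ Ioc (0 : ℝ) 1) {θ : ℝ} (h0 : φ θ u s 2 = 0) :
    0 < Z.X (φ θ u s) 2 * Z.Y (φ θ u s) 2 := by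
  have := ((H.cross _ (H.mem θ u s) h0).resolve_right (H.orbit_not_fold hu hs θ)).2
  rwa [lieDeriv_height, lieDeriv_height] at this

end Cylinders

/-! ### The angular coordinate defined by the crossings -/

/-- `α` is an angular coordinate around the axis of the cylinders, with index `m`: the orbits
meet the switching manifold upwards where `α ∈ 2πℤ` and downwards where `α ∈ π + 2πℤ`. -/
structure IsAngle (Z : PiecewiseField) (φ : ℝ → ℝ → ℝ → E3) (α : ℝ → ℝ → ℝ → ℝ) (m : ℤ) :
    Prop where
  cont : ContinuousOn (fun p : ℝ × ℝ × ℝ => α p.1 p.2.1 p.2.2) {p | 0 < p.2.2}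
  index : ∀ θ u s (k : ℤ), α (θ + k * (2 * Real.pi)) u s = α θ u s + (k * m : ℤ) * (2 * Real.pi)
  height : ∀ θ, ∀ u ∈ Icc (0 : ℝ) 1, ∀ s ∈ Ioc (0 : ℝ) 1,
    ∃ R > 0, φ θ u s 2 = R * Real.sin (α θ u s)
  cross : ∀ θ, ∀ u ∈ Icc (0 : ℝ) 1, ∀ s ∈ Ioc (0 : ℝ) 1, φ θ u s 2 = 0 →
    0 < Real.cos (α θ u s) * Z.X (φ θ u s) 2 ∧ 0 < Real.cos (α θ u s) * Z.Y (φ θ u s) 2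

theorem IsAngle.reverse {Z : PiecewiseField} {φ : ℝ → ℝ → ℝ → E3} {α : ℝ → ℝ → ℝ → ℝ} {m : ℤ}
    (h : IsAngle Z φ α m) : IsAngle Z (fun θ => φ (-θ)) (fun θ => α (-θ)) (-m) where
  cont := h.cont.comp (f := fun p : ℝ × ℝ × ℝ => (-p.1, p.2.1, p.2.2)) (by fun_prop)
    (fun p hp => hp)
  index θ u s k := by
    have := h.index (-θ) u s (-k)
    rw [show -(θ + k * (2 * Real.pi)) = -θ + (-k : ℤ) * (2 * Real.pi) by push_cast; ring, this]
    push_cast; ring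
  height θ := h.height (-θ)
  cross θ := h.cross (-θ)

/-- `α` is the argument of `ω = c + iz`, where `c` has the sign of `X.f` on crossing points. Where
`z = 0` off the axis, `c ≠ 0`, so `ω` has a logarithm on the simply connected space of `(u, log s,
θ)`. -/
theorem Cylinders.exists_isAngle {Z : PiecewiseField} {M : Set E3} {φ : ℝ → ℝ → ℝ → E3}
    (H : Cylinders Z M φ) : ∃ α m, IsAngle Z φ α m := by
  have hXc : ContinuousOn (fun p => Z.X p 2) (M ∩ {p | p 2 = 0}) := by
    intro p hp
    have : ContinuousAt Z.X p := H.regX.continuousAt ⟨hp.1, by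
      have : p 2 = 0 := hp.2
      simp [side, this]⟩
    have h2 : Continuous fun q : E3 => q 2 := by fun_prop
    exact (h2.continuousAt.comp this).continuousWithinAt
  have hcl : IsClosed (M ∩ {p : E3 | p 2 = 0}) :=
    H.compact.isClosed.inter (isClosed_eq (by fun_prop) continuous_const)
  set P : Set E3 := (M ∩ {p : E3 | p 2 = 0}) ∩ (fun p => Z.X p 2) ⁻¹' Ici 0
  set N : Set E3 := (M ∩ {p : E3 | p 2 = 0}) ∩ (fun p => Z.X p 2) ⁻¹' Iic 0
  have hP : IsClosed P := hXc.preimage_isClosed_of_isClosed hcl isClosed_Ici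
  have hN : IsClosed N := hXc.preimage_isClosed_of_isClosed hcl isClosed_Iic
  have hax := H.fold 0 ⟨le_rfl, zero_le_one⟩
  obtain ⟨ha0, ha1, -⟩ := hax
  rw [lieDeriv_height] at ha1
  have hPn : P.Nonempty := ⟨φ 0 0 0, ⟨H.mem _ _ _, ha0⟩, ge_of_eq ha1⟩
  have hNn : N.Nonempty := ⟨φ 0 0 0, ⟨H.mem _ _ _, ha0⟩, le_of_eq ha1⟩
  -- The sets `P` and `N` share the folds, where `X.f = 0`. The difference of distances is positive
  -- on `P \ N`, negative on `N \ P`, and continuous on all of space, even where `X` is not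
  -- controlled.
  set c : E3 → ℝ := fun p => infDist p N - infDist p P with hc
  have hcc : Continuous c := (continuous_infDist_pt N).sub (continuous_infDist_pt P)
  have hcpos : ∀ p ∈ M, p 2 = 0 → 0 < Z.X p 2 → 0 < c p := by
    intro p hp h0 hX
    have h1 : infDist p P = 0 := infDist_zero_of_mem ⟨⟨hp, h0⟩, hX.le⟩
    have h2 : 0 < infDist p N := (hN.notMem_iff_infDist_pos hNn).1 fun h => by
      have : Z.X p 2 ≤ 0 := h.2
      linarith
    simp only [hc, h1]; linarith
  have hcneg : ∀ p ∈ M, p 2 = 0 → Z.X p 2 < 0 → c p < 0 := by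
    intro p hp h0 hX
    have h1 : infDist p N = 0 := infDist_zero_of_mem ⟨⟨hp, h0⟩, hX.le⟩
    have h2 : 0 < infDist p P := (hP.notMem_iff_infDist_pos hPn).1 fun h => by
      have : 0 ≤ Z.X p 2 := h.2
      linarith
    simp only [hc, h1]; linarith
  set ω : E3 → ℂ := fun p => (c p : ℂ) + (p 2 : ℝ) * Complex.I with hω
  have hωc : Continuous ω := by fun_prop
  have hω0 : ∀ θ, ∀ u ∈ Icc (0 : ℝ) 1, ∀ s ∈ Ioc (0 : ℝ) 1, ω (φ θ u s) ≠ 0 := by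
    intro θ u hu s hs h
    have him : φ θ u s 2 = 0 := by simpa [hω] using congrArg Complex.im h
    have hre : c (φ θ u s) = 0 := by simpa [hω] using congrArg Complex.re h
    rcases pos_and_pos_or_neg_and_neg_of_mul_pos (H.crossing hu hs him) with h | h
    · exact (hcpos _ (H.mem _ _ _) him h.1).ne' hre
    · exact (hcneg _ (H.mem _ _ _) him h.1).ne hre
  have h01 : (0 : ℝ) ≤ 1 := zero_le_one
  obtain ⟨L, hL, hLe⟩ := exists_continuous_log
    -- The variable `log s` removes the axis; the `min` and the projection keep the parameters in
    -- the cylinders.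
    (f := fun p : (ℝ × ℝ) × ℝ => ω (φ p.2 (projIcc 0 1 h01 p.1.1) (Real.exp (min p.1.2 0))))
    (hωc.comp (H.cont.comp (f := fun p : (ℝ × ℝ) × ℝ =>
      (p.2, ((projIcc 0 1 h01 p.1.1 : ℝ), Real.exp (min p.1.2 0)))) (by
        have : Continuous fun p : (ℝ × ℝ) × ℝ => (projIcc 0 1 h01 p.1.1 : ℝ) :=
          continuous_subtype_val.comp (continuous_projIcc.comp (by fun_prop))
        fun_prop)))
    (fun p => hω0 _ _ (projIcc 0 1 h01 p.1.1).2 _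
      ⟨Real.exp_pos _, Real.exp_le_one_iff.2 (min_le_right _ _)⟩)
  obtain ⟨m, hm⟩ := exists_monodromy hL (fun x θ => by
    rw [hLe, hLe]
    exact congrArg ω (H.periodic _ _ θ))
  have key : ∀ θ, ∀ u ∈ Icc (0 : ℝ) 1, ∀ s ∈ Ioc (0 : ℝ) 1,
      Complex.exp (L ((u, Real.log s), θ)) = ω (φ θ u s) := by
    intro θ u hu s hs
    rw [hLe]
    simp only
    rw [projIcc_of_mem h01 hu, min_eq_left (Real.log_nonpos hs.1.le hs.2), Real.exp_log hs.1]
  have him : ∀ θ, ∀ u ∈ Icc (0 : ℝ) 1, ∀ s ∈ Ioc (0 : ℝ) 1,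
      φ θ u s 2 = Real.exp (L ((u, Real.log s), θ)).re * Real.sin (L ((u, Real.log s), θ)).im := by
    intro θ u hu s hs
    have := congrArg Complex.im (key θ u hu s hs)
    rw [Complex.exp_im] at this
    rw [this]; simp [hω]
  have hre : ∀ θ, ∀ u ∈ Icc (0 : ℝ) 1, ∀ s ∈ Ioc (0 : ℝ) 1,
      c (φ θ u s) = Real.exp (L ((u, Real.log s), θ)).re * Real.cos (L ((u, Real.log s), θ)).im := by
    intro θ u hu s hs
    have := congrArg Complex.re (key θ u hu s hs)
    rw [Complex.exp_re] at this
    rw [this]; simp [hω]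
  refine ⟨fun θ u s => (L ((u, Real.log s), θ)).im, m, ?_, ?_, ?_, ?_⟩
  · refine Complex.continuous_im.comp_continuousOn (hL.comp_continuousOn ?_)
    refine ContinuousOn.prodMk (ContinuousOn.prodMk (by fun_prop) ?_) (by fun_prop)
    exact ContinuousOn.log (by fun_prop) fun p hp => ne_of_gt hp
  · intro θ u s k
    simp only [hm]
    simp
  · exact fun θ u hu s hs => ⟨_, Real.exp_pos _, him θ u hu s hs⟩
  · intro θ u hu s hs h0
    have hc' := hre θ u hu s hs
    have hpos := Real.exp_pos (L ((u, Real.log s), θ)).re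
    simp only
    rcases pos_and_pos_or_neg_and_neg_of_mul_pos (H.crossing hu hs h0) with h | h
    · have := hcpos _ (H.mem θ u s) h0 h.1
      rw [hc'] at this
      have := (mul_pos_iff_of_pos_left hpos).1 this
      exact ⟨mul_pos this h.1, mul_pos this h.2⟩
    · have := hcneg _ (H.mem θ u s) h0 h.1
      rw [hc'] at this
      have : Real.cos (L ((u, Real.log s), θ)).im < 0 := by
        by_contra hcon
        push Not at hcon
        linarith [mul_nonneg hpos.le hcon]
      exact ⟨mul_pos_of_neg_of_neg this h.1, mul_pos_of_neg_of_neg this h.2⟩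

/-! ### Each level of the angle is passed once; the index is not zero -/

/-- The first later return to the level would arrive from above, but every passage comes from below.
The statement for earlier times follows: a value `≥ l` before `t₁` would force a passage before
`t₁`, after which the function stays above `l`. -/
theorem forall_lt_of_crosses_upward {ψ : ℝ → ℝ} (hψ : Continuous ψ) {l : ℝ}
    (h : ∀ t, ψ t = l → (∀ᶠ s in 𝓝[>] t, l < ψ s) ∧ (∀ᶠ s in 𝓝[<] t, ψ s < l)) {t₁ : ℝ}
    (h1 : ψ t₁ = l) : (∀ t > t₁, l < ψ t) ∧ (∀ t < t₁, ψ t < l) := by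
  have right : ∀ t₁, ψ t₁ = l → ∀ t > t₁, l < ψ t := by
    intro t₁ h1 t ht
    by_contra hcon
    push Not at hcon
    obtain ⟨s₀, hs₀, hs₀'⟩ := ((h t₁ h1).1.and (Ioo_mem_nhdsGT ht)).exists
    set S : Set ℝ := Icc s₀ t ∩ {x | ψ x ≤ l}
    have hS : IsCompact S := isCompact_Icc.inter_right (isClosed_le hψ continuous_const)
    obtain ⟨x, hx, hxmin⟩ := hS.exists_isLeast ⟨t, ⟨hs₀'.2.le, le_rfl⟩, hcon⟩
    have hsx : s₀ < x := by
      rcases hx.1.1.eq_or_lt with h2 | h2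
      · have : ψ x ≤ l := hx.2
        rw [← h2] at this
        linarith
      · exact h2
    have hbefore : ∀ y ∈ Ico s₀ x, l < ψ y := by
      intro y hy
      by_contra hy'
      push Not at hy'
      have := hxmin ⟨⟨hy.1, hy.2.le.trans hx.1.2⟩, hy'⟩
      linarith [hy.2]
    have hx' : l ≤ ψ x := by
      have hm : x ∈ closure (Ioo s₀ x) := by rw [closure_Ioo hsx.ne]; exact ⟨hsx.le, le_rfl⟩
      exact closure_minimal (fun y hy => (hbefore y ⟨hy.1.le, hy.2⟩).le)
        (isClosed_le continuous_const hψ) hm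
    obtain ⟨y, hy, hy'⟩ := ((h x (le_antisymm hx.2 hx')).2.and (Ioo_mem_nhdsLT hsx)).exists
    linarith [hbefore y ⟨hy'.1.le, hy'.2⟩]
  refine ⟨right t₁ h1, fun t ht => ?_⟩
  by_contra hcon
  push Not at hcon
  obtain ⟨s₀, hs₀, hs₀'⟩ := ((h t₁ h1).2.and (Ioo_mem_nhdsLT ht)).exists
  obtain ⟨x, hx, hxe⟩ := intermediate_value_Icc' hs₀'.1.le hψ.continuousOn ⟨hs₀.le, hcon⟩
  linarith [right x hxe t₁ (hx.2.trans_lt hs₀'.2)]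

theorem surjective_of_quasiperiodic {f : ℝ → ℝ} (hf : Continuous f) {c d : ℝ} (hd : d ≠ 0)
    (h : ∀ k : ℤ, f (k * c) = f 0 + k * d) : Function.Surjective f := by
  intro y
  obtain ⟨n, hn⟩ := exists_nat_ge (|y - f 0| / |d|)
  rw [div_le_iff₀ (abs_pos.2 hd)] at hn
  have h1 := h n
  have h2 := h (-n)
  push_cast at h1 h2
  obtain ⟨h3, h4⟩ := abs_le.1 hn
  rcases hd.lt_or_gt with hd | hd
  · rw [abs_of_neg hd] at h3 h4
    exact mem_range_of_exists_le_of_exists_ge hf ⟨_, by rw [h1]; linarith⟩ ⟨_, by rw [h2]; linarith⟩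
  · rw [abs_of_pos hd] at h3 h4
    exact mem_range_of_exists_le_of_exists_ge hf ⟨_, by rw [h2]; linarith⟩ ⟨_, by rw [h1]; linarith⟩

namespace Cylinders

variable {Z : PiecewiseField} {M : Set E3} {φ : ℝ → ℝ → ℝ → E3} {α : ℝ → ℝ → ℝ → ℝ} {m : ℤ}

theorem continuous_angle (ha : IsAngle Z φ α m) (u : ℝ) {s : ℝ} (hs : 0 < s) :
    Continuous fun θ => α θ u s :=
  ha.cont.comp_continuous (f := fun θ : ℝ => (θ, u, s)) (by fun_prop) fun _ => hs

/-- At `α = kπ` both fields cross Σ in the direction given by the sign of `cos (kπ)`, while the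
height has the sign of `sin α`. So `α` increases through every level, upward or downward, and
`forall_lt_of_crosses_upward` applies to `α ∘ τ`. -/
theorem exists_orbit_time (H : Cylinders Z M φ) (ha : IsAngle Z φ α m) {u s : ℝ}
    (hu : u ∈ Icc (0 : ℝ) 1) (hs : s ∈ Ioc (0 : ℝ) 1) :
    ∃ (γ : ℝ → E3) (τ : ℝ → ℝ) (T : ℝ), 0 < T ∧ FollowsSides Z.X Z.Y 1 γ ∧
      Function.Periodic γ T ∧ Continuous τ ∧ (∀ t, γ t = φ (τ t) u s) ∧
      (∀ θ, ∃ t, γ t = φ θ u s) ∧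
      (∃ n : ℤ, ∀ t (j : ℤ), τ (t + j * T) = τ t + (j * n : ℤ) * (2 * Real.pi)) ∧
      ∀ t (k : ℤ), α (τ t) u s = k * Real.pi →
        (∀ t' > t, k * Real.pi < α (τ t') u s) ∧ (∀ t' < t, α (τ t') u s < k * Real.pi) := by
  obtain ⟨γ, T, hT, hγ, hper, hr⟩ := H.orbit u hu s hs
  have hγf := hγ.followsSides
  obtain ⟨τ, hτ, hτe⟩ := H.lift u hu s hs γ hγf.continuous (fun t => by
    have : γ t ∈ range γ := mem_range_self t
    rw [hr] at this
    obtain ⟨θ, hθ⟩ := this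
    exact ⟨θ, hθ.symm⟩)
  have hψ : Continuous fun t => α (τ t) u s := (continuous_angle ha u hs.1).comp hτ
  refine ⟨γ, τ, T, hT, hγf, hper, hτ, hτe, fun θ => ?_, ?_, ?_⟩
  · have : φ θ u s ∈ range γ := by rw [hr]; exact ⟨θ, rfl⟩
    exact this
  · have hs' : s ∈ Icc (0 : ℝ) 1 := ⟨hs.1.le, hs.2⟩
    -- After a period the point returns, so the lifted angle has changed by a number of full turns,
    -- which is constant in `t` by continuity.
    have hn : ∀ t, ∃ n : ℤ, (τ (t + T) - τ t) / (2 * Real.pi) = n := by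
      intro t
      have e := hper t
      rw [hτe, hτe] at e
      obtain ⟨-, -, h⟩ := H.inj _ _ u hu u hu s hs' s hs' e.symm
      obtain ⟨n, hn⟩ := h.resolve_left hs.1.ne'
      refine ⟨n, ?_⟩
      rw [hn]; field_simp; ring
    obtain ⟨n, hn0⟩ := hn 0
    have step : ∀ t, τ (t + T) = τ t + n * (2 * Real.pi) := by
      intro t
      have := IsPreconnected.eq_of_int_valued isPreconnected_univ
        (f := fun t => (τ (t + T) - τ t) / (2 * Real.pi)) (by fun_prop) (fun t _ => hn t)
        (mem_univ t) (mem_univ 0)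
      rw [hn0, div_eq_iff (by positivity)] at this
      linarith
    refine ⟨n, fun t j => ?_⟩
    induction j with
    | zero => simp
    | succ i ih =>
      have e : t + ((i + 1 : ℤ) : ℝ) * T = (t + (i : ℤ) * T) + T := by push_cast; ring
      rw [e, step, ih]; push_cast; ring
    | pred i ih =>
      have e : t + ((-i : ℤ) : ℝ) * T = (t + ((-i - 1 : ℤ) : ℝ) * T) + T := by push_cast; ring
      rw [e, step] at ih
      push_cast at ih ⊢
      linear_combination ih
  · intro t k hk
    refine forall_lt_of_crosses_upward hψ (fun t ht => ?_) hk
    have hcos : Real.cos (k * Real.pi) ^ 2 = 1 := by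
      have := Real.sin_sq_add_cos_sq (k * Real.pi)
      rw [Real.sin_int_mul_pi] at this
      linarith
    -- The factor `cos (kπ) = ±1` treats even and odd levels alike.
    have hsin : ∀ x, Real.cos (k * Real.pi) * Real.sin x = Real.sin (x - k * Real.pi) := by
      intro x
      rw [Real.sin_sub, Real.sin_int_mul_pi]; ring
    have h0 : γ t 2 = 0 := by
      obtain ⟨R, -, hR⟩ := ha.height (τ t) u hu s hs
      rw [hτe, hR, ht, Real.sin_int_mul_pi, mul_zero]
    have hc := ha.cross (τ t) u hu s hs (by rw [← hτe]; exact h0)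
    rw [ht, ← hτe] at hc
    obtain ⟨c1, c2⟩ := hγf.crosses h0 hc.1 hc.2
    have hnear : ∀ᶠ x in 𝓝 t, |α (τ x) u s - k * Real.pi| < Real.pi := by
      have : ContinuousAt (fun x => |α (τ x) u s - k * Real.pi|) t :=
        (hψ.sub continuous_const).abs.continuousAt
      refine this.eventually (gt_mem_nhds ?_)
      simp [ht, Real.pi_pos]
    constructor
    · filter_upwards [c1, mem_nhdsWithin_of_mem_nhds hnear] with x hx hx'
      obtain ⟨R, hRpos, hR⟩ := ha.height (τ x) u hu s hs
      rw [hτe, hR, mul_left_comm, hsin] at hx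
      have h2 := (mul_pos_iff_of_pos_left hRpos).1 hx
      by_contra hcon
      push Not at hcon
      rw [abs_lt] at hx'
      linarith [Real.sin_nonpos_of_nonpos_of_neg_pi_le (by linarith) hx'.1.le]
    · filter_upwards [c2, mem_nhdsWithin_of_mem_nhds hnear] with x hx hx'
      obtain ⟨R, hRpos, hR⟩ := ha.height (τ x) u hu s hs
      rw [hτe, hR, mul_left_comm, hsin] at hx
      by_contra hcon
      push Not at hcon
      rw [abs_lt] at hx'
      have := Real.sin_nonneg_of_nonneg_of_le_pi (show 0 ≤ α (τ x) u s - k * Real.pi by linarith)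
        hx'.2.le
      linarith [mul_nonneg hRpos.le this]

theorem surjective_angle (ha : IsAngle Z φ α m) (hm : m ≠ 0) (u : ℝ) {s : ℝ} (hs : 0 < s) :
    Function.Surjective fun θ => α θ u s := by
  refine surjective_of_quasiperiodic (c := 2 * Real.pi) (d := m * (2 * Real.pi))
    (continuous_angle ha u hs) ?_ fun k => ?_
  · have : (m : ℝ) ≠ 0 := by exact_mod_cast hm
    positivity
  · have := ha.index 0 u s k
    rw [zero_add] at this
    rw [this]; push_cast; ring

/-- If the lifted angle made no net turn in a period, it would return to a level of `α` already
passed. Hence it makes a nonzero number of turns and is unbounded in both directions. -/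
theorem exists_orbit_time_surjective (H : Cylinders Z M φ) (ha : IsAngle Z φ α m) (hm : m ≠ 0)
    {u s : ℝ} (hu : u ∈ Icc (0 : ℝ) 1) (hs : s ∈ Ioc (0 : ℝ) 1) :
    ∃ (γ : ℝ → E3) (τ : ℝ → ℝ), FollowsSides Z.X Z.Y 1 γ ∧ Continuous τ ∧
      (∀ t, γ t = φ (τ t) u s) ∧ Function.Surjective τ ∧
      ∀ t (k : ℤ), α (τ t) u s = k * Real.pi →
        (∀ t' > t, k * Real.pi < α (τ t') u s) ∧ (∀ t' < t, α (τ t') u s < k * Real.pi) := by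
  obtain ⟨γ, τ, T, hT, hγ, -, hτ, hτe, hsurj, ⟨n, hn⟩, hlev⟩ := H.exists_orbit_time ha hu hs
  refine ⟨γ, τ, hγ, hτ, hτe, ?_, hlev⟩
  have hn0 : n ≠ 0 := by
    rintro rfl
    obtain ⟨θ, hθ⟩ := surjective_angle ha hm u hs.1 0
    simp only at hθ
    obtain ⟨t, ht⟩ := hsurj θ
    have hs' : s ∈ Icc (0 : ℝ) 1 := ⟨hs.1.le, hs.2⟩
    rw [hτe] at ht
    obtain ⟨-, -, h⟩ := H.inj _ _ u hu u hu s hs' s hs' ht.symm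
    obtain ⟨k, hk⟩ := h.resolve_left hs.1.ne'
    have h1 : α (τ t) u s = (2 * (k * m) : ℤ) * Real.pi := by
      rw [hk, ha.index, hθ]; push_cast; ring
    have h2 := (hlev t _ h1).1 (t + T) (by linarith)
    have h3 := hn t 1
    simp at h3
    rw [h3, h1] at h2
    exact lt_irrefl _ h2
  refine surjective_of_quasiperiodic (c := T) (d := n * (2 * Real.pi)) hτ ?_ fun k => ?_
  · have : (n : ℝ) ≠ 0 := by exact_mod_cast hn0
    positivity
  · have := hn 0 k
    rw [zero_add] at this
    rw [this]; push_cast; ring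

/-- As every angle is `τ` of some time, two angles on a level would give two times on it. -/
theorem existsUnique_level (H : Cylinders Z M φ) (ha : IsAngle Z φ α m) (hm : m ≠ 0)
    {u s : ℝ} (hu : u ∈ Icc (0 : ℝ) 1) (hs : s ∈ Ioc (0 : ℝ) 1) (k : ℤ) :
    ∃! θ, α θ u s = k * Real.pi := by
  obtain ⟨θ, hθ⟩ := surjective_angle ha hm u hs.1 (k * Real.pi)
  refine ⟨θ, hθ, fun θ' hθ' => ?_⟩
  obtain ⟨γ, τ, -, -, -, hsurj, hlev⟩ := H.exists_orbit_time_surjective ha hm hu hs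
  obtain ⟨t, rfl⟩ := hsurj θ
  obtain ⟨t', rfl⟩ := hsurj θ'
  rcases lt_trichotomy t t' with h | h | h
  · exact absurd hθ' ((hlev t k hθ).1 t' h).ne'
  · rw [h]
  · exact absurd hθ' ((hlev t k hθ).2 t' h).ne

/-- A periodic curve cannot stay on the open side `ε` where the field bends to the other side. -/
theorem _root_.PSVF.FollowsSides.not_forall_pos {V V' : E3 → E3} {ε : ℝ} {γ : ℝ → E3}
    (h : FollowsSides V V' ε γ) {T : ℝ} (hT : 0 < T) (hper : Function.Periodic γ T)
    (hd : ∀ t, DifferentiableAt ℝ V (γ t))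
    (hneg : ∀ t, ε * lieDeriv V (lieDeriv V height) (γ t) < 0) : ¬ ∀ t, 0 < ε * γ t 2 := by
  intro hpos
  have hder : ∀ t, HasDerivAt γ (V (γ t)) t := by
    intro t
    have := h.isArc (M := univ) (fun _ => mem_univ _) (show t - 1 < t + 1 by linarith)
      (fun s _ => hpos s)
    exact (this t ⟨by linarith, by linarith⟩).2.hasDerivAt
      (Icc_mem_nhds (by linarith) (by linarith))
  -- Along `γ` the function `ε V.f` has derivative `ε V².f < 0`, which is impossible for a periodic
  -- curve.
  have hanti : StrictAnti fun t => ε * V (γ t) 2 := by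
    refine strictAnti_of_hasDerivAt_neg (f' := fun t => ε * lieDeriv V (lieDeriv V height) (γ t))
      (fun t => ?_) hneg
    refine HasDerivAt.const_mul _ ?_
    rw [lieDeriv_height, lieDeriv]
    have hg : HasFDerivAt (fun p => V p 2) (fderiv ℝ (fun p => V p 2) (γ t)) (γ t) :=
      (((EuclideanSpace.proj 2 : E3 →L[ℝ] ℝ).differentiableAt).comp (γ t) (hd t)).hasFDerivAt
    exact hg.comp_hasDerivAt t (hder t)
  have := hanti (show (0 : ℝ) < 0 + T by linarith)
  simp only [hper 0] at this
  exact lt_irrefl _ this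

theorem _root_.PSVF.RegularOn.eventually_lieDeriv {V : E3 → E3} {K : Set E3} (h : RegularOn V K)
    {p : E3} (hp : p ∈ K) {ε : ℝ} (hneg : ε * lieDeriv V (lieDeriv V height) p < 0) :
    ∀ᶠ q in 𝓝 p, DifferentiableAt ℝ V q ∧ ε * lieDeriv V (lieDeriv V height) q < 0 := by
  have hV := h.contDiffAt hp
  have hg : ContDiffAt ℝ 1 (fun q => V q 2) p :=
    (EuclideanSpace.proj 2 : E3 →L[ℝ] ℝ).contDiff.contDiffAt.comp p hV
  have hc : ContinuousAt (fun q => ε * lieDeriv V (lieDeriv V height) q) p := by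
    refine continuousAt_const.mul ?_
    rw [lieDeriv_height]
    have h1 : ContinuousAt (fderiv ℝ fun q => V q 2) p :=
      (hg.fderiv_right (m := 0) (by simp)).continuousAt
    exact h1.clm_apply hV.continuousAt
  filter_upwards [(hV.eventually (by simp)).mono fun q hq => hq.differentiableAt one_ne_zero,
    hc.eventually (gt_mem_nhds hneg)] with q h1 h2
  exact ⟨h1, h2⟩

/-- For `m = 0` the angle `α` is `2π`-periodic in `θ`, so it takes the same value after a period of
the orbit, contrary to its increase past a level: no orbit would meet Σ. But near the axis the fold
inequalities persist, and an orbit there cannot stay on one open side. -/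
theorem index_ne_zero (H : Cylinders Z M φ) (ha : IsAngle Z φ α m) : m ≠ 0 := by
  rintro rfl
  have h0I : (0 : ℝ) ∈ Icc (0 : ℝ) 1 := ⟨le_rfl, zero_le_one⟩
  obtain ⟨f0, f1, f2, f3, f4⟩ := H.fold 0 h0I
  have f0' : φ 0 0 0 2 = 0 := f0
  have hW := (H.regX.eventually_lieDeriv (ε := 1) ⟨H.mem 0 0 0, by simp [side, f0']⟩
    (by linarith)).and (H.regY.eventually_lieDeriv (ε := -1) ⟨H.mem 0 0 0, by simp [side, f0']⟩
    (by linarith))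
  have hev := H.eventually_forall_mem 0 hW
  have hev2 : ∀ᶠ s : ℝ in 𝓝[>] 0, ∀ θ, φ θ 0 s ∈ {q | (DifferentiableAt ℝ Z.X q ∧
      1 * lieDeriv Z.X (lieDeriv Z.X height) q < 0) ∧ DifferentiableAt ℝ Z.Y q ∧
      -1 * lieDeriv Z.Y (lieDeriv Z.Y height) q < 0} := by
    have ht : Tendsto (fun s : ℝ => ((0 : ℝ), s)) (𝓝[>] 0) (𝓝 ((0 : ℝ), (0 : ℝ))) :=
      (Continuous.tendsto (by fun_prop) 0).mono_left nhdsWithin_le_nhds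
    exact ht.eventually hev
  obtain ⟨s, hs, hs01⟩ := (hev2.and (Ioc_mem_nhdsGT (zero_lt_one' ℝ))).exists
  obtain ⟨γ, τ, T, hT, hγ, hper, hτ, hτe, hsurj, ⟨n, hn⟩, hlev⟩ :=
    H.exists_orbit_time ha h0I hs01
  by_cases hz : ∃ t, γ t 2 = 0
  · obtain ⟨t, ht⟩ := hz
    obtain ⟨R, hR, hRe⟩ := ha.height (τ t) 0 h0I s hs01
    rw [← hτe, ht] at hRe
    have hsin : Real.sin (α (τ t) 0 s) = 0 := by
      rcases mul_eq_zero.1 hRe.symm with h | h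
      · exact absurd h hR.ne'
      · exact h
    obtain ⟨k, hk⟩ := Real.sin_eq_zero_iff.1 hsin
    have h1 := (hlev t k hk.symm).1 (t + T) (by linarith)
    have h2 := hn t 1
    simp only [Int.cast_one, one_mul] at h2
    rw [h2, ha.index, ← hk] at h1
    simp at h1
  · push Not at hz
    have hc2 : Continuous fun t => γ t 2 := by
      have := hγ.continuous
      fun_prop
    rcases lt_or_gt_of_ne (hz 0) with h | h
    · have hall : ∀ t, 0 < -1 * γ t 2 := by
        intro t
        by_contra hcon
        push Not at hcon
        obtain ⟨x, hx⟩ := mem_range_of_exists_le_of_exists_ge hc2 ⟨0, h.le⟩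
          ⟨t, show 0 ≤ γ t 2 by linarith⟩
        exact hz x hx
      exact hγ.symm.not_forall_pos hT hper (fun t => by rw [hτe]; exact (hs (τ t)).2.1)
        (fun t => by rw [hτe]; exact (hs (τ t)).2.2) hall
    · have hall : ∀ t, 0 < 1 * γ t 2 := by
        intro t
        by_contra hcon
        push Not at hcon
        obtain ⟨x, hx⟩ := mem_range_of_exists_le_of_exists_ge hc2
          ⟨t, show γ t 2 ≤ 0 by linarith⟩ ⟨0, le_of_lt h⟩
        exact hz x hx
      exact hγ.not_forall_pos hT hper (fun t => by rw [hτe]; exact (hs (τ t)).1.1)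
        (fun t => by rw [hτe]; exact (hs (τ t)).1.2) hall

end Cylinders

/-! ### The index is one -/

/-- At a fold, a coordinate transverse to the field together with its component `V 2` separates
the points of the switching manifold. -/
theorem exists_fold_chart {V : E3 → E3} {p₀ : E3} (hV : ContDiffAt ℝ 1 V p₀)
    (h1 : V p₀ 2 = 0) (h2 : lieDeriv V (lieDeriv V height) p₀ ≠ 0) :
    ∃ ξ : E3 → ℝ, Continuous ξ ∧ ξ p₀ = 0 ∧ ∃ ρ > 0,
      (∀ p ∈ ball p₀ ρ, ContinuousAt V p) ∧
      ∀ p ∈ ball p₀ ρ, ∀ q ∈ ball p₀ ρ, p 2 = 0 → q 2 = 0 → ξ p = ξ q → V p 2 = V q 2 → p = q := by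
  set ν := V p₀ with hν
  have hg : ContDiffAt ℝ 1 (fun q => V q 2) p₀ :=
    (EuclideanSpace.proj 2 : E3 →L[ℝ] ℝ).contDiff.contDiffAt.comp p₀ hV
  rw [lieDeriv_height, lieDeriv, ← hν] at h2
  have hc : ContinuousAt (fun q => fderiv ℝ (fun q => V q 2) q ν) p₀ :=
    ContinuousAt.clm_apply (hg.fderiv_right (m := 0) (by simp)).continuousAt continuousAt_const
  obtain ⟨ρ, hρ, hball⟩ := Metric.eventually_nhds_iff_ball.1
    ((hV.eventually (by simp)).and (hc.eventually (isOpen_ne.mem_nhds h2)))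
  -- `ξ` is the linear coordinate of the plane that is constant in the direction `ν = V p₀`, which
  -- is tangent to Σ. Points of Σ with equal `ξ` differ by a multiple of `ν`.
  refine ⟨fun p => ν 0 * (p 1 - p₀ 1) - ν 1 * (p 0 - p₀ 0), by fun_prop, by simp, ρ, hρ,
    fun p hp => (hball p hp).1.continuousAt, ?_⟩
  -- `ν` is horizontal, and it is not zero because the derivative of `V.f` in its direction is `V².f
  -- ≠ 0`.
  have hn : 0 < ν 0 ^ 2 + ν 1 ^ 2 := by
    by_contra hcon
    have e0 : ν 0 = 0 := by nlinarith [sq_nonneg (ν 0), sq_nonneg (ν 1)]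
    have e1 : ν 1 = 0 := by nlinarith [sq_nonneg (ν 0), sq_nonneg (ν 1)]
    have : ν = 0 := by ext i; fin_cases i <;> simp [e0, e1, h1]
    rw [this] at h2
    simp at h2
  -- Rolle: in the ball the derivative of `V.f` in the fixed direction `ν` does not vanish, so `V.f`
  -- separates points on a segment parallel to `ν`.
  have key : ∀ p ∈ ball p₀ ρ, ∀ l : ℝ, l > 0 → p + l • ν ∈ ball p₀ ρ → V p 2 ≠ V (p + l • ν) 2 := by
    intro p hp l hl hq heq
    have hseg : ∀ x ∈ Icc 0 l, p + x • ν ∈ ball p₀ ρ := by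
      intro x hx
      have := (convex_ball p₀ ρ).add_smul_sub_mem hp hq (t := x / l)
        ⟨div_nonneg hx.1 hl.le, (div_le_one hl).2 hx.2⟩
      convert this using 2
      rw [add_sub_cancel_left, smul_smul, div_mul_cancel₀ _ hl.ne']
    have hder : ∀ x ∈ Icc 0 l, HasDerivAt (fun x : ℝ => V (p + x • ν) 2)
        (fderiv ℝ (fun q => V q 2) (p + x • ν) ν) x := by
      intro x hx
      have h3 : DifferentiableAt ℝ (fun q => V q 2) (p + x • ν) :=
        (EuclideanSpace.proj 2 : E3 →L[ℝ] ℝ).differentiableAt.comp _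
          ((hball _ (hseg x hx)).1.differentiableAt one_ne_zero)
      have h4 : HasDerivAt (fun x : ℝ => p + x • ν) ν x := by
        simpa using ((hasDerivAt_id x).smul_const ν).const_add p
      exact h3.hasFDerivAt.comp_hasDerivAt x h4
    obtain ⟨x, hx, hx0⟩ := exists_hasDerivAt_eq_zero hl
      (fun x hx => (hder x hx).continuousAt.continuousWithinAt) (by simpa using heq)
      (fun x hx => hder x ⟨hx.1.le, hx.2.le⟩)
    exact (hball _ (hseg x ⟨hx.1.le, hx.2.le⟩)).2 hx0
  intro p hp q hq hp2 hq2 hξ hη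
  set l := (ν 0 * (q 0 - p 0) + ν 1 * (q 1 - p 1)) / (ν 0 ^ 2 + ν 1 ^ 2) with hl
  have hl' : l * (ν 0 ^ 2 + ν 1 ^ 2) = ν 0 * (q 0 - p 0) + ν 1 * (q 1 - p 1) :=
    div_mul_cancel₀ _ hn.ne'
  have hξ' : ν 0 * (q 1 - p 1) = ν 1 * (q 0 - p 0) := by linarith
  have hqe : q = p + l • ν := by
    ext i
    fin_cases i
    · simp only [Fin.zero_eta, PiLp.add_apply, PiLp.smul_apply, smul_eq_mul]
      apply mul_right_cancel₀ hn.ne'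
      linear_combination -ν 0 * hl' - ν 1 * hξ'
    · simp only [Fin.mk_one, PiLp.add_apply, PiLp.smul_apply, smul_eq_mul]
      apply mul_right_cancel₀ hn.ne'
      linear_combination -ν 1 * hl' + ν 0 * hξ'
    · simp [hp2, hq2, h1]
  have hpe : p = q + (-l) • ν := by rw [hqe]; simp
  rcases lt_trichotomy l 0 with h | h | h
  · exact absurd hη.symm (by
      conv_rhs => rw [hpe]
      exact key q hq (-l) (by linarith) (by rw [← hpe]; exact hp))
  · rw [hqe, h]; simp
  · exact absurd hη (by rw [hqe]; exact key p hp l h (by rw [← hqe]; exact hq))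

namespace Cylinders

variable {Z : PiecewiseField} {M : Set E3} {φ : ℝ → ℝ → ℝ → E3} {α : ℝ → ℝ → ℝ → ℝ} {m : ℤ}

/-- Continuity of a map given in cylinder coordinates; the angle may be arbitrary on the axis. -/
theorem continuousOn_comp (H : Cylinders Z M φ) {A : Type*} [TopologicalSpace A] {S : Set A}
    {Θ U T : A → ℝ} (hU : ContinuousOn U S) (hT : ContinuousOn T S)
    (hΘ : ∀ x ∈ S, T x ≠ 0 → ContinuousWithinAt Θ S x) :
    ContinuousOn (fun x => φ (Θ x) (U x) (T x)) S := by
  intro x hx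
  by_cases h0 : T x = 0
  · have hUT : Tendsto (fun y => (U y, T y)) (𝓝[S] x) (𝓝 (U x, 0)) := by
      have := ((hU x hx).prodMk (hT x hx)).tendsto
      rwa [h0] at this
    intro W hW
    simp only [h0] at hW
    rw [H.axis] at hW
    exact (hUT.eventually (H.eventually_forall_mem (U x) hW)).mono fun y hy => hy (Θ y)
  · exact H.cont.continuousAt.comp_continuousWithinAt
      (f := fun x => (Θ x, U x, T x)) ((hΘ x hx h0).prodMk ((hU x hx).prodMk (hT x hx)))

open Classical in
/-- The angle `θ` at which the angular coordinate takes the value `kπ`. -/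
def level (α : ℝ → ℝ → ℝ → ℝ) (k : ℤ) (u s : ℝ) : ℝ :=
  -- The default is harmless: for nonzero index and `s > 0` every level is attained, and at `s = 0`
  -- the point does not depend on the angle.
  if h : ∃ θ, α θ u s = k * Real.pi then h.choose else 0

theorem angle_level (ha : IsAngle Z φ α m) (hm : 0 < m) (u : ℝ) {s : ℝ} (hs : 0 < s) (k : ℤ) :
    α (level α k u s) u s = k * Real.pi := by
  have h : ∃ θ, α θ u s = k * Real.pi := surjective_angle ha hm.ne' u hs (k * Real.pi)
  rw [level, dif_pos h]
  exact h.choose_spec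

theorem eq_level (H : Cylinders Z M φ) (ha : IsAngle Z φ α m) (hm : 0 < m) {u s : ℝ}
    (hu : u ∈ Icc (0 : ℝ) 1) (hs : s ∈ Ioc (0 : ℝ) 1) {k : ℤ} {θ : ℝ}
    (h : α θ u s = k * Real.pi) : θ = level α k u s :=
  (H.existsUnique_level ha hm.ne' hu hs k).unique h (angle_level ha hm u hs.1 k)

/-- As `m > 0`, adding turns to `θ` makes `α` arbitrarily large. A value `≤ kπ` beyond the level
point would therefore produce a second point on the level. -/
theorem lt_angle_of_level_lt (H : Cylinders Z M φ) (ha : IsAngle Z φ α m) (hm : 0 < m) {u s : ℝ}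
    (hu : u ∈ Icc (0 : ℝ) 1) (hs : s ∈ Ioc (0 : ℝ) 1) {k : ℤ} {θ : ℝ}
    (h : level α k u s < θ) : k * Real.pi < α θ u s := by
  by_contra hcon
  push Not at hcon
  obtain ⟨n, hn⟩ := exists_nat_ge ((k * Real.pi - α θ u s) / (2 * Real.pi))
  rw [div_le_iff₀ Real.two_pi_pos] at hn
  have h1 := ha.index θ u s n
  have hm1 : (1 : ℝ) ≤ m := by exact_mod_cast hm
  have h2 : k * Real.pi ≤ α (θ + (n : ℤ) * (2 * Real.pi)) u s := by
    rw [h1]; push_cast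
    have : (n : ℝ) * (2 * Real.pi) ≤ n * m * (2 * Real.pi) := by
      have : (n : ℝ) ≤ n * m := le_mul_of_one_le_right (Nat.cast_nonneg n) hm1
      exact mul_le_mul_of_nonneg_right this Real.two_pi_pos.le
    linarith
  have hle : θ ≤ θ + (n : ℤ) * (2 * Real.pi) := by
    have : (0 : ℝ) ≤ (n : ℝ) * (2 * Real.pi) := by positivity
    push_cast; linarith
  obtain ⟨x, hx, hxe⟩ := intermediate_value_Icc hle (continuous_angle ha u hs.1).continuousOn
    ⟨hcon, h2⟩
  have := H.eq_level ha hm hu hs hxe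
  linarith [hx.1]

theorem angle_lt_of_lt_level (H : Cylinders Z M φ) (ha : IsAngle Z φ α m) (hm : 0 < m) {u s : ℝ}
    (hu : u ∈ Icc (0 : ℝ) 1) (hs : s ∈ Ioc (0 : ℝ) 1) {k : ℤ} {θ : ℝ}
    (h : θ < level α k u s) : α θ u s < k * Real.pi := by
  by_contra hcon
  push Not at hcon
  obtain ⟨n, hn⟩ := exists_nat_ge ((α θ u s - k * Real.pi) / (2 * Real.pi))
  rw [div_le_iff₀ Real.two_pi_pos] at hn
  have h1 := ha.index θ u s (-n)
  have hm1 : (1 : ℝ) ≤ m := by exact_mod_cast hm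
  have h2 : α (θ + (-n : ℤ) * (2 * Real.pi)) u s ≤ k * Real.pi := by
    rw [h1]; push_cast
    have : (n : ℝ) * (2 * Real.pi) ≤ n * m * (2 * Real.pi) := by
      have : (n : ℝ) ≤ n * m := le_mul_of_one_le_right (Nat.cast_nonneg n) hm1
      exact mul_le_mul_of_nonneg_right this Real.two_pi_pos.le
    linarith
  have hle : θ + (-n : ℤ) * (2 * Real.pi) ≤ θ := by
    have : (0 : ℝ) ≤ (n : ℝ) * (2 * Real.pi) := by positivity
    push_cast; linarith
  obtain ⟨x, hx, hxe⟩ := intermediate_value_Icc hle (continuous_angle ha u hs.1).continuousOn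
    ⟨h2, hcon⟩
  have := H.eq_level ha hm hu hs hxe
  linarith [hx.2]

/-- Whether a fixed angle `b` lies before or after the level is decided by the sign of `α - kπ` at
`b`, an open condition on `(u, s)`. -/
theorem continuousOn_level (H : Cylinders Z M φ) (ha : IsAngle Z φ α m) (hm : 0 < m) (k : ℤ) :
    ContinuousOn (fun p : ℝ × ℝ => level α k p.1 p.2) (Icc 0 1 ×ˢ Ioc 0 1) := by
  have hcon : ∀ θ, ∀ p ∈ Icc (0 : ℝ) 1 ×ˢ Ioc (0 : ℝ) 1,
      ContinuousWithinAt (fun p : ℝ × ℝ => α θ p.1 p.2) (Icc 0 1 ×ˢ Ioc 0 1) p := by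
    intro θ p hp
    exact (ha.cont.comp (f := fun p : ℝ × ℝ => (θ, p.1, p.2)) (by fun_prop)
      (fun q hq => (hq.2.1 : (0 : ℝ) < q.2))) p hp
  intro p hp
  rw [ContinuousWithinAt, tendsto_order]
  constructor
  · intro b hb
    have h1 := H.angle_lt_of_lt_level ha hm hp.1 hp.2 hb
    filter_upwards [(hcon b p hp).eventually (gt_mem_nhds h1), self_mem_nhdsWithin] with q hq hq'
    by_contra hcon
    push Not at hcon
    rcases hcon.eq_or_lt with h | h
    · rw [← h, angle_level ha hm q.1 hq'.2.1] at hq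
      exact lt_irrefl _ hq
    · exact absurd hq (H.lt_angle_of_level_lt ha hm hq'.1 hq'.2 h).not_gt
  · intro b hb
    have h1 := H.lt_angle_of_level_lt ha hm hp.1 hp.2 hb
    filter_upwards [(hcon b p hp).eventually (lt_mem_nhds h1), self_mem_nhdsWithin] with q hq hq'
    by_contra hcon
    push Not at hcon
    rcases hcon.eq_or_lt with h | h
    · rw [h, angle_level ha hm q.1 hq'.2.1] at hq
      exact lt_irrefl _ hq
    · exact absurd hq (H.angle_lt_of_lt_level ha hm hq'.1 hq'.2 h).not_gt

/-- A positive index is `1`: otherwise there would be several disjoint sheets of upward crossing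
points in the switching manifold on the same side of the axis. -/
theorem index_eq_one (H : Cylinders Z M φ) (ha : IsAngle Z φ α m) (hm : 0 < m) : m = 1 := by
  have hI : ∀ d : ℝ, d ≤ 1 / 2 → ∀ u ∈ Icc (1 / 2 - d) (1 / 2 + d), u ∈ Icc (0 : ℝ) 1 :=
    fun d hd u hu => ⟨by linarith [hu.1], by linarith [hu.2]⟩
  have hhalf : (1 / 2 : ℝ) ∈ Icc (0 : ℝ) 1 := by constructor <;> norm_num
  set p₀ := φ 0 (1 / 2) 0
  obtain ⟨f0, f1, f2, -, -⟩ := H.fold (1 / 2) hhalf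
  have f0' : p₀ 2 = 0 := f0
  have hV := H.regX.contDiffAt (p := p₀) ⟨H.mem _ _ _, by simp [side, f0']⟩
  rw [lieDeriv_height] at f1
  obtain ⟨ξ, hξ, hξ0, ρ, hρ, hXc, hsep⟩ := exists_fold_chart hV f1 f2.ne
  -- a rectangle whose orbits are near the axis
  have hev := H.eventually_forall_mem (1 / 2) (ball_mem_nhds p₀ hρ)
  obtain ⟨e, he, hball⟩ := Metric.eventually_nhds_iff_ball.1 hev
  obtain ⟨d, hd0, hde, hd2⟩ : ∃ d > 0, d < e ∧ d ≤ (1 / 2 : ℝ) :=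
    ⟨min (e / 2) (1 / 2), by positivity, (min_le_left _ _).trans_lt (by linarith), min_le_right _ _⟩
  have hW : ∀ θ, ∀ u ∈ Icc (1 / 2 - d) (1 / 2 + d), ∀ s ∈ Icc 0 d, φ θ u s ∈ ball p₀ ρ := by
    intro θ u hu s hs
    refine hball (u, s) ?_ θ
    rw [mem_ball, Prod.dist_eq, max_lt_iff, Real.dist_eq, Real.dist_eq, abs_lt, abs_lt]
    simp only
    exact ⟨⟨by linarith [hu.1], by linarith [hu.2]⟩, by linarith [hs.1], by linarith [hs.2]⟩
  have hz : ∀ k u, ∀ s ∈ Icc (0 : ℝ) 1, u ∈ Icc (0 : ℝ) 1 → φ (level α k u s) u s 2 = 0 := by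
    intro k u s hs hu
    rcases hs.1.eq_or_lt with h | h
    · rw [← h, H.axis]
      exact (H.fold u hu).1
    · obtain ⟨R, -, hR⟩ := ha.height (level α k u s) u hu s ⟨h, hs.2⟩
      rw [hR, angle_level ha hm u h, Real.sin_int_mul_pi, mul_zero]
  have hup : ∀ k : ℤ, Real.cos (k * Real.pi) = 1 → ∀ u ∈ Icc (0 : ℝ) 1, ∀ s ∈ Ioc (0 : ℝ) 1,
      0 < Z.X (φ (level α k u s) u s) 2 := by
    intro k hk u hu s hs
    have := (ha.cross (level α k u s) u hu s hs (hz k u s ⟨hs.1.le, hs.2⟩ hu)).1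
    rwa [angle_level ha hm u hs.1, hk, one_mul] at this
  -- the axis in the chart
  have hinj : InjOn (fun u => ξ (φ 0 u 0)) (Icc (1 / 2 - d) (1 / 2 + d)) := by
    intro u hu v hv huv
    have h0d : (0 : ℝ) ∈ Icc 0 d := ⟨le_rfl, hd0.le⟩
    have hu' := hI d hd2 u hu
    have hv' := hI d hd2 v hv
    obtain ⟨gu0, gu1, -⟩ := H.fold u hu'
    obtain ⟨gv0, gv1, -⟩ := H.fold v hv'
    rw [lieDeriv_height] at gu1 gv1
    have := hsep _ (hW 0 u hu 0 h0d) _ (hW 0 v hv 0 h0d) gu0 gv0 huv (gu1.trans gv1.symm)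
    exact (H.inj _ _ u hu' v hv' 0 ⟨le_rfl, zero_le_one⟩ 0 ⟨le_rfl, zero_le_one⟩ this).1
  have hξc : Continuous fun u => ξ (φ 0 u 0) :=
    hξ.comp (H.cont.comp (f := fun u : ℝ => ((0 : ℝ), u, (0 : ℝ))) (by fun_prop))
  -- `ξ` is injective, hence monotone, along the axis and vanishes at its midpoint. The sign `σ`
  -- makes it increasing, as the half-disc lemma requires.
  obtain ⟨σ, hσ, hl, hr⟩ : ∃ σ : ℝ, (σ = 1 ∨ σ = -1) ∧ σ * ξ (φ 0 (1 / 2 - d) 0) < 0 ∧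
      0 < σ * ξ (φ 0 (1 / 2 + d) 0) := by
    have m0 : (1 / 2 - d) ∈ Icc (1 / 2 - d) (1 / 2 + d) := ⟨le_rfl, by linarith⟩
    have m1 : (1 / 2 + d) ∈ Icc (1 / 2 - d) (1 / 2 + d) := ⟨by linarith, le_rfl⟩
    have mh : (1 / 2 : ℝ) ∈ Icc (1 / 2 - d) (1 / 2 + d) := ⟨by linarith, by linarith⟩
    rcases ContinuousOn.strictMonoOn_of_injOn_Icc' (show 1 / 2 - d ≤ 1 / 2 + d by linarith)
      hξc.continuousOn hinj with h | h
    · have h1 := h m0 mh (by linarith)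
      have h2 := h mh m1 (by linarith)
      simp only at h1 h2
      exact ⟨1, Or.inl rfl, by linarith, by linarith⟩
    · have h1 := h m0 mh (by linarith)
      have h2 := h mh m1 (by linarith)
      simp only at h1 h2
      exact ⟨-1, Or.inr rfl, by linarith, by linarith⟩
  have hσ0 : σ ≠ 0 := by rcases hσ with rfl | rfl <;> norm_num
  set β : E3 → ℂ := fun p => ((σ * ξ p : ℝ) : ℂ) + (Z.X p 2 : ℝ) * Complex.I with hβ
  have hβre : ∀ p, (β p).re = σ * ξ p := fun p => by simp [hβ]
  have hβim : ∀ p, (β p).im = Z.X p 2 := fun p => by simp [hβ]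
  have hβc : ∀ p ∈ ball p₀ ρ, ContinuousAt β p := by
    intro p hp
    have h2 : ContinuousAt (fun q => Z.X q 2) p :=
      ContinuousAt.comp (g := fun q : E3 => q 2) (by fun_prop) (hXc p hp)
    have h1 : ContinuousAt (fun q => σ * ξ q) p := (continuous_const.mul hξ).continuousAt
    exact (Complex.continuous_ofReal.continuousAt.comp h1).add
      ((Complex.continuous_ofReal.continuousAt.comp h2).mul continuousAt_const)
  have hβinj : ∀ p ∈ ball p₀ ρ, ∀ q ∈ ball p₀ ρ, p 2 = 0 → q 2 = 0 → β p = β q → p = q := by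
    intro p hp q hq hp2 hq2 h
    refine hsep p hp q hq hp2 hq2 ?_ ?_
    · have := congrArg Complex.re h
      rw [hβre, hβre] at this
      exact mul_left_cancel₀ hσ0 this
    · have := congrArg Complex.im h
      rwa [hβim, hβim] at this
  -- the sheet of the level `0`
  set R : Set (ℝ × ℝ) := Icc (1 / 2 - d) (1 / 2 + d) ×ˢ Icc 0 d
  have hRI : ∀ p ∈ R, p.1 ∈ Icc (0 : ℝ) 1 ∧ p.2 ∈ Icc (0 : ℝ) 1 := fun p hp =>
    ⟨hI d hd2 _ hp.1, hp.2.1, by linarith [hp.2.2]⟩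
  -- The bottom edge `s = 0` goes to the axis, where `X.f = 0`; for `s > 0` the sheet consists of
  -- upward crossings, where `X.f > 0`.
  set b : ℝ × ℝ → ℂ := fun p => β (φ (level α 0 p.1 p.2) p.1 p.2) with hb
  have hbc : ContinuousOn b R := by
    have h1 : ContinuousOn (fun p : ℝ × ℝ => φ (level α 0 p.1 p.2) p.1 p.2) R := by
      refine H.continuousOn_comp (Θ := fun p : ℝ × ℝ => level α 0 p.1 p.2) (U := Prod.fst)
        (T := Prod.snd) continuousOn_fst continuousOn_snd fun p hp h0 => ?_
      have hp2 : 0 < p.2 := lt_of_le_of_ne hp.2.1 (Ne.symm h0)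
      refine ((H.continuousOn_level ha hm 0) p ⟨(hRI p hp).1, hp2, (hRI p hp).2.2⟩).mono_of_mem_nhdsWithin ?_
      filter_upwards [self_mem_nhdsWithin,
        mem_nhdsWithin_of_mem_nhds (continuous_snd.continuousAt.eventually (lt_mem_nhds hp2))]
        with q hq hq'
      exact ⟨(hRI q hq).1, hq', (hRI q hq).2.2⟩
    intro p hp
    exact ContinuousAt.comp_continuousWithinAt (g := β)
      (f := fun p : ℝ × ℝ => φ (level α 0 p.1 p.2) p.1 p.2)
      (hβc _ (hW _ p.1 hp.1 p.2 hp.2)) (h1 p hp)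
  have hbpos : ∀ p ∈ R, 0 < p.2 → 0 < (b p).im := by
    intro p hp h
    rw [hb, hβim]
    exact hup 0 (by simp) _ (hRI p hp).1 _ ⟨h, (hRI p hp).2.2⟩
  have hbot : ∀ u, b (u, 0) = β (φ 0 u 0) := fun u => by simp only [hb]; rw [H.axis]
  have hbot0 : ∀ u ∈ Icc (1 / 2 - d) (1 / 2 + d), (b (u, 0)).im = 0 := by
    intro u hu
    rw [hbot, hβim]
    have := (H.fold u (hI d hd2 u hu)).2.1
    rwa [lieDeriv_height] at this
  -- On the three other edges `b` has no zero: for `s > 0` its imaginary part is positive, and the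
  -- two lower corners have nonzero real part. Its minimum modulus there is the radius of the
  -- half-disc covered by the sheet.
  set E : Set (ℝ × ℝ) := R ∩ {p | p.1 = 1 / 2 - d ∨ p.1 = 1 / 2 + d ∨ p.2 = d}
  have hEc : IsCompact E := by
    refine (isCompact_Icc.prod isCompact_Icc).inter_right ?_
    have h1 : IsClosed {p : ℝ × ℝ | p.1 = 1 / 2 - d} := isClosed_eq continuous_fst continuous_const
    have h2 : IsClosed {p : ℝ × ℝ | p.1 = 1 / 2 + d} := isClosed_eq continuous_fst continuous_const
    have h3 : IsClosed {p : ℝ × ℝ | p.2 = d} := isClosed_eq continuous_snd continuous_const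
    exact h1.union (h2.union h3)
  have hEn : E.Nonempty := ⟨(1 / 2 - d, 0), ⟨⟨le_rfl, by linarith⟩, ⟨le_rfl, hd0.le⟩⟩, Or.inl rfl⟩
  obtain ⟨pm, hpm, hmin⟩ := hEc.exists_isMinOn hEn (hbc.mono inter_subset_left).norm
  have hr0 : 0 < ‖b pm‖ := by
    rw [norm_pos_iff]
    intro h0
    rcases hpm.1.2.1.eq_or_lt with h | h
    · have hpe : pm = (pm.1, 0) := by ext <;> simp [h.symm]
      rw [hpe, hbot] at h0
      have hre := congrArg Complex.re h0
      rw [hβre] at hre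
      rcases hpm.2 with h1 | h1 | h1
      · rw [h1] at hre
        exact hl.ne hre
      · rw [h1] at hre
        exact hr.ne' hre
      · rw [← h] at h1
        exact hd0.ne h1
    · have := hbpos pm hpm.1 h
      rw [h0] at this
      simp at this
  -- a point of another sheet close to the axis
  have hβ0 : β p₀ = 0 := by
    apply Complex.ext
    · rw [hβre, hξ0, mul_zero]; rfl
    · rw [hβim]; exact f1
  have hnear : ∀ᶠ p in 𝓝 p₀, ‖β p‖ < ‖b pm‖ := by
    have : ContinuousAt (fun p => ‖β p‖) p₀ := (hβc p₀ (mem_ball_self hρ)).norm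
    refine this.eventually (gt_mem_nhds ?_)
    simp only [hβ0, norm_zero]
    exact hr0
  have hnear2 : ∀ᶠ s : ℝ in 𝓝[>] 0, ∀ θ, ‖β (φ θ (1 / 2) s)‖ < ‖b pm‖ := by
    have ht : Tendsto (fun s : ℝ => ((1 / 2 : ℝ), s)) (𝓝[>] 0) (𝓝 ((1 / 2 : ℝ), (0 : ℝ))) :=
      (Continuous.tendsto (by fun_prop) 0).mono_left nhdsWithin_le_nhds
    exact ht.eventually (H.eventually_forall_mem (1 / 2) hnear)
  obtain ⟨s, hs, hsd⟩ := (hnear2.and (Ioc_mem_nhdsGT hd0)).exists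
  have hs1 : s ∈ Ioc (0 : ℝ) 1 := ⟨hsd.1, by linarith [hsd.2]⟩
  -- Levels are counted in multiples of `π`, so `2` is the next level of upward crossings.
  have hq := hup 2 (by simp) (1 / 2) hhalf s hs1
  obtain ⟨p, hp, hpe⟩ := half_disc_subset_image (b := b) (x₀ := 1 / 2 - d) (x₁ := 1 / 2 + d)
    (y₁ := d) (r₀ := ‖b pm‖) (by linarith) hd0.le hbc hbot0
    (fun p hp => by
      rcases hp.2.1.eq_or_lt with h | h
      · have hpe : p = (p.1, 0) := by ext <;> simp [h.symm]
        rw [hpe]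
        exact (hbot0 _ hp.1).ge
      · exact (hbpos p hp h).le)
    (by rw [hbot, hβre]; exact hl) (by rw [hbot, hβre]; exact hr)
    (fun p hp h => hmin ⟨hp, h⟩) (q := β (φ (level α 2 (1 / 2) s) (1 / 2) s))
    (by rw [hβim]; exact hq) (hs _)
  have hmid : (1 / 2 : ℝ) ∈ Icc (1 / 2 - d) (1 / 2 + d) := ⟨by linarith, by linarith⟩
  have hpe' := hβinj _ (hW _ p.1 hp.1 p.2 hp.2) _ (hW _ (1 / 2) hmid s ⟨hsd.1.le, hsd.2⟩)
    (hz 0 p.1 p.2 (hRI p hp).2 (hRI p hp).1) (hz 2 (1 / 2) s ⟨hs1.1.le, hs1.2⟩ hhalf) hpe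
  obtain ⟨e1, e2, e3⟩ := H.inj _ _ _ (hRI p hp).1 _ hhalf _ (hRI p hp).2 _
    ⟨hs1.1.le, hs1.2⟩ hpe'
  rw [e1, e2] at e3
  obtain ⟨n, hn⟩ := e3.resolve_left hs1.1.ne'
  have h2 := angle_level ha hm (1 / 2) hs1.1 2
  rw [hn, ha.index, angle_level ha hm (1 / 2) hs1.1 0] at h2
  -- The two sheets share a point off the axis, so their angles differ by `n` turns. Then `α`
  -- differs both by `2π` and by `2πnm`.
  have hnm : ((n * m : ℤ) : ℝ) = 1 := by
    have h3 : ((n * m : ℤ) : ℝ) * (2 * Real.pi) = 1 * (2 * Real.pi) := by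
      push_cast at h2 ⊢
      linarith
    exact mul_right_cancel₀ Real.two_pi_pos.ne' h3
  have hnm' : n * m = 1 := by exact_mod_cast hnm
  rcases Int.eq_one_or_neg_one_of_mul_eq_one (by rw [mul_comm]; exact hnm') with h | h
  · exact h
  · omega

end Cylinders

/-! ### The upper and the lower arc of each orbit -/

/-- The curve `f` on `[a, b]` parametrizes, in the sense of time, an orbit of `V` restricted
to `S`. -/
structure IsOrbitArc (V : E3 → E3) (S : Set E3) (f : ℝ → E3) (a b : ℝ) : Prop where
  reaches : ∀ θ ∈ Icc a b, ∀ θ' ∈ Icc a b, θ ≤ θ' → Reaches V S (f θ) (f θ')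
  of_reaches : ∀ θ ∈ Icc a b, ∀ q, Reaches V S (f θ) q → ∃ θ' ∈ Icc θ b, q = f θ'
  height_lt : ∀ θ ∈ Icc a b, ∀ η ∈ Icc a b, θ < η → (∀ x ∈ Icc θ η, 0 < V (f x) 2) →
    f θ 2 < f η 2

/-- The upward crossing points are at the angle `A`, the downward ones at the angle `B`. -/
structure Meridians (Z : PiecewiseField) (M : Set E3) (φ : ℝ → ℝ → ℝ → E3) (A B : ℝ → ℝ → ℝ) :
    Prop where
  contA : ContinuousOn (fun p : ℝ × ℝ => A p.1 p.2) (Icc 0 1 ×ˢ Ioc 0 1)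
  contB : ContinuousOn (fun p : ℝ × ℝ => B p.1 p.2) (Icc 0 1 ×ˢ Ioc 0 1)
  lt : ∀ u ∈ Icc (0 : ℝ) 1, ∀ s ∈ Ioc (0 : ℝ) 1, A u s < B u s
  lt' : ∀ u ∈ Icc (0 : ℝ) 1, ∀ s ∈ Ioc (0 : ℝ) 1, B u s < A u s + 2 * Real.pi
  zeroA : ∀ u ∈ Icc (0 : ℝ) 1, ∀ s ∈ Ioc (0 : ℝ) 1, φ (A u s) u s 2 = 0
  zeroB : ∀ u ∈ Icc (0 : ℝ) 1, ∀ s ∈ Ioc (0 : ℝ) 1, φ (B u s) u s 2 = 0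
  upA : ∀ u ∈ Icc (0 : ℝ) 1, ∀ s ∈ Ioc (0 : ℝ) 1, 0 < Z.X (φ (A u s) u s) 2
  pos : ∀ u ∈ Icc (0 : ℝ) 1, ∀ s ∈ Ioc (0 : ℝ) 1, ∀ θ ∈ Ioo (A u s) (B u s), 0 < φ θ u s 2
  neg : ∀ u ∈ Icc (0 : ℝ) 1, ∀ s ∈ Ioc (0 : ℝ) 1, ∀ θ ∈ Ioo (B u s) (A u s + 2 * Real.pi),
    φ θ u s 2 < 0
  upper : ∀ u ∈ Icc (0 : ℝ) 1, ∀ s ∈ Ioc (0 : ℝ) 1,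
    IsOrbitArc Z.X (M ∩ side 1) (fun θ => φ θ u s) (A u s) (B u s)
  lower : ∀ u ∈ Icc (0 : ℝ) 1, ∀ s ∈ Ioc (0 : ℝ) 1,
    IsOrbitArc Z.Y (M ∩ side (-1)) (fun θ => φ θ u s) (B u s) (A u s + 2 * Real.pi)

namespace Cylinders

variable {Z : PiecewiseField} {M : Set E3} {φ : ℝ → ℝ → ℝ → E3} {α : ℝ → ℝ → ℝ → ℝ} {m : ℤ}

theorem level_lt_level (H : Cylinders Z M φ) (ha : IsAngle Z φ α m) (hm : 0 < m) {u s : ℝ}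
    (hu : u ∈ Icc (0 : ℝ) 1) (hs : s ∈ Ioc (0 : ℝ) 1) (k : ℤ) :
    level α k u s < level α (k + 1) u s := by
  have h1 := angle_level ha hm u hs.1 (k + 1)
  have h0 := angle_level ha hm u hs.1 k
  push_cast at h1
  by_contra hcon
  push Not at hcon
  rcases hcon.eq_or_lt with h | h
  · rw [h, h0] at h1
    linarith [Real.pi_pos]
  · linarith [H.angle_lt_of_lt_level ha hm hu hs h, Real.pi_pos]

theorem angle_mem_Ioo (H : Cylinders Z M φ) (ha : IsAngle Z φ α m) (hm : 0 < m) {u s : ℝ}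
    (hu : u ∈ Icc (0 : ℝ) 1) (hs : s ∈ Ioc (0 : ℝ) 1) {k : ℤ} {θ : ℝ}
    (hθ : θ ∈ Ioo (level α k u s) (level α (k + 1) u s)) :
    α θ u s ∈ Ioo (k * Real.pi) (k * Real.pi + Real.pi) := by
  have h1 := H.lt_angle_of_level_lt ha hm hu hs hθ.1
  have h2 := H.angle_lt_of_lt_level ha hm hu hs hθ.2
  push_cast at h2
  exact ⟨h1, by linarith⟩

theorem cos_mul_height_pos (ha : IsAngle Z φ α m) {u s : ℝ} (hu : u ∈ Icc (0 : ℝ) 1)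
    (hs : s ∈ Ioc (0 : ℝ) 1) {k : ℤ} {θ : ℝ}
    (h : α θ u s ∈ Ioo (k * Real.pi) (k * Real.pi + Real.pi)) :
    0 < Real.cos (k * Real.pi) * φ θ u s 2 := by
  obtain ⟨R, hR, hRe⟩ := ha.height θ u hu s hs
  have hsin : Real.cos (k * Real.pi) * Real.sin (α θ u s) = Real.sin (α θ u s - k * Real.pi) := by
    rw [Real.sin_sub, Real.sin_int_mul_pi]; ring
  rw [hRe, mul_left_comm, hsin]
  exact mul_pos hR (Real.sin_pos_of_pos_of_lt_pi (by linarith [h.1]) (by linarith [h.2]))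

theorem height_level (ha : IsAngle Z φ α m) (hm : 0 < m) {u s : ℝ} (hu : u ∈ Icc (0 : ℝ) 1)
    (hs : s ∈ Ioc (0 : ℝ) 1) (k : ℤ) : φ (level α k u s) u s 2 = 0 := by
  obtain ⟨R, -, hR⟩ := ha.height (level α k u s) u hu s hs
  rw [hR, angle_level ha hm u hs.1, Real.sin_int_mul_pi, mul_zero]

/-- Between the times at which the trajectory passes the levels `k` and `k + 1` it stays on the side
given by the parity of `k`, and `FollowsSides.orbit_arc` applies. Both sides are covered through `ε
= cos (kπ)`; `hcr` says that the arc leaves its side at the second level. -/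
theorem isOrbitArc_level (H : Cylinders Z M φ) (ha : IsAngle Z φ α m) (hm : 0 < m) {u s : ℝ}
    (hu : u ∈ Icc (0 : ℝ) 1) (hs : s ∈ Ioc (0 : ℝ) 1) {k : ℤ} {V V' : E3 → E3} {ε : ℝ}
    (hε : Real.cos (k * Real.pi) = ε) (hV : RegularOn V (M ∩ side ε))
    (hZ : ∀ γ, FollowsSides Z.X Z.Y 1 γ → FollowsSides V V' ε γ)
    (hcr : 0 < Real.cos ((k + 1 : ℤ) * Real.pi) * V (φ (level α (k + 1) u s) u s) 2) :
    IsOrbitArc V (M ∩ side ε) (fun θ => φ θ u s) (level α k u s) (level α (k + 1) u s) := by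
  obtain ⟨C, hC⟩ := hV.exists_lipschitzOnWith (H.compact.inter_right (isClosed_side ε))
  obtain ⟨γ, τ, hγ, hτ, hτe, hsurj, hlev⟩ := H.exists_orbit_time_surjective ha hm.ne' hu hs
  obtain ⟨t₁, h1⟩ := hsurj (level α k u s)
  obtain ⟨t₂, h2⟩ := hsurj (level α (k + 1) u s)
  have a1 : α (τ t₁) u s = k * Real.pi := by rw [h1, angle_level ha hm u hs.1]
  have a2 : α (τ t₂) u s = (k + 1 : ℤ) * Real.pi := by rw [h2, angle_level ha hm u hs.1]
  have l1 := hlev t₁ k a1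
  have l2 := hlev t₂ (k + 1) a2
  have ht : t₁ < t₂ := by
    push_cast at a2
    rcases lt_trichotomy t₁ t₂ with h | h | h
    · exact h
    · rw [← h, a1] at a2
      linarith [Real.pi_pos]
    · have := l1.2 t₂ h
      linarith [Real.pi_pos]
  have hbt : ∀ t ∈ Ioo t₁ t₂, α (τ t) u s ∈ Ioo (k * Real.pi) (k * Real.pi + Real.pi) := by
    intro t htt
    have := l2.2 t htt.2
    push_cast at this
    exact ⟨l1.1 t htt.1, by linarith⟩
  have hcos : Real.cos ((k + 1 : ℤ) * Real.pi) = -ε := by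
    rw [← hε]; push_cast
    rw [add_mul, one_mul, Real.cos_add_pi]
  have := (hZ γ hγ).orbit_arc (M := M) (fun t => by rw [hτe]; exact H.mem _ _ _) hC ht
    (fun t htt => by rw [hτe, ← hε]; exact cos_mul_height_pos ha hu hs (hbt t htt))
    (f := fun θ => φ θ u s) hτ hτe ?_ ?_ ?_ ?_
  · rw [h1, h2] at this
    exact ⟨this.1, this.2.1, this.2.2⟩
  · intro t htt
    rw [h1, h2]
    have hb := hbt t htt
    constructor
    · by_contra hcon
      push Not at hcon
      rcases hcon.eq_or_lt with h | h
      · rw [h, angle_level ha hm u hs.1] at hb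
        exact lt_irrefl _ hb.1
      · linarith [H.angle_lt_of_lt_level ha hm hu hs h, hb.1]
    · by_contra hcon
      push Not at hcon
      rcases hcon.eq_or_lt with h | h
      · rw [← h, angle_level ha hm u hs.1] at hb
        push_cast at hb
        linarith [hb.2]
      · have := H.lt_angle_of_level_lt ha hm hu hs h
        push_cast at this
        linarith [hb.2]
  · simp only [h2]
    exact height_level ha hm hu hs _
  -- Equal end points would make the difference `π` of the levels a multiple of `2π`.
  · intro heq
    simp only [h1, h2] at heq
    have hs' : s ∈ Icc (0 : ℝ) 1 := ⟨hs.1.le, hs.2⟩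
    obtain ⟨-, -, h3⟩ := H.inj _ _ u hu u hu s hs' s hs' heq
    obtain ⟨n, hn⟩ := h3.resolve_left hs.1.ne'
    have h4 := angle_level ha hm u hs.1 (k + 1)
    rw [hn, ha.index, angle_level ha hm u hs.1] at h4
    have h5 : ((2 * (n * m) : ℤ) : ℝ) * Real.pi = ((1 : ℤ) : ℝ) * Real.pi := by
      push_cast at h4 ⊢
      linarith
    have h6 := mul_right_cancel₀ Real.pi_ne_zero h5
    have h7 : 2 * (n * m) = 1 := by exact_mod_cast h6
    omega
  · simp only [h2]
    rw [hcos] at hcr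
    linarith

/-- `A` and `B` are the levels `0` and `1`. Index one means that level `2` is level `0` after one
turn of `θ`, so the two arcs make up the whole circle. -/
theorem exists_meridians_of_pos (H : Cylinders Z M φ) (ha : IsAngle Z φ α m) (hm : 0 < m) :
    ∃ A B, Meridians Z M φ A B := by
  obtain rfl := H.index_eq_one ha hm
  have h2 : ∀ u ∈ Icc (0 : ℝ) 1, ∀ s ∈ Ioc (0 : ℝ) 1,
      level α (1 + 1) u s = level α 0 u s + 2 * Real.pi := by
    intro u hu s hs
    refine (H.eq_level ha hm hu hs ?_).symm
    have := ha.index (level α 0 u s) u s 1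
    rw [angle_level ha hm u hs.1] at this
    push_cast at this ⊢
    rw [one_mul] at this
    rw [this]; ring
  have h1 : ∀ u s, level α 1 u s = level α (0 + 1) u s := fun u s => by rw [zero_add]
  have hc0 : Real.cos ((0 : ℤ) * Real.pi) = 1 := by simp
  have hc1 : Real.cos ((1 : ℤ) * Real.pi) = -1 := by simp
  have hcr : ∀ (k : ℤ) (u : ℝ), ∀ s ∈ Ioc (0 : ℝ) 1, u ∈ Icc (0 : ℝ) 1 →
      0 < Real.cos (k * Real.pi) * Z.X (φ (level α k u s) u s) 2 ∧
      0 < Real.cos (k * Real.pi) * Z.Y (φ (level α k u s) u s) 2 := by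
    intro k u s hs hu
    have := ha.cross (level α k u s) u hu s hs (height_level ha hm hu hs k)
    rwa [angle_level ha hm u hs.1] at this
  refine ⟨level α 0, level α 1, H.continuousOn_level ha hm 0, H.continuousOn_level ha hm 1,
    ?_, ?_, ?_, ?_, ?_, ?_, ?_, ?_, ?_⟩
  · intro u hu s hs
    exact H.level_lt_level ha hm hu hs 0
  · intro u hu s hs
    rw [← h2 u hu s hs]
    exact H.level_lt_level ha hm hu hs 1
  · exact fun u hu s hs => height_level ha hm hu hs 0
  · exact fun u hu s hs => height_level ha hm hu hs 1
  · intro u hu s hs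
    have := (hcr 0 u s hs hu).1
    rwa [hc0, one_mul] at this
  · intro u hu s hs θ hθ
    rw [h1] at hθ
    have := cos_mul_height_pos ha hu hs (H.angle_mem_Ioo ha hm hu hs hθ)
    rwa [hc0, one_mul] at this
  · intro u hu s hs θ hθ
    rw [← h2 u hu s hs] at hθ
    have := cos_mul_height_pos ha hu hs (H.angle_mem_Ioo ha hm hu hs hθ)
    rw [hc1] at this
    linarith
  · intro u hu s hs
    have := H.isOrbitArc_level ha hm hu hs (V := Z.X) (V' := Z.Y) hc0 H.regX
      (fun γ hγ => hγ) (hcr (0 + 1) u s hs hu).1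
    rwa [zero_add] at this
  · intro u hu s hs
    have := H.isOrbitArc_level ha hm hu hs (V := Z.Y) (V' := Z.X) hc1 H.regY
      (fun γ hγ => hγ.symm) (hcr (1 + 1) u s hs hu).2
    rwa [h2 u hu s hs] at this

end Cylinders

/-- Traversing the circles backwards changes the sign of the index, so it may be assumed positive.
-/
theorem exists_cylinders_meridians {r : WithTop ℕ∞} (hr : 1 ≤ r) {Z : PiecewiseField} {M : Set E3}
    (hM : IsCompactRegion M) (hZ : Z.SmoothOn r M)
    (hcross : ∀ p ∈ M ∩ switching, Z.IsCrossing p ∨ Z.IsInvisibleTwoFold p)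
    (hcyl : Z.HasCylinderContinuum M) : ∃ φ A B, Cylinders Z M φ ∧ Meridians Z M φ A B := by
  obtain ⟨φ, H⟩ := exists_cylinders hr hM hZ hcross hcyl
  obtain ⟨α, m, ha⟩ := H.exists_isAngle
  rcases lt_or_gt_of_ne (H.index_ne_zero ha) with hm | hm
  · obtain ⟨A, B, h⟩ := H.reverse.exists_meridians_of_pos ha.reverse (by omega)
    exact ⟨_, A, B, H.reverse, h⟩
  · obtain ⟨A, B, h⟩ := H.exists_meridians_of_pos ha hm
    exact ⟨φ, A, B, H, h⟩

/-! ### Orbits of the normal form and coordinates on its region -/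

/-- The two halves of the normal form: `foldField 1` and `foldField (-1)`. -/
def foldField (ε : ℝ) (p : E3) : E3 := !₂[0, -ε, 2 * p 1]

theorem normalForm_X : normalForm.X = foldField 1 := rfl

theorem normalForm_Y : normalForm.Y = foldField (-1) := by
  funext p; simp [normalForm, foldField]

theorem eq_of_hasDerivWithinAt_zero {f : ℝ → ℝ} {a b : ℝ}
    (h : ∀ t ∈ Icc a b, HasDerivWithinAt f 0 (Icc a b) t) : ∀ t ∈ Icc a b, f t = f a := by
  refine constant_of_has_deriv_right_zero (fun t ht => (h t ht).continuousWithinAt) fun t ht => ?_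
  exact (h t ⟨ht.1, ht.2.le⟩).mono_of_mem_nhdsWithin (by
    filter_upwards [self_mem_nhdsWithin, mem_nhdsWithin_of_mem_nhds (Iio_mem_nhds ht.2)]
      with s hs hs'
    exact ⟨ht.1.trans hs, le_of_lt hs'⟩)

theorem abs_eq_of_sign {ε x : ℝ} (hε : ε = 1 ∨ ε = -1) (h : 0 ≤ ε * x) : |x| = ε * x := by
  rcases hε with rfl | rfl
  · rw [one_mul] at h ⊢; exact abs_of_nonneg h
  · rw [abs_of_nonpos (by linarith)]; ring

/-- The orbits of the normal form, restricted to one side of the normal region. -/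
theorem reaches_foldField_iff {a b c ε : ℝ} (hε : ε = 1 ∨ ε = -1) {p q : E3}
    (hp : p ∈ normalRegion a b c) :
    Reaches (foldField ε) (normalRegion a b c ∩ side ε) p q ↔
      0 ≤ ε * p 2 ∧ 0 ≤ ε * q 2 ∧ p 0 = q 0 ∧ |p 2| + p 1 ^ 2 = |q 2| + q 1 ^ 2 ∧
        ε * q 1 ≤ ε * p 1 := by
  have hε2 : ε * ε = 1 := by rcases hε with rfl | rfl <;> norm_num
  constructor
  · rintro ⟨γ, T, hT, hγ, rfl, rfl⟩
    have m0 : (0 : ℝ) ∈ Icc 0 T := ⟨le_rfl, hT⟩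
    have mT : T ∈ Icc 0 T := ⟨hT, le_rfl⟩
    have s0 : 0 ≤ ε * γ 0 2 := (hγ 0 m0).1.2
    have sT : 0 ≤ ε * γ T 2 := (hγ T mT).1.2
    -- The conserved quantities are `x`, `y + εt` and `εz + y²`.
    have c0 := eq_of_hasDerivWithinAt_zero (f := fun t => γ t 0) (fun t ht => by
      simpa [foldField] using hγ.coord ht 0) T mT
    have c1 := eq_of_hasDerivWithinAt_zero (f := fun t => γ t 1 + ε * t) (fun t ht => by
      have h1 := hγ.coord ht 1
      have h2 := ((hasDerivWithinAt_id t (Icc 0 T)).const_mul ε)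
      exact (h1.add h2).congr_deriv (by simp [foldField])) T mT
    have c2 := eq_of_hasDerivWithinAt_zero (f := fun t => ε * γ t 2 + γ t 1 ^ 2) (fun t ht => by
      have h1 := hγ.coord ht 1
      have h2 := (hγ.coord ht 2).const_mul ε
      exact (h2.add (h1.pow 2)).congr_deriv (by simp [foldField]; ring)) T mT
    simp only at c0 c1 c2
    refine ⟨s0, sT, c0.symm, ?_, ?_⟩
    · rw [abs_eq_of_sign hε s0, abs_eq_of_sign hε sT]; exact c2.symm
    · have : γ 0 1 = γ T 1 + ε * T := by rw [c1]; ring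
      rw [this, mul_add, ← mul_assoc, hε2]; linarith
  · rintro ⟨sp, sq, h0, h1, h2⟩
    rw [abs_eq_of_sign hε sp, abs_eq_of_sign hε sq] at h1
    obtain ⟨hpa, hpb, hpc⟩ := hp
    rw [abs_eq_of_sign hε sp] at hpc
    -- The explicit parabola through `p`. Since `y` moves with velocity `-ε`, the time needed to
    -- reach `q` is `ε (p 1 - q 1)`.
    set γ : ℝ → E3 := fun t => p + t • (!₂[0, -ε, 2 * p 1] : E3) + t ^ 2 • (!₂[0, 0, -ε] : E3)
      with hγ
    have g0 : ∀ t, γ t 0 = p 0 := fun t => by simp [hγ]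
    have g1 : ∀ t, γ t 1 = p 1 - ε * t := fun t => by simp [hγ]; ring
    have g2 : ∀ t, γ t 2 = p 2 + 2 * p 1 * t - ε * t ^ 2 := fun t => by simp [hγ]; ring
    refine ⟨γ, ε * (p 1 - q 1), by linarith, fun t ht => ?_, by simp [hγ], ?_⟩
    · have hcons : ε * γ t 2 + γ t 1 ^ 2 = ε * p 2 + p 1 ^ 2 := by
        rw [g1, g2]
        linear_combination (-t ^ 2 + t ^ 2) * hε2
      -- `εy` runs between its values at `q` and `p`, so `y²` is at most the larger of its values
      -- there, and both are bounded by the conserved `εz + y²`. Hence the arc stays on its side.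
      have hy : γ t 1 ^ 2 ≤ ε * p 2 + p 1 ^ 2 := by
        have e1 : (γ t 1) ^ 2 = (ε * γ t 1) ^ 2 := by rw [mul_pow, pow_two ε, hε2, one_mul]
        have e2 : ε * γ t 1 = ε * p 1 - t := by rw [g1, mul_sub, ← mul_assoc, hε2]; ring
        have e3 : (p 1) ^ 2 = (ε * p 1) ^ 2 := by rw [mul_pow, pow_two ε, hε2, one_mul]
        have e4 : (q 1) ^ 2 = (ε * q 1) ^ 2 := by rw [mul_pow, pow_two ε, hε2, one_mul]
        rw [e1, e2]
        have ht2 : t ≤ ε * p 1 - ε * q 1 := by linarith [ht.2]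
        have ht1 := ht.1
        rcases le_or_gt 0 (ε * p 1 - t) with h | h
        · nlinarith
        · nlinarith
      have hside : 0 ≤ ε * γ t 2 := by linarith
      refine ⟨⟨⟨by rw [g0]; exact hpa, by rw [g0]; exact hpb, ?_⟩, hside⟩, ?_⟩
      · rw [abs_eq_of_sign hε hside, hcons]; exact hpc
      · have hd : HasDerivAt γ ((1 : ℝ) • (!₂[0, -ε, 2 * p 1] : E3) +
            ((2 : ℕ) * t ^ (2 - 1) : ℝ) • (!₂[0, 0, -ε] : E3)) t :=
          (((hasDerivAt_id t).smul_const _).const_add p).add ((hasDerivAt_pow 2 t).smul_const _)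
        refine (hd.congr_deriv ?_).hasDerivWithinAt
        ext i
        fin_cases i
        · simp [foldField]
        · simp [foldField]
        · simp [foldField, g1]; ring
    · have hq2 : q 2 = ε * (ε * p 2 + p 1 ^ 2 - q 1 ^ 2) := by
        rw [h1]; linear_combination -q 2 * hε2
      ext i
      fin_cases i
      · change γ _ 0 = q 0
        rw [g0, h0]
      · change γ _ 1 = q 1
        rw [g1, ← mul_assoc, hε2]; ring
      · change γ _ 2 = q 2
        rw [g2, hq2]
        linear_combination (-p 2 - ε * (p 1 - q 1) ^ 2) * hε2

/-- The position `u` of a point of the normal region, with the orientation `e` of the axis. -/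
def axisCoord (a b e : ℝ) (p : E3) : ℝ := 1 / 2 + e * ((p 0 - a) / (b - a) - 1 / 2)

/-- The cylinder `s` through a point of the normal region. -/
def radiusCoord (c : ℝ) (p : E3) : ℝ := (|p 2| + p 1 ^ 2) / c

/-- The relative position of a point on the orbit of the normal form. -/
def arcCoord (p : E3) : ℝ := p 1 / √(|p 2| + p 1 ^ 2)

theorem continuous_axisCoord (a b e : ℝ) : Continuous (axisCoord a b e) := by
  unfold axisCoord; fun_prop

theorem continuous_radiusCoord (c : ℝ) : Continuous (radiusCoord c) := by
  unfold radiusCoord; fun_prop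

theorem radiusSq_nonneg (p : E3) : 0 ≤ |p 2| + p 1 ^ 2 := by positivity

theorem axisCoord_mem {a b c e : ℝ} (hab : a < b) (he : e = 1 ∨ e = -1) {p : E3}
    (hp : p ∈ normalRegion a b c) : axisCoord a b e p ∈ Icc (0 : ℝ) 1 := by
  obtain ⟨h1, h2, -⟩ := hp
  have h3 : 0 ≤ (p 0 - a) / (b - a) := div_nonneg (by linarith) (by linarith)
  have h4 : (p 0 - a) / (b - a) ≤ 1 := (div_le_one (by linarith)).2 (by linarith)
  unfold axisCoord
  rcases he with rfl | rfl <;> constructor <;> linarith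

theorem radiusCoord_mem {a b c : ℝ} (hc : 0 < c) {p : E3} (hp : p ∈ normalRegion a b c) :
    radiusCoord c p ∈ Icc (0 : ℝ) 1 :=
  ⟨div_nonneg (radiusSq_nonneg p) hc.le, (div_le_one hc).2 hp.2.2⟩

theorem radiusCoord_eq_zero_iff {c : ℝ} (hc : 0 < c) {p : E3} :
    radiusCoord c p = 0 ↔ p 1 = 0 ∧ p 2 = 0 := by
  unfold radiusCoord
  rw [div_eq_zero_iff, or_iff_left hc.ne', add_eq_zero_iff_of_nonneg (abs_nonneg _) (sq_nonneg _),
    abs_eq_zero, sq_eq_zero_iff, and_comm]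

theorem axisCoord_inj {a b e : ℝ} (hab : a < b) (he : e = 1 ∨ e = -1) {p q : E3}
    (h : axisCoord a b e p = axisCoord a b e q) : p 0 = q 0 := by
  unfold axisCoord at h
  have he0 : e ≠ 0 := by rcases he with rfl | rfl <;> norm_num
  have h1 : e * ((p 0 - a) / (b - a) - 1 / 2) = e * ((q 0 - a) / (b - a) - 1 / 2) := by linarith
  have h2 := mul_left_cancel₀ he0 h1
  have h3 : (p 0 - a) / (b - a) = (q 0 - a) / (b - a) := by linarith
  rw [div_left_inj' (by linarith)] at h3
  linarith

theorem radiusCoord_inj {c : ℝ} (hc : 0 < c) {p q : E3} (h : radiusCoord c p = radiusCoord c q) :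
    |p 2| + p 1 ^ 2 = |q 2| + q 1 ^ 2 := by
  unfold radiusCoord at h
  rwa [div_left_inj' hc.ne'] at h

theorem sqrt_pos_of_radiusCoord {c : ℝ} {p : E3} (h : radiusCoord c p ≠ 0) :
    0 < √(|p 2| + p 1 ^ 2) := by
  refine Real.sqrt_pos.2 (lt_of_le_of_ne (radiusSq_nonneg p) fun h0 => h ?_)
  unfold radiusCoord
  rw [← h0, zero_div]

theorem arcCoord_mul_sqrt {c : ℝ} {p : E3} (h : radiusCoord c p ≠ 0) :
    arcCoord p * √(|p 2| + p 1 ^ 2) = p 1 :=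
  div_mul_cancel₀ _ (sqrt_pos_of_radiusCoord h).ne'

/-- With this identity `|z|` measures the distance of the relative position from its extreme values
`±1`: it lies in `[-1, 1]`, and off the axis the ends are exactly the points of Σ. -/
theorem arcCoord_sq {c : ℝ} {p : E3} (h : radiusCoord c p ≠ 0) :
    (1 - arcCoord p ^ 2) * (|p 2| + p 1 ^ 2) = |p 2| := by
  have h1 := arcCoord_mul_sqrt h
  have h2 := Real.sq_sqrt (radiusSq_nonneg p)
  have h3 : arcCoord p ^ 2 * (|p 2| + p 1 ^ 2) = p 1 ^ 2 := by
    nth_rewrite 1 [← h2]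
    rw [← mul_pow, h1]
  linarith

theorem abs_arcCoord_le {c : ℝ} {p : E3} (h : radiusCoord c p ≠ 0) : |arcCoord p| ≤ 1 := by
  have h1 := arcCoord_sq h
  have h2 := Real.sqrt_pos.1 (sqrt_pos_of_radiusCoord h)
  rw [← sq_le_one_iff_abs_le_one]
  by_contra hcon
  push Not at hcon
  have : (1 - arcCoord p ^ 2) * (|p 2| + p 1 ^ 2) < 0 := mul_neg_of_neg_of_pos (by linarith) h2
  linarith [abs_nonneg (p 2)]

theorem abs_arcCoord_lt {c : ℝ} {p : E3} (h : radiusCoord c p ≠ 0) (hz : p 2 ≠ 0) :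
    |arcCoord p| < 1 := by
  have h1 := arcCoord_sq h
  have h2 := Real.sqrt_pos.1 (sqrt_pos_of_radiusCoord h)
  rw [← sq_lt_one_iff_abs_lt_one]
  by_contra hcon
  push Not at hcon
  have : (1 - arcCoord p ^ 2) * (|p 2| + p 1 ^ 2) ≤ 0 :=
    mul_nonpos_of_nonpos_of_nonneg (by linarith) h2.le
  linarith [abs_pos.2 hz]

theorem arcCoord_eq_of_height_eq_zero {c : ℝ} {p : E3} (h : radiusCoord c p ≠ 0) (hz : p 2 = 0) :
    arcCoord p = 1 ∨ arcCoord p = -1 := by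
  have h1 := arcCoord_sq h
  have h2 := Real.sqrt_pos.1 (sqrt_pos_of_radiusCoord h)
  rw [hz, abs_zero] at h1
  rw [hz, abs_zero] at h2
  rcases mul_eq_zero.1 h1 with h3 | h3
  · exact mul_self_eq_one_iff.1 (by linarith [pow_two (arcCoord p)])
  · linarith

theorem continuousAt_arcCoord {c : ℝ} {p : E3} (h : radiusCoord c p ≠ 0) :
    ContinuousAt arcCoord p := by
  unfold arcCoord
  refine ContinuousAt.div (by fun_prop) (by fun_prop) (sqrt_pos_of_radiusCoord h).ne'

/-- The angle in `[a, b]` at the relative position `w ∈ [-1, 1]` of an orbit on the side `ε`. -/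
def branchAngle (ε a b w : ℝ) : ℝ := a + (b - a) * ((1 - ε * w) / 2)

theorem branchAngle_mem_Icc {ε a b w : ℝ} (hε : ε = 1 ∨ ε = -1) (hab : a ≤ b) (hw : |w| ≤ 1) :
    branchAngle ε a b w ∈ Icc a b := by
  obtain ⟨h1, h2⟩ := abs_le.1 hw
  unfold branchAngle
  rcases hε with rfl | rfl <;> constructor <;> nlinarith

theorem branchAngle_mem_Ioo {ε a b w : ℝ} (hε : ε = 1 ∨ ε = -1) (hab : a < b) (hw : |w| < 1) :
    branchAngle ε a b w ∈ Ioo a b := by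
  obtain ⟨h1, h2⟩ := abs_lt.1 hw
  unfold branchAngle
  rcases hε with rfl | rfl <;> constructor <;> nlinarith

/-- On the side `ε` the quantity `εy` decreases in time, so time order becomes the order of angles.
-/
theorem branchAngle_le_iff {ε a b w w' : ℝ} (hab : a < b) :
    branchAngle ε a b w ≤ branchAngle ε a b w' ↔ ε * w' ≤ ε * w := by
  unfold branchAngle
  rw [add_le_add_iff_left, mul_le_mul_iff_right₀ (by linarith)]
  constructor <;> intro h <;> linarith

/-! ### The map between the normal region and the cylinders -/

/-- The homeomorphism of the normal region onto `M`. -/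
def cylinderMap (φ : ℝ → ℝ → ℝ → E3) (A B : ℝ → ℝ → ℝ) (a b c e : ℝ) (p : E3) : E3 :=
  φ (if 0 ≤ p 2 then
      branchAngle 1 (A (axisCoord a b e p) (radiusCoord c p))
        (B (axisCoord a b e p) (radiusCoord c p)) (arcCoord p)
    else
      branchAngle (-1) (B (axisCoord a b e p) (radiusCoord c p))
        (A (axisCoord a b e p) (radiusCoord c p) + 2 * Real.pi) (arcCoord p))
    (axisCoord a b e p) (radiusCoord c p)

section

variable {Z : PiecewiseField} {M : Set E3} {φ : ℝ → ℝ → ℝ → E3} {A B : ℝ → ℝ → ℝ} {a b c e : ℝ}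

theorem cylinderMap_of_nonneg {p : E3} (hp : 0 ≤ p 2) :
    cylinderMap φ A B a b c e p = φ (branchAngle 1 (A (axisCoord a b e p) (radiusCoord c p))
      (B (axisCoord a b e p) (radiusCoord c p)) (arcCoord p))
      (axisCoord a b e p) (radiusCoord c p) := by
  rw [cylinderMap, if_pos hp]

/-- The formulas of the two sides agree on Σ: the relative position `1` has the angles `A` and `A +
2π`, the position `-1` has the angle `B` in both, and on the axis the angle is irrelevant. -/
theorem cylinderMap_of_nonpos (H : Cylinders Z M φ) {p : E3} (hp : p 2 ≤ 0) :
    cylinderMap φ A B a b c e p = φ (branchAngle (-1) (B (axisCoord a b e p) (radiusCoord c p))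
      (A (axisCoord a b e p) (radiusCoord c p) + 2 * Real.pi) (arcCoord p))
      (axisCoord a b e p) (radiusCoord c p) := by
  rcases hp.lt_or_eq with h | h
  · rw [cylinderMap, if_neg (not_le.2 h)]
  · rw [cylinderMap, if_pos h.ge]
    by_cases hs : radiusCoord c p = 0
    · rw [hs, H.axis]
      exact (H.axis _ _).symm
    · rcases arcCoord_eq_of_height_eq_zero hs h with hw | hw
      · rw [hw]
        have := H.periodic (axisCoord a b e p) (radiusCoord c p)
          (A (axisCoord a b e p) (radiusCoord c p))
        simp only at this
        unfold branchAngle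
        rw [show ∀ x y : ℝ, x + (y - x) * ((1 - 1 * 1) / 2) = x by intros; ring,
          show ∀ x y : ℝ, x + (y - x) * ((1 - -1 * 1) / 2) = y by intros; ring, this]
      · rw [hw]
        unfold branchAngle
        rw [show ∀ x y : ℝ, x + (y - x) * ((1 - 1 * -1) / 2) = y by intros; ring,
          show ∀ x y : ℝ, x + (y - x) * ((1 - -1 * -1) / 2) = x by intros; ring]

theorem exists_cylinderMap_eq (p : E3) : ∃ θ, cylinderMap φ A B a b c e p =
    φ θ (axisCoord a b e p) (radiusCoord c p) :=
  ⟨_, rfl⟩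

theorem radiusCoord_mem_Ioc (hc : 0 < c) {p : E3} (hp : p ∈ normalRegion a b c)
    (hs : radiusCoord c p ≠ 0) : radiusCoord c p ∈ Ioc (0 : ℝ) 1 :=
  ⟨lt_of_le_of_ne (radiusCoord_mem hc hp).1 hs.symm, (radiusCoord_mem hc hp).2⟩

theorem cylinderMap_height_pos (Me : Meridians Z M φ A B) (hab : a < b) (hc : 0 < c)
    (he : e = 1 ∨ e = -1) {p : E3} (hp : p ∈ normalRegion a b c) (hz : 0 < p 2) :
    0 < cylinderMap φ A B a b c e p 2 := by
  have hs : radiusCoord c p ≠ 0 := fun h => hz.ne' ((radiusCoord_eq_zero_iff hc).1 h).2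
  have hu := axisCoord_mem hab he hp
  have hs' := radiusCoord_mem_Ioc hc hp hs
  rw [cylinderMap_of_nonneg hz.le]
  exact Me.pos _ hu _ hs' _ (branchAngle_mem_Ioo (Or.inl rfl) (Me.lt _ hu _ hs')
    (abs_arcCoord_lt hs hz.ne'))

theorem cylinderMap_height_neg (H : Cylinders Z M φ) (Me : Meridians Z M φ A B) (hab : a < b)
    (hc : 0 < c) (he : e = 1 ∨ e = -1) {p : E3} (hp : p ∈ normalRegion a b c) (hz : p 2 < 0) :
    cylinderMap φ A B a b c e p 2 < 0 := by
  have hs : radiusCoord c p ≠ 0 := fun h => hz.ne ((radiusCoord_eq_zero_iff hc).1 h).2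
  have hu := axisCoord_mem hab he hp
  have hs' := radiusCoord_mem_Ioc hc hp hs
  rw [cylinderMap_of_nonpos H hz.le]
  exact Me.neg _ hu _ hs' _ (branchAngle_mem_Ioo (Or.inr rfl) (Me.lt' _ hu _ hs')
    (abs_arcCoord_lt hs hz.ne))

theorem cylinderMap_height_zero (H : Cylinders Z M φ) (Me : Meridians Z M φ A B) (hab : a < b)
    (hc : 0 < c) (he : e = 1 ∨ e = -1) {p : E3} (hp : p ∈ normalRegion a b c) (hz : p 2 = 0) :
    cylinderMap φ A B a b c e p 2 = 0 := by
  have hu := axisCoord_mem hab he hp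
  rw [cylinderMap_of_nonneg hz.ge]
  by_cases hs : radiusCoord c p = 0
  · rw [hs, H.axis]
    exact (H.fold _ hu).1
  · have hs' := radiusCoord_mem_Ioc hc hp hs
    unfold branchAngle
    rcases arcCoord_eq_of_height_eq_zero hs hz with hw | hw
    · rw [hw, show ∀ x y : ℝ, x + (y - x) * ((1 - 1 * 1) / 2) = x by intros; ring]
      exact Me.zeroA _ hu _ hs'
    · rw [hw, show ∀ x y : ℝ, x + (y - x) * ((1 - 1 * -1) / 2) = y by intros; ring]
      exact Me.zeroB _ hu _ hs'

theorem cylinderMap_mem_side (H : Cylinders Z M φ) (Me : Meridians Z M φ A B) (hab : a < b)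
    (hc : 0 < c) (he : e = 1 ∨ e = -1) {ε : ℝ} (hε : ε = 1 ∨ ε = -1) {p : E3}
    (hp : p ∈ normalRegion a b c) :
    cylinderMap φ A B a b c e p ∈ side ε ↔ 0 ≤ ε * p 2 := by
  change 0 ≤ ε * cylinderMap φ A B a b c e p 2 ↔ _
  rcases lt_trichotomy (p 2) 0 with h | h | h
  · have := cylinderMap_height_neg H Me hab hc he hp h
    rcases hε with rfl | rfl <;> constructor <;> intro <;> linarith
  · have := cylinderMap_height_zero H Me hab hc he hp h
    rw [this, h]
  · have := cylinderMap_height_pos Me hab hc he hp h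
    rcases hε with rfl | rfl <;> constructor <;> intro <;> linarith

theorem isClosed_normalRegion (a b c : ℝ) : IsClosed (normalRegion a b c) := by
  have h1 : IsClosed {p : E3 | a ≤ p 0} := isClosed_le continuous_const (by fun_prop)
  have h2 : IsClosed {p : E3 | p 0 ≤ b} := isClosed_le (by fun_prop) continuous_const
  have h3 : IsClosed {p : E3 | |p 2| + p 1 ^ 2 ≤ c} := isClosed_le (by fun_prop) continuous_const
  exact h1.inter (h2.inter h3)

theorem isCompact_normalRegion (a b c : ℝ) : IsCompact (normalRegion a b c) := by
  refine isCompact_of_isClosed_isBounded (isClosed_normalRegion a b c) ?_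
  refine (isBounded_iff_forall_norm_le).2 ⟨√((|a| + |b|) ^ 2 + c + c ^ 2), fun p hp => ?_⟩
  obtain ⟨h1, h2, h3⟩ := hp
  rw [EuclideanSpace.norm_eq]
  refine Real.sqrt_le_sqrt ?_
  rw [Fin.sum_univ_three]
  simp only [Real.norm_eq_abs, sq_abs]
  have e0 : p 0 ^ 2 ≤ (|a| + |b|) ^ 2 := by
    rw [← sq_abs (p 0)]
    refine pow_le_pow_left₀ (abs_nonneg _) ?_ 2
    rw [abs_le]
    constructor
    · linarith [neg_abs_le a, abs_nonneg b]
    · linarith [le_abs_self b, abs_nonneg a]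
  have e1 : p 1 ^ 2 ≤ c := by linarith [abs_nonneg (p 2)]
  have e2 : p 2 ^ 2 ≤ c ^ 2 := by
    rw [← sq_abs (p 2)]
    exact pow_le_pow_left₀ (abs_nonneg _) (by linarith [sq_nonneg (p 1)]) 2
  linarith

/-- The relative position has no limit at the axis, but there `φ` does not depend on the angle, so
`Cylinders.continuousOn_comp` applies on each closed half. -/
theorem continuousOn_cylinderMap (H : Cylinders Z M φ) (Me : Meridians Z M φ A B) (hab : a < b)
    (hc : 0 < c) (he : e = 1 ∨ e = -1) :
    ContinuousOn (cylinderMap φ A B a b c e) (normalRegion a b c) := by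
  have branch : ∀ (ε : ℝ) (F G : ℝ → ℝ → ℝ) (S : Set E3), S ⊆ normalRegion a b c →
      ContinuousOn (fun p : ℝ × ℝ => F p.1 p.2) (Icc 0 1 ×ˢ Ioc 0 1) →
      ContinuousOn (fun p : ℝ × ℝ => G p.1 p.2) (Icc 0 1 ×ˢ Ioc 0 1) →
      ContinuousOn (fun p => φ (branchAngle ε (F (axisCoord a b e p) (radiusCoord c p))
        (G (axisCoord a b e p) (radiusCoord c p)) (arcCoord p))
        (axisCoord a b e p) (radiusCoord c p)) S := by
    intro ε F G S hS hF hG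
    refine H.continuousOn_comp (continuous_axisCoord a b e).continuousOn
      (continuous_radiusCoord c).continuousOn fun p hp hs => ?_
    have hmem : (axisCoord a b e p, radiusCoord c p) ∈ Icc (0 : ℝ) 1 ×ˢ Ioc (0 : ℝ) 1 :=
      ⟨axisCoord_mem hab he (hS hp), radiusCoord_mem_Ioc hc (hS hp) hs⟩
    have hcoord : ContinuousWithinAt (fun p => (axisCoord a b e p, radiusCoord c p)) S p :=
      ((continuous_axisCoord a b e).prodMk (continuous_radiusCoord c)).continuousWithinAt
    have hin : ∀ᶠ q in 𝓝[S] p, (axisCoord a b e q, radiusCoord c q) ∈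
        Icc (0 : ℝ) 1 ×ˢ Ioc (0 : ℝ) 1 := by
      have : ∀ᶠ q in 𝓝 p, radiusCoord c q ≠ 0 :=
        (continuous_radiusCoord c).continuousAt.eventually_ne hs
      filter_upwards [mem_nhdsWithin_of_mem_nhds this, self_mem_nhdsWithin] with q hq hq'
      exact ⟨axisCoord_mem hab he (hS hq'), radiusCoord_mem_Ioc hc (hS hq') hq⟩
    have comp : ∀ F : ℝ → ℝ → ℝ,
        ContinuousOn (fun p : ℝ × ℝ => F p.1 p.2) (Icc 0 1 ×ˢ Ioc 0 1) →
        ContinuousWithinAt (fun p => F (axisCoord a b e p) (radiusCoord c p)) S p := by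
      intro F hF
      have h1 := (hF _ hmem).tendsto
      have h2 : Tendsto (fun p => (axisCoord a b e p, radiusCoord c p)) (𝓝[S] p)
          (𝓝[Icc (0 : ℝ) 1 ×ˢ Ioc (0 : ℝ) 1] (axisCoord a b e p, radiusCoord c p)) :=
        tendsto_nhdsWithin_iff.2 ⟨hcoord.tendsto, hin⟩
      exact h1.comp h2
    have hF' := comp F hF
    have hG' := comp G hG
    have hw : ContinuousWithinAt arcCoord S p := (continuousAt_arcCoord hs).continuousWithinAt
    unfold branchAngle
    exact hF'.add ((hG'.sub hF').mul
      ((continuousWithinAt_const.sub (continuousWithinAt_const.mul hw)).div_const 2))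
  have hU : IsClosed {p : E3 | 0 ≤ p 2} := isClosed_le continuous_const (by fun_prop)
  have hL : IsClosed {p : E3 | p 2 ≤ 0} := isClosed_le (by fun_prop) continuous_const
  have h1 : ContinuousOn (cylinderMap φ A B a b c e) (normalRegion a b c ∩ {p | 0 ≤ p 2}) :=
    (branch 1 A B _ inter_subset_left Me.contA Me.contB).congr
      fun p hp => cylinderMap_of_nonneg hp.2
  have h2 : ContinuousOn (cylinderMap φ A B a b c e) (normalRegion a b c ∩ {p | p 2 ≤ 0}) :=
    (branch (-1) B (fun u s => A u s + 2 * Real.pi) _ inter_subset_left Me.contB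
      (Me.contA.add continuousOn_const)).congr fun p hp => cylinderMap_of_nonpos H hp.2
  have h3 := h1.union_of_isClosed h2 ((isClosed_normalRegion a b c).inter hU)
    ((isClosed_normalRegion a b c).inter hL)
  refine h3.mono fun p hp => ?_
  rcases le_total 0 (p 2) with h | h
  · exact Or.inl ⟨hp, h⟩
  · exact Or.inr ⟨hp, h⟩

theorem int_eq_zero_of_mem_Icc {x y z n : ℝ} {k : ℤ} (hx : x ∈ Icc y z)
    (hx' : x + k * n ∈ Icc y z) (h : z < y + n) : k = 0 := by
  have hn : 0 < n := by linarith [hx.1, hx.2]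
  by_contra hk
  rcases lt_or_gt_of_ne hk with h1 | h1
  · have : (k : ℝ) ≤ -1 := by exact_mod_cast Int.le_sub_one_of_lt h1
    nlinarith [hx.2, hx'.1]
  · have : (1 : ℝ) ≤ k := by exact_mod_cast h1
    nlinarith [hx.1, hx'.2]

/-- Comparison of the positions of two points of the same orbit on the side `ε`. -/
theorem arcCoord_le_iff (hc : 0 < c) {ε : ℝ} {p q : E3} (hs : radiusCoord c p ≠ 0)
    (h : radiusCoord c p = radiusCoord c q) :
    ε * arcCoord q ≤ ε * arcCoord p ↔ ε * q 1 ≤ ε * p 1 := by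
  have hσ := radiusCoord_inj hc h
  have h1 := arcCoord_mul_sqrt hs
  have h2 := arcCoord_mul_sqrt (h ▸ hs)
  have h3 := sqrt_pos_of_radiusCoord hs
  rw [← hσ] at h2
  rw [← h1, ← h2, ← mul_assoc, ← mul_assoc, mul_le_mul_iff_left₀ h3]

/-- `u` and `s` determine `x` and `|z| + y²`, and the image shows the side. On one side the angles
fill an interval shorter than a full turn, so the angle and with it `y` are determined; then so is
`z`. -/
theorem injOn_cylinderMap (H : Cylinders Z M φ) (Me : Meridians Z M φ A B) (hab : a < b)
    (hc : 0 < c) (he : e = 1 ∨ e = -1) :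
    InjOn (cylinderMap φ A B a b c e) (normalRegion a b c) := by
  intro p hp q hq heq
  have hup := axisCoord_mem hab he hp
  have huq := axisCoord_mem hab he hq
  obtain ⟨hu, hs, hθ⟩ := H.inj _ _ _ hup _ huq _ (radiusCoord_mem hc hp) _
    (radiusCoord_mem hc hq) heq
  have h0 := axisCoord_inj hab he hu
  have hσ := radiusCoord_inj hc hs
  by_cases hs0 : radiusCoord c p = 0
  · have h1 := (radiusCoord_eq_zero_iff hc).1 hs0
    have h2 := (radiusCoord_eq_zero_iff hc).1 (hs ▸ hs0)
    ext i
    fin_cases i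
    · exact h0
    · exact h1.1.trans h2.1.symm
    · exact h1.2.trans h2.2.symm
  · have hs' := radiusCoord_mem_Ioc hc hp hs0
    have key : ∀ ε : ℝ, (ε = 1 ∨ ε = -1) → ∀ x y : ℝ, x < y → y < x + 2 * Real.pi →
        0 ≤ ε * p 2 → 0 ≤ ε * q 2 →
        cylinderMap φ A B a b c e p = φ (branchAngle ε x y (arcCoord p))
          (axisCoord a b e p) (radiusCoord c p) →
        cylinderMap φ A B a b c e q = φ (branchAngle ε x y (arcCoord q))
          (axisCoord a b e p) (radiusCoord c p) → p = q := by
      intro ε hε x y hxy hyx hzp hzq e1 e2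
      rw [e1, e2] at heq
      obtain ⟨-, -, h1⟩ := H.inj _ _ _ hup _ hup _ (radiusCoord_mem hc hp) _
        (radiusCoord_mem hc hp) heq
      obtain ⟨n, hn⟩ := h1.resolve_left hs0
      have m1 := branchAngle_mem_Icc (ε := ε) (w := arcCoord p) hε hxy.le (abs_arcCoord_le hs0)
      have m2 := branchAngle_mem_Icc (ε := ε) (w := arcCoord q) hε hxy.le
        (abs_arcCoord_le (c := c) (hs ▸ hs0))
      have hn0 : n = 0 := int_eq_zero_of_mem_Icc m1 (hn ▸ m2) hyx
      rw [hn0, Int.cast_zero, zero_mul, add_zero] at hn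
      have l1 := (arcCoord_le_iff (ε := ε) hc hs0 hs).1 ((branchAngle_le_iff hxy).1 hn.ge)
      have l2 := (arcCoord_le_iff (ε := ε) hc (hs ▸ hs0) hs.symm).1
        ((branchAngle_le_iff hxy).1 hn.le)
      have hε0 : ε ≠ 0 := by rcases hε with rfl | rfl <;> norm_num
      have hy : p 1 = q 1 := mul_left_cancel₀ hε0 (le_antisymm l2 l1)
      have hz : p 2 = q 2 := by
        rw [abs_eq_of_sign hε hzp, abs_eq_of_sign hε hzq, hy] at hσ
        exact mul_left_cancel₀ hε0 (by linarith)
      ext i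
      fin_cases i
      · exact h0
      · exact hy
      · exact hz
    have hside : ∀ ε : ℝ, (ε = 1 ∨ ε = -1) → (0 ≤ ε * p 2 ↔ 0 ≤ ε * q 2) := by
      intro ε hε
      rw [← cylinderMap_mem_side H Me hab hc he hε hp, ← cylinderMap_mem_side H Me hab hc he hε hq,
        heq]
    rcases le_total 0 (p 2) with h | h
    · have hq2 : 0 ≤ q 2 := by simpa using (hside 1 (Or.inl rfl)).1 (by simpa using h)
      refine key 1 (Or.inl rfl) _ _ (Me.lt _ hup _ hs') (Me.lt' _ hup _ hs') (by simpa using h)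
        (by simpa using hq2) (cylinderMap_of_nonneg h) ?_
      rw [cylinderMap_of_nonneg hq2, ← hu, ← hs]
    · have hq2 : q 2 ≤ 0 := by simpa using (hside (-1) (Or.inr rfl)).1 (by simpa using h)
      refine key (-1) (Or.inr rfl) _ _ (Me.lt' _ hup _ hs') ?_ (by simpa using h)
        (by simpa using hq2) (cylinderMap_of_nonpos H h) ?_
      · linarith [Me.lt _ hup _ hs']
      · rw [cylinderMap_of_nonpos H hq2, ← hu, ← hs]

/-- The point of the normal region with given position, cylinder and relative position on the
orbit on the side `ε`. -/
theorem exists_mem_normalRegion (hab : a < b) (hc : 0 < c) (he : e = 1 ∨ e = -1) {ε : ℝ}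
    (hε : ε = 1 ∨ ε = -1) {u s w : ℝ} (hu : u ∈ Icc (0 : ℝ) 1) (hs : s ∈ Icc (0 : ℝ) 1)
    (hw : |w| ≤ 1) : ∃ p ∈ normalRegion a b c, axisCoord a b e p = u ∧ radiusCoord c p = s ∧
      0 ≤ ε * p 2 ∧ (s ≠ 0 → arcCoord p = w) := by
  have hcs : 0 ≤ c * s := mul_nonneg hc.le hs.1
  have hw2 : w ^ 2 ≤ 1 := (sq_le_one_iff_abs_le_one w).2 hw
  have hε2 : ε * ε = 1 := by rcases hε with rfl | rfl <;> norm_num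
  have hba : 0 < b - a := by linarith
  set p : E3 := !₂[a + (b - a) * (1 / 2 + e * (u - 1 / 2)), √(c * s) * w, ε * (c * s * (1 - w ^ 2))]
    with hp
  have p0 : p 0 = a + (b - a) * (1 / 2 + e * (u - 1 / 2)) := rfl
  have p1 : p 1 = √(c * s) * w := rfl
  have p2 : p 2 = ε * (c * s * (1 - w ^ 2)) := rfl
  have hεz : ε * p 2 = c * s * (1 - w ^ 2) := by rw [p2, ← mul_assoc, hε2, one_mul]
  have hz : 0 ≤ ε * p 2 := by rw [hεz]; exact mul_nonneg hcs (by linarith)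
  have hσ : |p 2| + p 1 ^ 2 = c * s := by
    rw [abs_eq_of_sign hε hz, hεz, p1, mul_pow, Real.sq_sqrt hcs]; ring
  have hx : 0 ≤ 1 / 2 + e * (u - 1 / 2) ∧ 1 / 2 + e * (u - 1 / 2) ≤ 1 := by
    rcases he with rfl | rfl <;> constructor <;> linarith [hu.1, hu.2]
  refine ⟨p, ⟨?_, ?_, ?_⟩, ?_, ?_, hz, fun hs0 => ?_⟩
  · rw [p0]; nlinarith [hx.1]
  · rw [p0]; nlinarith [hx.2]
  · rw [hσ]; nlinarith [hs.2]
  · unfold axisCoord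
    rw [p0, add_sub_cancel_left, mul_div_cancel_left₀ _ hba.ne']
    rcases he with rfl | rfl <;> ring
  · unfold radiusCoord
    rw [hσ, mul_div_cancel_left₀ _ hc.ne']
  · unfold arcCoord
    have : 0 < c * s := mul_pos hc (lt_of_le_of_ne hs.1 hs0.symm)
    rw [hσ, p1, mul_div_cancel_left₀ _ (Real.sqrt_pos.2 this).ne']

theorem exists_branchAngle_eq {ε x y θ : ℝ} (hε : ε = 1 ∨ ε = -1) (hxy : x < y)
    (hθ : θ ∈ Icc x y) : ∃ w, |w| ≤ 1 ∧ branchAngle ε x y w = θ := by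
  have h0 : 0 < y - x := by linarith
  have h1 : 0 ≤ (θ - x) / (y - x) := div_nonneg (by linarith [hθ.1]) h0.le
  have h2 : (θ - x) / (y - x) ≤ 1 := (div_le_one h0).2 (by linarith [hθ.2])
  refine ⟨ε * (1 - 2 * ((θ - x) / (y - x))), ?_, ?_⟩
  · rw [abs_le]
    rcases hε with rfl | rfl <;> constructor <;> linarith
  · unfold branchAngle
    have hε2 : ε * ε = 1 := by rcases hε with rfl | rfl <;> norm_num
    rw [← mul_assoc, hε2, one_mul, show (1 - (1 - 2 * ((θ - x) / (y - x)))) / 2 =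
      (θ - x) / (y - x) by ring, mul_div_cancel₀ _ h0.ne']
    ring

theorem surjOn_cylinderMap (H : Cylinders Z M φ) (Me : Meridians Z M φ A B) (hab : a < b)
    (hc : 0 < c) (he : e = 1 ∨ e = -1) :
    SurjOn (cylinderMap φ A B a b c e) (normalRegion a b c) M := by
  intro m hm
  obtain ⟨θ, u, hu, s, hs, rfl⟩ := H.surj m hm
  by_cases hs0 : s = 0
  · obtain ⟨p, hp, hpu, hps, -⟩ := exists_mem_normalRegion hab hc he (ε := 1) (Or.inl rfl) hu hs
      (w := 0) (by simp)
    obtain ⟨θ', hθ'⟩ := exists_cylinderMap_eq (φ := φ) (A := A) (B := B) (a := a) (b := b) (c := c)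
      (e := e) p
    refine ⟨p, hp, ?_⟩
    rw [hθ', hpu, hps, hs0, H.axis, ← H.axis θ]
  · have hs' : s ∈ Ioc (0 : ℝ) 1 := ⟨lt_of_le_of_ne hs.1 (Ne.symm hs0), hs.2⟩
    obtain ⟨θ', hθ', hθe⟩ := (H.periodic u s).exists_mem_Ico Real.two_pi_pos θ (A u s)
    rw [hθe]
    rcases le_total θ' (B u s) with h | h
    · obtain ⟨w, hw, hwe⟩ := exists_branchAngle_eq (ε := 1) (Or.inl rfl) (Me.lt u hu s hs')
        ⟨hθ'.1, h⟩
      obtain ⟨p, hp, hpu, hps, hpz, hpw⟩ := exists_mem_normalRegion hab hc he (ε := 1) (Or.inl rfl)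
        hu hs hw
      refine ⟨p, hp, ?_⟩
      rw [cylinderMap_of_nonneg (by simpa using hpz), hpu, hps, hpw hs0, hwe]
    · obtain ⟨w, hw, hwe⟩ := exists_branchAngle_eq (ε := -1) (Or.inr rfl) (Me.lt' u hu s hs')
        ⟨h, hθ'.2.le⟩
      obtain ⟨p, hp, hpu, hps, hpz, hpw⟩ := exists_mem_normalRegion hab hc he (ε := -1)
        (Or.inr rfl) hu hs hw
      refine ⟨p, hp, ?_⟩
      rw [cylinderMap_of_nonpos H (by simpa using hpz), hpu, hps, hpw hs0, hwe]

/-- `cylinderMap` maps the orbits on the side `ε` of the normal form to those of `V`. -/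
theorem reaches_cylinderMap_iff (H : Cylinders Z M φ) (Me : Meridians Z M φ A B) (hab : a < b)
    (hc : 0 < c) (he : e = 1 ∨ e = -1) {ε : ℝ} (hε : ε = 1 ∨ ε = -1) {V : E3 → E3}
    {F G : ℝ → ℝ → ℝ} (hV : RegularOn V (M ∩ side ε))
    (hfold : ∀ u ∈ Icc (0 : ℝ) 1, φ 0 u 0 2 = 0 ∧ V (φ 0 u 0) 2 = 0 ∧
      ε * lieDeriv V (lieDeriv V height) (φ 0 u 0) < 0)
    (hk : ∀ p, 0 ≤ ε * p 2 → cylinderMap φ A B a b c e p =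
      φ (branchAngle ε (F (axisCoord a b e p) (radiusCoord c p))
        (G (axisCoord a b e p) (radiusCoord c p)) (arcCoord p))
        (axisCoord a b e p) (radiusCoord c p))
    (hFG : ∀ u ∈ Icc (0 : ℝ) 1, ∀ s ∈ Ioc (0 : ℝ) 1, F u s < G u s ∧ G u s < F u s + 2 * Real.pi)
    (harc : ∀ u ∈ Icc (0 : ℝ) 1, ∀ s ∈ Ioc (0 : ℝ) 1,
      IsOrbitArc V (M ∩ side ε) (fun θ => φ θ u s) (F u s) (G u s))
    {p q : E3} (hp : p ∈ normalRegion a b c) (hq : q ∈ normalRegion a b c) :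
    Reaches V (M ∩ side ε) (cylinderMap φ A B a b c e p) (cylinderMap φ A B a b c e q) ↔
      Reaches (foldField ε) (normalRegion a b c ∩ side ε) p q := by
  rw [reaches_foldField_iff hε hp]
  have hup := axisCoord_mem hab he hp
  have huq := axisCoord_mem hab he hq
  constructor
  · intro hr
    have hpz : 0 ≤ ε * p 2 := by
      obtain ⟨γ, T, hT, hγ, h0, -⟩ := hr
      rw [← cylinderMap_mem_side H Me hab hc he hε hp, ← h0]
      exact (hγ 0 ⟨le_rfl, hT⟩).1.2
    have hqz : 0 ≤ ε * q 2 := by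
      obtain ⟨γ, T, hT, hγ, -, h1⟩ := hr
      rw [← cylinderMap_mem_side H Me hab hc he hε hq, ← h1]
      exact (hγ T ⟨hT, le_rfl⟩).1.2
    -- On the axis the only arcs are those of zero duration, because the field bends to the other
    -- side; off the axis the description of the orbit by angles applies.
    by_cases hs : radiusCoord c p = 0
    · have hpq : p = q := by
        refine injOn_cylinderMap H Me hab hc he hp hq ?_
        obtain ⟨γ, T, hT, hγ, h0, h1⟩ := hr
        rcases hT.eq_or_lt with hT | hT
        · rw [← h0, ← h1, hT]
        · exfalso
          have hγ0 : γ 0 = φ 0 (axisCoord a b e p) 0 := by rw [h0, hk p hpz, hs, H.axis]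
          obtain ⟨f0, f1, f2⟩ := hfold _ hup
          refine not_isArc_of_fold (V := V) (ε := ε) (t := 0) (γ := γ) hT ?_ ?_ ?_ ?_
            (hγ.mono inter_subset_right (by rw [zero_add]))
          · exact (hV.contDiffAt (hγ 0 ⟨le_rfl, hT.le⟩).1).differentiableAt one_ne_zero
          · rw [hγ0]; exact f0
          · rw [hγ0]; exact f1
          · rw [hγ0]; exact f2
      subst hpq
      exact ⟨hpz, hpz, rfl, rfl, le_rfl⟩
    · have hs' := radiusCoord_mem_Ioc hc hp hs
      obtain ⟨hlt, hlt'⟩ := hFG _ hup _ hs'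
      have m1 := branchAngle_mem_Icc (ε := ε) (w := arcCoord p) hε hlt.le (abs_arcCoord_le hs)
      rw [hk p hpz] at hr
      obtain ⟨θ, hθ, hqe⟩ := (harc _ hup _ hs').of_reaches _ m1 _ hr
      rw [hk q hqz] at hqe
      obtain ⟨hu, hss, hn⟩ := H.inj _ _ _ huq _ hup _ (radiusCoord_mem hc hq) _
        (radiusCoord_mem hc hp) hqe
      have hsq : radiusCoord c q ≠ 0 := hss ▸ hs
      obtain ⟨n, hn⟩ := hn.resolve_left hsq
      have m2 := branchAngle_mem_Icc (ε := ε) (w := arcCoord q) hε hlt.le (abs_arcCoord_le hsq)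
      rw [hu, hss] at hn
      have hθ' : θ ∈ Icc (F (axisCoord a b e p) (radiusCoord c p))
        (G (axisCoord a b e p) (radiusCoord c p)) := ⟨m1.1.trans hθ.1, hθ.2⟩
      -- Both angles lie in the interval of the arc, which is shorter than `2π`.
      have hn0 : n = 0 := int_eq_zero_of_mem_Icc m2 (hn ▸ hθ') hlt'
      rw [hn0, Int.cast_zero, zero_mul, add_zero] at hn
      rw [hn, mem_Icc] at hθ
      exact ⟨hpz, hqz, axisCoord_inj hab he hu.symm, radiusCoord_inj hc hss.symm,
        (arcCoord_le_iff hc hs hss.symm).1 ((branchAngle_le_iff hlt).1 hθ.1)⟩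
  · rintro ⟨hpz, hqz, h0, hσ, hy⟩
    have hu : axisCoord a b e p = axisCoord a b e q := by unfold axisCoord; rw [h0]
    have hss : radiusCoord c p = radiusCoord c q := by unfold radiusCoord; rw [hσ]
    by_cases hs : radiusCoord c p = 0
    · have h1 := (radiusCoord_eq_zero_iff hc).1 hs
      have h2 := (radiusCoord_eq_zero_iff hc).1 (hss ▸ hs)
      have hpq : p = q := by
        ext i
        fin_cases i
        · exact h0
        · exact h1.1.trans h2.1.symm
        · exact h1.2.trans h2.2.symm
      subst hpq
      refine ⟨fun _ => cylinderMap φ A B a b c e p, 0, le_rfl, fun t ht => ⟨⟨H.mem _ _ _,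
        (cylinderMap_mem_side H Me hab hc he hε hp).2 hpz⟩, ?_⟩, rfl, rfl⟩
      have ht0 : t = 0 := le_antisymm ht.2 ht.1
      rw [ht0, Icc_self]
      exact HasFDerivWithinAt.singleton
    · have hs' := radiusCoord_mem_Ioc hc hp hs
      obtain ⟨hlt, hlt'⟩ := hFG _ hup _ hs'
      rw [hk p hpz, hk q hqz, ← hu, ← hss]
      exact (harc _ hup _ hs').reaches _
        (branchAngle_mem_Icc (ε := ε) (w := arcCoord p) hε hlt.le (abs_arcCoord_le hs)) _
        (branchAngle_mem_Icc (ε := ε) (w := arcCoord q) hε hlt.le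
          (abs_arcCoord_le (c := c) (hss ▸ hs)))
        ((branchAngle_le_iff hlt).2 ((arcCoord_le_iff hc hs hss).2 hy))

/-- The homeomorphism of `M` onto the normal region. -/
theorem exists_homeomorph (H : Cylinders Z M φ) (Me : Meridians Z M φ A B) (hab : a < b)
    (hc : 0 < c) (he : e = 1 ∨ e = -1) :
    ∃ h : M ≃ₜ normalRegion a b c, ∀ p : M, (p : E3) = cylinderMap φ A B a b c e (h p) := by
  have hcs : CompactSpace (normalRegion a b c) :=
    isCompact_iff_compactSpace.1 (isCompact_normalRegion a b c)
  set k : normalRegion a b c → M := fun p => ⟨cylinderMap φ A B a b c e p, H.mem _ _ _⟩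
  have hk : Function.Bijective k := by
    constructor
    · intro p q h
      exact Subtype.ext (injOn_cylinderMap H Me hab hc he p.2 q.2 (congrArg Subtype.val h))
    · intro m
      obtain ⟨p, hp, hpe⟩ := surjOn_cylinderMap H Me hab hc he m.2
      exact ⟨⟨p, hp⟩, Subtype.ext hpe⟩
  have hkc : Continuous (Equiv.ofBijective k hk) := by
    refine Continuous.subtype_mk ?_ _
    exact (continuousOn_cylinderMap H Me hab hc he).domRestrict
  refine ⟨(hkc.homeoOfEquivCompactToT2).symm, fun p => ?_⟩
  have := (hkc.homeoOfEquivCompactToT2).apply_symm_apply p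
  exact (congrArg Subtype.val this).symm

theorem sigmaEquivalent_of_homeomorph (H : Cylinders Z M φ) (Me : Meridians Z M φ A B)
    (hab : a < b) (hc : 0 < c) (he : e = 1 ∨ e = -1) (h : M ≃ₜ normalRegion a b c)
    (hh : ∀ p : M, (p : E3) = cylinderMap φ A B a b c e (h p)) (ho : OrientationPreserving h) :
    SigmaEquivalent Z M normalForm (normalRegion a b c) := by
  have hX : ∀ p q : M, Reaches Z.X (M ∩ upperSide) p q ↔
      Reaches normalForm.X (normalRegion a b c ∩ upperSide) (h p) (h q) := by
    intro p q
    rw [upperSide_eq_side, normalForm_X]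
    nth_rewrite 1 [hh p]
    nth_rewrite 1 [hh q]
    refine reaches_cylinderMap_iff H Me hab hc he (Or.inl rfl) (F := A) (G := B) H.regX ?_
      (fun p hp => cylinderMap_of_nonneg (by simpa using hp))
      (fun u hu s hs => ⟨Me.lt u hu s hs, Me.lt' u hu s hs⟩) Me.upper (h p).2 (h q).2
    intro u hu
    obtain ⟨f0, f1, f2, -, -⟩ := H.fold u hu
    rw [lieDeriv_height] at f1
    exact ⟨f0, f1, by linarith⟩
  have hY : ∀ p q : M, Reaches Z.Y (M ∩ lowerSide) p q ↔
      Reaches normalForm.Y (normalRegion a b c ∩ lowerSide) (h p) (h q) := by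
    intro p q
    rw [lowerSide_eq_side, normalForm_Y]
    nth_rewrite 1 [hh p]
    nth_rewrite 1 [hh q]
    refine reaches_cylinderMap_iff H Me hab hc he (Or.inr rfl) (F := B)
      (G := fun u s => A u s + 2 * Real.pi) H.regY ?_
      (fun p hp => cylinderMap_of_nonpos H (by simpa using hp))
      (fun u hu s hs => ⟨Me.lt' u hu s hs, by linarith [Me.lt u hu s hs]⟩) Me.lower (h p).2 (h q).2
    intro u hu
    obtain ⟨f0, -, -, f3, f4⟩ := H.fold u hu
    rw [lieDeriv_height] at f3
    exact ⟨f0, f3, by linarith⟩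
  refine ⟨h, ho, fun p => ?_, fun p q => or_congr (hX p q) (hX q p),
    fun p q => or_congr (hY p q) (hY q p), fun p q => (hX p q).1, fun p q => (hY p q).1⟩
  rw [hh p]
  change cylinderMap φ A B a b c e (h p) 2 = 0 ↔ ((h p : E3) 2 = 0)
  rcases lt_trichotomy ((h p : E3) 2) 0 with h1 | h1 | h1
  · exact iff_of_false (cylinderMap_height_neg H Me hab hc he (h p).2 h1).ne h1.ne
  · exact iff_of_true (cylinderMap_height_zero H Me hab hc he (h p).2 h1) h1
  · exact iff_of_false (cylinderMap_height_pos Me hab hc he (h p).2 h1).ne' h1.ne'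

end

/-! ### Local degree through homotopies of maps of the sphere -/

/-- Two maps of the unit sphere to `ℝ³ \ {0}` are homotopic. -/
def SphereHomotopic (f g : sphere (0 : E3) 1 → E3) : Prop :=
  ∃ F G : C(sphere (0 : E3) 1, {v : E3 // v ≠ 0}),
    (∀ v, (F v : E3) = f v) ∧ (∀ v, (G v : E3) = g v) ∧ F.Homotopic G

theorem SphereHomotopic.trans {f g k : sphere (0 : E3) 1 → E3} (h : SphereHomotopic f g)
    (h' : SphereHomotopic g k) : SphereHomotopic f k := by
  obtain ⟨F, G, hF, hG, hFG⟩ := h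
  obtain ⟨G', K, hG', hK, hGK⟩ := h'
  have : G = G' := by
    ext1 v
    exact Subtype.ext ((hG v).trans (hG' v).symm)
  exact ⟨F, K, hF, hK, hFG.trans (this ▸ hGK)⟩

theorem homotopic_of_family {A : Type*} [TopologicalSpace A] {F G : C(A, {v : E3 // v ≠ 0})}
    {K : unitInterval × A → E3} (hK : Continuous K) (h0 : ∀ x, K x ≠ 0)
    (hF : ∀ v, (F v : E3) = K (0, v)) (hG : ∀ v, (G v : E3) = K (1, v)) : F.Homotopic G :=
  ⟨{ toFun := fun x => ⟨K x, h0 x⟩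
     continuous_toFun := hK.subtype_mk _
     map_zero_left := fun v => Subtype.ext (hF v).symm
     map_one_left := fun v => Subtype.ext (hG v).symm }⟩

theorem SphereHomotopic.of_family {f g : sphere (0 : E3) 1 → E3}
    {K : unitInterval × sphere (0 : E3) 1 → E3} (hK : Continuous K) (h0 : ∀ x, K x ≠ 0)
    (hf : ∀ v, K (0, v) = f v) (hg : ∀ v, K (1, v) = g v) : SphereHomotopic f g := by
  refine ⟨⟨fun v => ⟨K (0, v), h0 _⟩, by fun_prop⟩, ⟨fun v => ⟨K (1, v), h0 _⟩, by fun_prop⟩,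
    hf, hg, homotopic_of_family hK h0 (fun _ => rfl) fun _ => rfl⟩

theorem SphereHomotopic.of_segment {f g : sphere (0 : E3) 1 → E3} (hf : Continuous f)
    (hg : Continuous g)
    (h : ∀ v, ∀ t ∈ Icc (0 : ℝ) 1, (1 - t) • f v + t • g v ≠ 0) : SphereHomotopic f g := by
  refine SphereHomotopic.of_family
    (K := fun x => (1 - (x.1 : ℝ)) • f x.2 + (x.1 : ℝ) • g x.2) (by fun_prop)
    (fun x => h x.2 x.1 x.1.2) (fun v => by simp) (fun v => by simp)

theorem sphere_norm (v : sphere (0 : E3) 1) : ‖(v : E3)‖ = 1 := by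
  simp

theorem add_smul_mem_closedBall (p : E3) {ρ : ℝ} (hρ : 0 ≤ ρ) (v : sphere (0 : E3) 1) :
    p + ρ • (v : E3) ∈ closedBall p ρ := by
  rw [mem_closedBall, dist_self_add_left, norm_smul, sphere_norm, mul_one, Real.norm_eq_abs,
    abs_of_nonneg hρ]

/-- Injectivity of `f` keeps the image of the centre off the image of the sphere while both move. -/
theorem sphereHomotopic_of_moving {f : E3 → E3} {U : Set E3} (hf : ContinuousOn f U)
    (hinj : InjOn f U) {P : unitInterval → E3} {R : unitInterval → ℝ} (hP : Continuous P)
    (hR : Continuous R) (hR0 : ∀ t, 0 < R t) (hU : ∀ t, closedBall (P t) (R t) ⊆ U) :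
    SphereHomotopic (fun v => f (P 0 + R 0 • (v : E3)) - f (P 0))
      (fun v => f (P 1 + R 1 • (v : E3)) - f (P 1)) := by
  have hmem : ∀ x : unitInterval × sphere (0 : E3) 1, P x.1 + R x.1 • (x.2 : E3) ∈ U :=
    fun x => hU x.1 (add_smul_mem_closedBall _ (hR0 _).le _)
  have hmem' : ∀ x : unitInterval × sphere (0 : E3) 1, P x.1 ∈ U :=
    fun x => hU x.1 (mem_closedBall_self (hR0 _).le)
  refine SphereHomotopic.of_family (K := fun x => f (P x.1 + R x.1 • (x.2 : E3)) - f (P x.1))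
    ((hf.comp_continuous (by fun_prop) hmem).sub (hf.comp_continuous (by fun_prop) hmem'))
    (fun x => ?_) (fun _ => rfl) (fun _ => rfl)
  rw [sub_ne_zero]
  intro h
  have h1 := hinj (hmem x) (hmem' x) h
  rw [add_eq_left, smul_eq_zero] at h1
  rcases h1 with h1 | h1
  · exact (hR0 _).ne' h1
  · have := sphere_norm x.2
    rw [h1, norm_zero] at this
    exact zero_ne_one this

/-- The local degree of an injective map is the same at all points of a connected interior. -/
theorem sphereHomotopic_of_mem_interior {f : E3 → E3} {U : Set E3} (hf : ContinuousOn f U)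
    (hinj : InjOn f U) (hconn : IsConnected (interior U)) {p q : E3} (hp : p ∈ interior U)
    (hq : q ∈ interior U) {ρ r : ℝ} (hρ : 0 < ρ) (hr : 0 < r) (hpρ : closedBall p ρ ⊆ U)
    (hqr : closedBall q r ⊆ U) :
    SphereHomotopic (fun v => f (p + ρ • (v : E3)) - f p)
      (fun v => f (q + r • (v : E3)) - f q) := by
  have radius : ∀ (p : E3) (ρ r : ℝ), 0 < ρ → 0 < r → closedBall p ρ ⊆ U → closedBall p r ⊆ U →
      SphereHomotopic (fun v => f (p + ρ • (v : E3)) - f p)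
        (fun v => f (p + r • (v : E3)) - f p) := by
    intro p ρ r hρ hr hpρ hpr
    have hpos : ∀ t : unitInterval, 0 < (1 - (t : ℝ)) * ρ + t * r := by
      intro t
      have h1 := t.2.1
      have h2 := t.2.2
      rcases h1.eq_or_lt with h | h
      · rw [← h]; linarith
      · nlinarith [mul_nonneg (sub_nonneg.2 h2) hρ.le, mul_pos h hr]
    have := sphereHomotopic_of_moving hf hinj (P := fun _ => p)
      (R := fun t : unitInterval => (1 - (t : ℝ)) * ρ + t * r) continuous_const (by fun_prop) hpos
      (fun t => by
        have h1 := t.2.1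
        have h2 := t.2.2
        rcases le_total ρ r with h | h
        · exact (closedBall_subset_closedBall (by nlinarith)).trans hpr
        · exact (closedBall_subset_closedBall (by nlinarith)).trans hpρ)
    simpa using this
  have hpath : IsPathConnected (interior U) := isOpen_interior.isConnected_iff_isPathConnected.1 hconn
  obtain ⟨γ, hγ⟩ := hpath.joinedIn p hp q hq
  -- By compactness one radius `δ` serves along the whole path. The given radii at the two ends are
  -- changed to `δ` by `radius`.
  obtain ⟨δ, hδ, hδU⟩ := (isCompact_range γ.continuous).exists_cthickening_subset_open
    isOpen_interior (by rintro _ ⟨t, rfl⟩; exact hγ t)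
  have hball : ∀ t, closedBall (γ t) δ ⊆ U := fun t =>
    (closedBall_subset_cthickening (mem_range_self t) δ).trans (hδU.trans interior_subset)
  have h1 := sphereHomotopic_of_moving hf hinj (P := γ) (R := fun _ => δ) γ.continuous
    continuous_const (fun _ => hδ) hball
  have b0 := hball 0
  have b1 := hball 1
  rw [γ.source] at b0
  rw [γ.target] at b1
  simp only [γ.source, γ.target] at h1
  exact ((radius p ρ δ hρ hδ hpρ b0).trans h1).trans (radius q δ r hδ hr b1 hqr)

theorem continuousOn_of_homeomorph {U V : Set E3} (h : U ≃ₜ V) {f : E3 → E3}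
    (hf : ∀ q : U, f q = h q) : ContinuousOn f U := by
  rw [continuousOn_iff_continuous_domRestrict]
  have : U.domRestrict f = fun q => (h q : E3) := funext fun q => hf q
  rw [this]
  fun_prop

theorem injOn_of_homeomorph {U V : Set E3} (h : U ≃ₜ V) {f : E3 → E3}
    (hf : ∀ q : U, f q = h q) : InjOn f U := by
  intro x hx y hy hxy
  have := (hf ⟨x, hx⟩).symm.trans (hxy.trans (hf ⟨y, hy⟩))
  exact congrArg Subtype.val (h.injective (Subtype.ext this))

/-- The points of `U` in a closed ball around `p`, other than `p`. -/
abbrev PuncturedBall {U : Set E3} (p : U) (ρ : ℝ) : Type :=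
  {q : U // (q : E3) ∈ closedBall (p : E3) ρ ∧ q ≠ p}

/-- Local degree `1`, expressed by maps of the sphere. -/
theorem orientationPreserving_of_sphere {U V : Set E3} (h : U ≃ₜ V) {f : E3 → E3}
    (hf : ∀ q : U, f q = h q)
    (hs : ∀ p ∈ interior U, ∃ ρ > 0, closedBall p ρ ⊆ U ∧
      SphereHomotopic (fun v => f (p + ρ • (v : E3)) - f p) (fun v => (v : E3))) :
    OrientationPreserving h := by
  intro p hp
  obtain ⟨ρ, hρ, hpρ, F, G, hF, hG, hFG⟩ := hs p hp
  refine ⟨ρ, hρ, hpρ, ?_⟩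
  have hfc := continuousOn_of_homeomorph h hf
  have hfi := injOn_of_homeomorph h hf
  have hn : ∀ q : PuncturedBall p ρ, 0 < ‖((q.1 : U) : E3) - p‖ := fun q =>
    norm_pos_iff.2 (sub_ne_zero.2 fun h => q.2.2 (Subtype.ext h))
  have hle : ∀ q : PuncturedBall p ρ, ‖((q.1 : U) : E3) - p‖ ≤ ρ := fun q => by
    rw [← dist_eq_norm]; exact q.2.1
  have hdc : Continuous fun q : PuncturedBall p ρ => (‖((q.1 : U) : E3) - p‖)⁻¹ • (((q.1 : U) : E3) - p) :=
    Continuous.smul (Continuous.inv₀ (by fun_prop) fun q => (hn q).ne') (by fun_prop)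
  have hdm : ∀ q : PuncturedBall p ρ,
      (‖((q.1 : U) : E3) - p‖)⁻¹ • (((q.1 : U) : E3) - p) ∈ sphere (0 : E3) 1 := fun q => by
    rw [mem_sphere_zero_iff_norm, norm_smul, norm_inv, norm_norm, inv_mul_cancel₀ (hn q).ne']
  set dir : C(PuncturedBall p ρ, sphere (0 : E3) 1) := ⟨fun q => ⟨_, hdm q⟩, hdc.subtype_mk hdm⟩
  have hdir' : ∀ q : PuncturedBall p ρ, ‖((q.1 : U) : E3) - p‖ • ((dir q : sphere (0 : E3) 1) : E3) =
      ((q.1 : U) : E3) - p := fun q => smul_inv_smul₀ (hn q).ne' _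
  set F₀ : C(PuncturedBall p ρ, {v : E3 // v ≠ 0}) := ⟨fun q => ⟨(h q.1 : E3) - h p, sub_ne_zero.2 fun e =>
    q.2.2 (h.injective (Subtype.ext e))⟩, by fun_prop⟩
  set F₃ : C(PuncturedBall p ρ, {v : E3 // v ≠ 0}) := ⟨fun q => ⟨((q.1 : U) : E3) - p,
    norm_pos_iff.1 (hn q)⟩, by fun_prop⟩
  -- The point `q` is pushed radially out to the sphere of radius `ρ`. There the given homotopy on
  -- the sphere acts (`k2`), and then the direction of `q - p` is scaled back to `q - p` (`k3`).
  have k1 : F₀.Homotopic (F.comp dir) := by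
    have hmem : ∀ x : unitInterval × PuncturedBall p ρ, (p : E3) +
        ((1 - (x.1 : ℝ)) * ‖((x.2.1 : U) : E3) - p‖ + x.1 * ρ) • (dir x.2 : E3) ∈ U := by
      intro x
      apply hpρ
      have h1 := x.1.2.1
      have h2 := x.1.2.2
      have h3 := hle x.2
      have h4 := (hn x.2).le
      refine closedBall_subset_closedBall ?_ (add_smul_mem_closedBall (p : E3) (ρ :=
        (1 - (x.1 : ℝ)) * ‖((x.2.1 : U) : E3) - p‖ + x.1 * ρ) ?_ (dir x.2))
      · nlinarith
      · have := mul_nonneg (sub_nonneg.2 h2) h4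
        have := mul_nonneg h1 hρ.le
        linarith
    refine homotopic_of_family (K := fun x : unitInterval × PuncturedBall p ρ => f ((p : E3) +
        ((1 - (x.1 : ℝ)) * ‖((x.2.1 : U) : E3) - p‖ + x.1 * ρ) • (dir x.2 : E3)) - f p)
      ((hfc.comp_continuous (by fun_prop) hmem).sub continuous_const) (fun x => ?_) (fun q => ?_)
      (fun q => ?_)
    · rw [sub_ne_zero]
      intro e
      have e1 := hfi (hmem x) p.2 e
      rw [add_eq_left, smul_eq_zero] at e1
      have h1 := x.1.2.1
      have h2 := x.1.2.2
      have h4 := hn x.2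
      rcases e1 with e1 | e1
      · rcases h1.eq_or_lt with h5 | h5
        · rw [← h5] at e1; linarith
        · have := mul_nonneg (sub_nonneg.2 h2) h4.le
          have := mul_pos h5 hρ
          linarith
      · have := sphere_norm (dir x.2)
        rw [e1, norm_zero] at this
        exact zero_ne_one this
    · simp only [Set.Icc.coe_zero, sub_zero, one_mul, zero_mul, add_zero]
      rw [hdir', add_sub_cancel, hf, hf]
      rfl
    · simp only [Set.Icc.coe_one, sub_self, one_mul, zero_mul, zero_add]
      exact hF _
  have k2 : (F.comp dir).Homotopic (G.comp dir) := hFG.comp (ContinuousMap.Homotopic.refl dir)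
  have k3 : (G.comp dir).Homotopic F₃ := by
    refine homotopic_of_family (K := fun x : unitInterval × PuncturedBall p ρ =>
      ((1 - (x.1 : ℝ)) + x.1 * ‖((x.2.1 : U) : E3) - p‖) • (dir x.2 : E3)) (by fun_prop)
      (fun x => ?_) (fun q => ?_) (fun q => ?_)
    · intro e
      have h1 := x.1.2.1
      have h2 := x.1.2.2
      have h4 := hn x.2
      rcases smul_eq_zero.1 e with e1 | e1
      · rcases h1.eq_or_lt with h5 | h5
        · rw [← h5] at e1; linarith
        · have := mul_pos h5 h4
          linarith
      · have := sphere_norm (dir x.2)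
        rw [e1, norm_zero] at this
        exact zero_ne_one this
    · simp only [Set.Icc.coe_zero, sub_zero, zero_mul, add_zero, one_smul]
      exact hG _
    · simp only [Set.Icc.coe_one, sub_self, one_mul, zero_add]
      exact (hdir' q).symm
  obtain ⟨K⟩ := (k1.trans k2).trans k3
  classical
  -- The homotopy lives on the punctured ball only; the value `0` elsewhere is never used.
  refine ⟨fun w => if hw : (w.2 : E3) ∈ closedBall (p : E3) ρ ∧ w.2 ≠ p then
    (K (w.1, ⟨w.2, hw⟩) : E3) else 0, ?_, ?_, ?_⟩
  · rw [continuousOn_iff_continuous_domRestrict]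
    have hKc : Continuous fun w : {w : unitInterval × U | (w.2 : E3) ∈ closedBall (p : E3) ρ ∧
        w.2 ≠ p} => ((K (w.1.1, ⟨w.1.2, w.2⟩) : {v : E3 // v ≠ 0}) : E3) :=
      continuous_subtype_val.comp (K.continuous.comp (by fun_prop))
    refine hKc.congr fun w => ?_
    simp only [domRestrict_apply]
    split_ifs with hw
    · rfl
    · exact absurd w.2 hw
  · intro t q hq hqp
    simp only [dif_pos (show (q : E3) ∈ closedBall (p : E3) ρ ∧ q ≠ p from ⟨hq, hqp⟩)]
    exact (K (t, ⟨q, hq, hqp⟩)).2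
  · intro q hq hqp
    simp only [dif_pos (show (q : E3) ∈ closedBall (p : E3) ρ ∧ q ≠ p from ⟨hq, hqp⟩)]
    rw [K.apply_zero, K.apply_one]
    exact ⟨rfl, rfl⟩

/-- The point of space with horizontal coordinate `y` whose other coordinates are `e * re z` and
`im z`. -/
def spatial (e : ℝ) (z : ℂ) (y : ℝ) : E3 := !₂[e * z.re, y, z.im]

theorem continuous_vec3 {A : Type*} [TopologicalSpace A] {x y z : A → ℝ} (hx : Continuous x)
    (hy : Continuous y) (hz : Continuous z) : Continuous fun t => (!₂[x t, y t, z t] : E3) := by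
  refine (PiLp.continuous_toLp 2 _).comp (continuous_pi fun i => ?_)
  fin_cases i
  · exact hx
  · exact hy
  · exact hz

theorem vec3_eq_zero {x y z : ℝ} (h : (!₂[x, y, z] : E3) = 0) : x = 0 ∧ y = 0 ∧ z = 0 :=
  ⟨congrFun (congrArg WithLp.ofLp h) 0, congrFun (congrArg WithLp.ofLp h) 1,
    congrFun (congrArg WithLp.ofLp h) 2⟩

theorem continuous_spatial {A : Type*} [TopologicalSpace A] (e : ℝ) {z : A → ℂ} {y : A → ℝ}
    (hz : Continuous z) (hy : Continuous y) : Continuous fun t => spatial e (z t) (y t) :=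
  continuous_vec3 (continuous_const.mul (Complex.continuous_re.comp hz)) hy
    (Complex.continuous_im.comp hz)

theorem spatial_eq_zero {e : ℝ} (he : e = 1 ∨ e = -1) {z : ℂ} {y : ℝ} (h : spatial e z y = 0) :
    z = 0 ∧ y = 0 := by
  obtain ⟨h1, h2, h3⟩ := vec3_eq_zero h
  refine ⟨Complex.ext ?_ h3, h2⟩
  rcases he with rfl | rfl
  · simpa using h1
  · simpa using h1

/-- The projection of a vector of space to the plane. -/
def planar (v : E3) : ℂ := ⟨v 0, v 1⟩

theorem continuous_planar : Continuous planar := by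
  have : planar = fun v : E3 => ((v 0 : ℝ) : ℂ) + ((v 1 : ℝ) : ℂ) * Complex.I := by
    funext v
    exact (Complex.mk_eq_add_mul_I _ _)
  rw [this]
  fun_prop

theorem sq_add_sq_of_sphere (v : sphere (0 : E3) 1) :
    (v : E3) 0 ^ 2 + (v : E3) 1 ^ 2 + (v : E3) 2 ^ 2 = 1 := by
  have h := sphere_norm v
  have h1 := EuclideanSpace.norm_sq_eq (v : E3)
  rw [h, Fin.sum_univ_three] at h1
  simp only [Real.norm_eq_abs, sq_abs] at h1
  linarith

theorem normSq_planar (v : E3) : ‖planar v‖ ^ 2 = v 0 ^ 2 + v 1 ^ 2 := by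
  rw [Complex.sq_norm, Complex.normSq_apply, planar]
  ring

theorem norm_planar_le (v : sphere (0 : E3) 1) : ‖planar v‖ ≤ 1 := by
  have h1 := normSq_planar v
  have h2 := sq_add_sq_of_sphere v
  nlinarith [sq_nonneg ((v : E3) 2), norm_nonneg (planar (v : E3))]

theorem norm_planar_eq (v : sphere (0 : E3) 1) (h : (v : E3) 2 = 0) : ‖planar v‖ = 1 := by
  have h1 := normSq_planar v
  have h2 := sq_add_sq_of_sphere v
  rw [h] at h2
  nlinarith [norm_nonneg (planar (v : E3))]

/-- The point over `w` of the horizontal disc around `p`. -/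
def diskPoint (p : E3) (ρ : ℝ) (w : ℂ) : E3 := p + ρ • (!₂[w.re, w.im, 0] : E3)

theorem continuous_diskPoint (p : E3) (ρ : ℝ) : Continuous (diskPoint p ρ) :=
  continuous_const.add ((continuous_vec3 Complex.continuous_re Complex.continuous_im
    continuous_const).const_smul ρ)

theorem diskPoint_zero (p : E3) (ρ : ℝ) : diskPoint p ρ 0 = p := by
  have : (!₂[(0 : ℂ).re, (0 : ℂ).im, 0] : E3) = 0 := by
    ext i
    fin_cases i <;> rfl
  rw [diskPoint, this, smul_zero, add_zero]

theorem diskPoint_mem_closedBall {p : E3} {ρ : ℝ} (hρ : 0 < ρ) {w : ℂ}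
    (hw : w ∈ closedBall (0 : ℂ) 1) : diskPoint p ρ w ∈ closedBall p ρ := by
  rw [mem_closedBall_zero_iff] at hw
  rw [diskPoint, mem_closedBall, dist_self_add_left, norm_smul, Real.norm_eq_abs, abs_of_pos hρ]
  have h1 : ‖(!₂[w.re, w.im, 0] : E3)‖ ≤ 1 := by
    rw [← sq_le_one_iff₀ (norm_nonneg _), EuclideanSpace.norm_sq_eq, Fin.sum_univ_three]
    simp only [Real.norm_eq_abs, sq_abs]
    change w.re ^ 2 + w.im ^ 2 + 0 ^ 2 ≤ 1
    have h2 := Complex.sq_norm w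
    rw [Complex.normSq_apply] at h2
    nlinarith [norm_nonneg w]
  nlinarith

theorem exists_diskPoint_eq {p q : E3} {ρ : ℝ} (hρ : 0 < ρ) (hq : q ∈ closedBall p ρ)
    (h : q 2 = p 2) : ∃ w ∈ closedBall (0 : ℂ) 1, diskPoint p ρ w = q := by
  refine ⟨⟨(q 0 - p 0) / ρ, (q 1 - p 1) / ρ⟩, ?_, ?_⟩
  · rw [mem_closedBall_zero_iff, ← sq_le_one_iff₀ (norm_nonneg _), Complex.sq_norm,
      Complex.normSq_apply]
    rw [mem_closedBall, dist_eq_norm] at hq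
    have h1 := EuclideanSpace.norm_sq_eq (q - p)
    rw [Fin.sum_univ_three] at h1
    simp only [Real.norm_eq_abs, sq_abs, PiLp.sub_apply, h, sub_self] at h1
    have h2 : (q 0 - p 0) ^ 2 + (q 1 - p 1) ^ 2 ≤ ρ ^ 2 := by
      nlinarith [norm_nonneg (q - p)]
    have h3 : (q 0 - p 0) / ρ * ((q 0 - p 0) / ρ) + (q 1 - p 1) / ρ * ((q 1 - p 1) / ρ) =
        ((q 0 - p 0) ^ 2 + (q 1 - p 1) ^ 2) / ρ ^ 2 := by
      field_simp
    simp only [h3]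
    exact (div_le_one (by positivity)).2 h2
  · ext i
    fin_cases i
    · simp [diskPoint, mul_div_cancel₀ _ hρ.ne']
    · simp [diskPoint, mul_div_cancel₀ _ hρ.ne']
    · simp [diskPoint, h]

/-- The map `(x, y, z) ↦ (x, -z, y)` is a quarter turn about the first axis, and it is undone by
rotating back. -/
theorem sphereHomotopic_rotation :
    SphereHomotopic (fun v => spatial 1 (planar v) (-(v : E3) 2)) (fun v => (v : E3)) := by
  refine SphereHomotopic.of_family (K := fun x => !₂[(x.2 : E3) 0,
    -(Real.cos (Real.pi / 2 * x.1) * (x.2 : E3) 2) + Real.sin (Real.pi / 2 * x.1) * (x.2 : E3) 1,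
    Real.cos (Real.pi / 2 * x.1) * (x.2 : E3) 1 + Real.sin (Real.pi / 2 * x.1) * (x.2 : E3) 2])
    (continuous_vec3 (by fun_prop) (by fun_prop) (by fun_prop)) (fun x h => ?_) (fun v => ?_)
    (fun v => ?_)
  · obtain ⟨h0, h1, h2⟩ := vec3_eq_zero h
    have h3 := sq_add_sq_of_sphere x.2
    have h4 := Real.sin_sq_add_cos_sq (Real.pi / 2 * x.1)
    have h5 : ((x.2 : E3) 1) ^ 2 + ((x.2 : E3) 2) ^ 2 = 0 := by
      linear_combination (-((x.2 : E3) 1) ^ 2 - ((x.2 : E3) 2) ^ 2) * h4 +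
        (-(Real.cos (Real.pi / 2 * x.1) * (x.2 : E3) 2) +
          Real.sin (Real.pi / 2 * x.1) * (x.2 : E3) 1) * h1 +
        (Real.cos (Real.pi / 2 * x.1) * (x.2 : E3) 1 +
          Real.sin (Real.pi / 2 * x.1) * (x.2 : E3) 2) * h2
    rw [h0] at h3
    linarith
  · simp [spatial, planar]
  · ext i
    fin_cases i <;> simp

/-- Conjugation reverses the third coordinate and `e = -1` the first; together they are a half turn
about the second axis. This is how the sign `e` compensates a winding number `-1`. -/
theorem sphereHomotopic_conj :
    SphereHomotopic (fun v => spatial (-1) ((starRingEnd ℂ) (planar v)) (-(v : E3) 2))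
      (fun v => spatial 1 (planar v) (-(v : E3) 2)) := by
  refine SphereHomotopic.of_family (K := fun x => !₂[
    -(Real.cos (Real.pi * x.1) * (x.2 : E3) 0) + Real.sin (Real.pi * x.1) * (x.2 : E3) 1,
    -(x.2 : E3) 2,
    -(Real.cos (Real.pi * x.1) * (x.2 : E3) 1) - Real.sin (Real.pi * x.1) * (x.2 : E3) 0])
    (continuous_vec3 (by fun_prop) (by fun_prop) (by fun_prop)) (fun x h => ?_) (fun v => ?_)
    (fun v => ?_)
  · obtain ⟨h0, h1, h2⟩ := vec3_eq_zero h
    have h3 := sq_add_sq_of_sphere x.2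
    have h4 := Real.sin_sq_add_cos_sq (Real.pi * x.1)
    have h5 : ((x.2 : E3) 0) ^ 2 + ((x.2 : E3) 1) ^ 2 = 0 := by
      linear_combination (-((x.2 : E3) 0) ^ 2 - ((x.2 : E3) 1) ^ 2) * h4 +
        (-(Real.cos (Real.pi * x.1) * (x.2 : E3) 0) +
          Real.sin (Real.pi * x.1) * (x.2 : E3) 1) * h0 +
        (-(Real.cos (Real.pi * x.1) * (x.2 : E3) 1) -
          Real.sin (Real.pi * x.1) * (x.2 : E3) 0) * h2
    have h6 : (x.2 : E3) 2 = 0 := by linarith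
    rw [h6] at h3
    linarith
  · simp [spatial, planar]
  · simp [spatial, planar]

/-- A pair of functions that is injective on a horizontal disc around `p` extends, together with the
vertical coordinate, to a map of local degree `±1`. -/
theorem exists_sign_sphereHomotopic {U S : E3 → ℝ} {p : E3} {ρ : ℝ} (hρ : 0 < ρ)
    (hU : ContinuousOn U (closedBall p ρ)) (hS : ContinuousOn S (closedBall p ρ))
    (hinj : InjOn (fun w => (⟨U (diskPoint p ρ w), S (diskPoint p ρ w)⟩ : ℂ)) (closedBall 0 1))
    (hn : (fun w => (⟨U (diskPoint p ρ w), S (diskPoint p ρ w)⟩ : ℂ)) '' closedBall 0 1 ∈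
      𝓝 (⟨U p, S p⟩ : ℂ)) :
    ∃ e : ℝ, (e = 1 ∨ e = -1) ∧ SphereHomotopic (fun v => spatial e
      ⟨U (p + ρ • (v : E3)) - U p, S (p + ρ • (v : E3)) - S p⟩ (-(v : E3) 2))
      (fun v => (v : E3)) := by
  set G : E3 → ℂ := fun q => ⟨U q, S q⟩ with hG
  have hGc : ContinuousOn G (closedBall p ρ) := by
    have : G = fun q => ((U q : ℝ) : ℂ) + ((S q : ℝ) : ℂ) * Complex.I := by
      funext v
      exact (Complex.mk_eq_add_mul_I _ _)
    rw [this]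
    exact (Complex.continuous_ofReal.comp_continuousOn hU).add
      ((Complex.continuous_ofReal.comp_continuousOn hS).mul continuousOn_const)
  -- The vertical push of the sphere to the horizontal disc stays inside the ball.
  have hball : ∀ (t : unitInterval) (v : sphere (0 : E3) 1),
      p + ρ • (!₂[(v : E3) 0, (v : E3) 1, (1 - (t : ℝ)) * (v : E3) 2] : E3) ∈ closedBall p ρ := by
    intro t v
    rw [mem_closedBall, dist_self_add_left, norm_smul, Real.norm_eq_abs, abs_of_pos hρ]
    have h1 : ‖(!₂[(v : E3) 0, (v : E3) 1, (1 - (t : ℝ)) * (v : E3) 2] : E3)‖ ≤ 1 := by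
      rw [← sq_le_one_iff₀ (norm_nonneg _), EuclideanSpace.norm_sq_eq, Fin.sum_univ_three]
      have h2 := sq_add_sq_of_sphere v
      have h3 : ((1 - (t : ℝ)) * (v : E3) 2) ^ 2 ≤ (v : E3) 2 ^ 2 := by
        rw [mul_pow]
        refine mul_le_of_le_one_left (sq_nonneg _) ?_
        have := t.2.1
        have := t.2.2
        nlinarith
      simp only [Real.norm_eq_abs, sq_abs]
      change (v : E3) 0 ^ 2 + (v : E3) 1 ^ 2 + ((1 - (t : ℝ)) * (v : E3) 2) ^ 2 ≤ 1
      linarith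
    nlinarith
  have hpush : Continuous fun x : unitInterval × sphere (0 : E3) 1 =>
      p + ρ • (!₂[(x.2 : E3) 0, (x.2 : E3) 1, (1 - (x.1 : ℝ)) * (x.2 : E3) 2] : E3) :=
    continuous_const.add ((continuous_vec3 (by fun_prop) (by fun_prop) (by fun_prop)).const_smul ρ)
  have hdisk : ∀ w ∈ closedBall (0 : ℂ) 1, diskPoint p ρ w ∈ closedBall p ρ :=
    fun w hw => diskPoint_mem_closedBall hρ hw
  set g : ℂ → ℂ := fun w => G (diskPoint p ρ w) with hg
  have hg0 : g 0 = G p := by rw [hg]; simp only [diskPoint_zero]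
  have hgc : ContinuousOn g (closedBall 0 1) :=
    hGc.comp (continuous_diskPoint p ρ).continuousOn hdisk
  obtain ⟨N, hNc, hN1, hN0, hN⟩ := exists_angular_homotopy hgc hinj (by rw [hg0]; exact hn)
  have hplane : ∀ v : sphere (0 : E3) 1, planar v ∈ closedBall (0 : ℂ) 1 := fun v =>
    mem_closedBall_zero_iff.2 (norm_planar_le v)
  have hne : ∀ v : sphere (0 : E3) 1, (v : E3) 2 = 0 → planar v ≠ 0 := by
    intro v hv h
    have := norm_planar_eq v hv
    rw [h, norm_zero] at this
    exact zero_ne_one this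
  have hgne : ∀ v : sphere (0 : E3) 1, planar v ≠ 0 → g (planar v) - G p ≠ 0 := by
    intro v hv h
    rw [← hg0, sub_eq_zero] at h
    exact hv (hinj (hplane v) (mem_closedBall_self zero_le_one) h)
  -- `N` is undefined over the poles, where `planar v = 0`, but has modulus `1` elsewhere, so the
  -- product extends continuously by `0`.
  have hQc : Continuous fun x : unitInterval × sphere (0 : E3) 1 =>
      (‖planar x.2‖ : ℂ) * N ((x.1 : ℝ), planar x.2) := by
    rw [continuous_iff_continuousAt]
    intro x
    have hpc : Continuous fun x : unitInterval × sphere (0 : E3) 1 => planar x.2 :=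
      continuous_planar.comp (by fun_prop)
    by_cases hx : planar x.2 = 0
    · have hb : ∀ y : unitInterval × sphere (0 : E3) 1,
          ‖(‖planar y.2‖ : ℂ) * N ((y.1 : ℝ), planar y.2)‖ ≤ ‖planar y.2‖ := by
        intro y
        by_cases hy : planar y.2 = 0
        · simp [hy]
        · rw [norm_mul, hN1 _ _ ⟨hplane y.2, hy⟩]
          simp
      rw [ContinuousAt, hx]
      simp only [norm_zero, Complex.ofReal_zero, zero_mul]
      refine squeeze_zero_norm hb ?_
      have := (hpc.norm).tendsto x
      rwa [hx, norm_zero] at this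
    · refine ContinuousAt.mul (by
        have := hpc.norm.continuousAt (x := x)
        exact Complex.continuous_ofReal.continuousAt.comp this) ?_
      have h1 : ContinuousOn (fun y : unitInterval × sphere (0 : E3) 1 =>
          N ((y.1 : ℝ), planar y.2)) {y | planar y.2 ≠ 0} := by
        refine hNc.comp (f := fun y : unitInterval × sphere (0 : E3) 1 => ((y.1 : ℝ), planar y.2))
          (Continuous.continuousOn (by fun_prop)) ?_
        intro y hy
        exact ⟨mem_univ _, hplane y.2, hy⟩
      exact h1.continuousAt ((isOpen_ne_fun hpc continuous_const).mem_nhds hx)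
  have hzc : Continuous fun x : unitInterval × sphere (0 : E3) 1 => -(x.2 : E3) 2 := by fun_prop
  have htc : Continuous fun x : unitInterval × sphere (0 : E3) 1 => (((x.1 : ℝ)) : ℂ) :=
    Complex.continuous_ofReal.comp (continuous_subtype_val.comp continuous_fst)
  have htc' : Continuous fun x : unitInterval × sphere (0 : E3) 1 => ((1 - (x.1 : ℝ) : ℝ) : ℂ) :=
    Complex.continuous_ofReal.comp
      (continuous_const.sub (continuous_subtype_val.comp continuous_fst))
  -- Throughout, one coordinate is `-(v 2)`, so a zero can occur only on the equator; there `planar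
  -- v` has modulus `1` and the planar part does not vanish. The three homotopies push to the disc,
  -- normalize the length, and turn by `N`.
  have step : ∀ e : ℝ, (e = 1 ∨ e = -1) → SphereHomotopic (fun v => spatial e
      (G (p + ρ • (v : E3)) - G p) (-(v : E3) 2)) (fun v => spatial e
      ((‖planar v‖ : ℂ) * N (1, planar v)) (-(v : E3) 2)) := by
    intro e he
    have k1 : SphereHomotopic (fun v => spatial e (G (p + ρ • (v : E3)) - G p) (-(v : E3) 2))
        (fun v => spatial e (g (planar v) - G p) (-(v : E3) 2)) := by
      refine SphereHomotopic.of_family (K := fun x => spatial e (G (p + ρ •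
        (!₂[(x.2 : E3) 0, (x.2 : E3) 1, (1 - (x.1 : ℝ)) * (x.2 : E3) 2] : E3)) - G p)
        (-(x.2 : E3) 2)) (continuous_spatial e ((hGc.comp_continuous hpush
          fun x => hball x.1 x.2).sub continuous_const) hzc) (fun x h => ?_)
        (fun v => ?_) (fun v => ?_)
      · obtain ⟨h1, h2⟩ := spatial_eq_zero he h
        have h3 : (x.2 : E3) 2 = 0 := by linarith
        rw [h3, mul_zero] at h1
        exact hgne x.2 (hne x.2 h3) h1
      · have : (!₂[(v : E3) 0, (v : E3) 1, (1 - ((0 : unitInterval) : ℝ)) * (v : E3) 2] : E3) =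
            v := by
          ext i
          fin_cases i <;> simp
        simp only [this]
      · have : (!₂[(v : E3) 0, (v : E3) 1, (1 - ((1 : unitInterval) : ℝ)) * (v : E3) 2] : E3) =
            !₂[(planar v).re, (planar v).im, 0] := by
          simp [planar]
        simp only [this]
        rfl
    have k2 : SphereHomotopic (fun v => spatial e (g (planar v) - G p) (-(v : E3) 2))
        (fun v => spatial e ((‖planar v‖ : ℂ) * N (0, planar v)) (-(v : E3) 2)) := by
      refine SphereHomotopic.of_family (K := fun x => spatial e
        (((1 - (x.1 : ℝ) : ℝ) : ℂ) * (g (planar x.2) - G p) +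
          ((x.1 : ℝ) : ℂ) * ((‖planar x.2‖ : ℂ) * N (0, planar x.2))) (-(x.2 : E3) 2))
        (continuous_spatial e ?_ hzc) (fun x h => ?_)
        (fun v => by simp) (fun v => by simp)
      · have e1 : Continuous fun x : unitInterval × sphere (0 : E3) 1 => g (planar x.2) :=
          hgc.comp_continuous (continuous_planar.comp (by fun_prop)) fun x => hplane x.2
        have e2 : Continuous fun x : unitInterval × sphere (0 : E3) 1 =>
            (‖planar x.2‖ : ℂ) * N (0, planar x.2) :=
          hQc.comp (f := fun x : unitInterval × sphere (0 : E3) 1 => ((0 : unitInterval), x.2))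
            (by fun_prop)
        exact (htc'.mul (e1.sub continuous_const)).add
          (htc.mul e2)
      · obtain ⟨h1, h2⟩ := spatial_eq_zero he h
        have h3 : (x.2 : E3) 2 = 0 := by linarith
        have h4 := hne x.2 h3
        have h5 := hgne x.2 h4
        have h6 : 0 < ‖g (planar x.2) - G p‖ := norm_pos_iff.2 h5
        rw [norm_planar_eq x.2 h3, hN0 _ ⟨hplane x.2, h4⟩, hg0] at h1
        have h7 : (((1 - (x.1 : ℝ)) + x.1 * (1 / ‖g (planar x.2) - G p‖) : ℝ) : ℂ) *
            (g (planar x.2) - G p) = 0 := by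
          rw [← h1]
          push_cast
          ring
        rcases mul_eq_zero.1 h7 with h8 | h8
        · have h9 : (1 - (x.1 : ℝ)) + x.1 * (1 / ‖g (planar x.2) - G p‖) = 0 :=
            Complex.ofReal_eq_zero.1 h8
          have t0 := x.1.2.1
          have t1 := x.1.2.2
          rcases t0.eq_or_lt with t | t
          · rw [← t] at h9; linarith
          · have : 0 < (x.1 : ℝ) * (1 / ‖g (planar x.2) - G p‖) := by positivity
            linarith
        · exact h5 h8
    have k3 : SphereHomotopic (fun v => spatial e ((‖planar v‖ : ℂ) * N (0, planar v)) (-(v : E3) 2))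
        (fun v => spatial e ((‖planar v‖ : ℂ) * N (1, planar v)) (-(v : E3) 2)) := by
      refine SphereHomotopic.of_family (K := fun x => spatial e
        ((‖planar x.2‖ : ℂ) * N ((x.1 : ℝ), planar x.2)) (-(x.2 : E3) 2))
        (continuous_spatial e hQc hzc) (fun x h => ?_) (fun v => by simp)
        (fun v => by simp)
      obtain ⟨h1, h2⟩ := spatial_eq_zero he h
      have h3 : (x.2 : E3) 2 = 0 := by linarith
      have h4 := congrArg norm h1
      rw [norm_mul, hN1 _ _ ⟨hplane x.2, hne x.2 h3⟩, norm_planar_eq x.2 h3] at h4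
      simp at h4
    exact (k1.trans k2).trans k3
  have cancel : ∀ w z : ℂ, (w = 0 → z = 0) → (‖w‖ : ℂ) * (z / ‖w‖) = z := by
    intro w z h
    by_cases hw : w = 0
    · simp [h hw]
    · exact mul_div_cancel₀ z (by simpa using hw)
  rcases hN with hN | hN
  · refine ⟨1, Or.inl rfl, (step 1 (Or.inl rfl)).trans ?_⟩
    have : (fun v : sphere (0 : E3) 1 => spatial 1 ((‖planar v‖ : ℂ) * N (1, planar v))
        (-(v : E3) 2)) = fun v : sphere (0 : E3) 1 =>
        spatial 1 (planar v) (-(v : E3) 2) := by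
      funext v
      congr 1
      by_cases h : planar v = 0
      · simp [h]
      · rw [hN _ ⟨hplane v, h⟩, cancel _ _ id]
    rw [this]
    exact sphereHomotopic_rotation
  · refine ⟨-1, Or.inr rfl, (step (-1) (Or.inr rfl)).trans ?_⟩
    have : (fun v : sphere (0 : E3) 1 => spatial (-1) ((‖planar v‖ : ℂ) * N (1, planar v))
        (-(v : E3) 2)) = fun v : sphere (0 : E3) 1 =>
        spatial (-1) ((starRingEnd ℂ) (planar v)) (-(v : E3) 2) := by
      funext v
      congr 1
      by_cases h : planar v = 0
      · simp [h]
      · rw [hN _ ⟨hplane v, h⟩, cancel _ _ fun h => by simp [h]]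
    rw [this]
    exact sphereHomotopic_conj.trans sphereHomotopic_rotation

/-- Near `p`, a map into the normal region with coordinates `U` and `S` for which the remaining
coordinate decreases with the height has the same local degree as the coordinates. -/
theorem sphereHomotopic_spatial {f : E3 → E3} {U S : E3 → ℝ} {p : E3} {ρ κ c e : ℝ} (hρ : 0 < ρ)
    (hκ : 0 < κ) (hc : 0 < c) (he : e = 1 ∨ e = -1) (hf : ContinuousOn f (closedBall p ρ))
    (hU : ContinuousOn U (closedBall p ρ)) (hS : ContinuousOn S (closedBall p ρ))
    (hinj : InjOn f (closedBall p ρ))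
    (hfU : ∀ q ∈ closedBall p ρ, f q 0 - f p 0 = κ * (e * (U q - U p)))
    (hfS : ∀ q ∈ closedBall p ρ,
      c * (S q - S p) = f q 2 - f p 2 + (f q 1 ^ 2 - f p 1 ^ 2))
    (hmono : ∀ q ∈ closedBall p ρ, q ≠ p → U q = U p → S q = S p →
      (f q 1 - f p 1) * (q 2 - p 2) < 0) :
    SphereHomotopic (fun v => f (p + ρ • (v : E3)) - f p) (fun v => spatial e
      ⟨U (p + ρ • (v : E3)) - U p, S (p + ρ • (v : E3)) - S p⟩ (-(v : E3) 2)) := by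
  have hmem := add_smul_mem_closedBall p hρ.le
  have hvc : Continuous fun v : sphere (0 : E3) 1 => p + ρ • (v : E3) := by fun_prop
  have hfc : Continuous fun v : sphere (0 : E3) 1 => f (p + ρ • (v : E3)) :=
    hf.comp_continuous hvc hmem
  have hUc : Continuous fun v : sphere (0 : E3) 1 => U (p + ρ • (v : E3)) :=
    hU.comp_continuous hvc hmem
  have hSc : Continuous fun v : sphere (0 : E3) 1 => S (p + ρ • (v : E3)) :=
    hS.comp_continuous hvc hmem
  have hne : ∀ v : sphere (0 : E3) 1, p + ρ • (v : E3) ≠ p := by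
    intro v h
    rw [add_eq_left, smul_eq_zero] at h
    rcases h with h | h
    · exact hρ.ne' h
    · have := sphere_norm v
      rw [h, norm_zero] at this
      exact zero_ne_one this
  have hcoord : ∀ i, Continuous fun q : E3 => q i := fun i => by fun_prop
  have hmid : Continuous fun v : sphere (0 : E3) 1 => (!₂[f (p + ρ • (v : E3)) 0 - f p 0,
      f (p + ρ • (v : E3)) 1 - f p 1, c * (S (p + ρ • (v : E3)) - S p)] : E3) :=
    continuous_vec3 (((hcoord 0).comp hfc).sub continuous_const)
      (((hcoord 1).comp hfc).sub continuous_const)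
      (continuous_const.mul (hSc.sub continuous_const))
  have hend : Continuous fun v : sphere (0 : E3) 1 => spatial e
      ⟨U (p + ρ • (v : E3)) - U p, S (p + ρ • (v : E3)) - S p⟩ (-(v : E3) 2) :=
    continuous_vec3 (continuous_const.mul (hUc.sub continuous_const))
      ((hcoord 2).comp continuous_subtype_val).neg (hSc.sub continuous_const)
  -- The first segment replaces the difference of `f · 2` by `c` times that of `S`. By `hfS` the two
  -- agree when `f · 1` has not changed, so a zero would contradict injectivity. The second segment
  -- replaces the other two coordinates.
  refine (SphereHomotopic.of_segment (g := fun v => (!₂[f (p + ρ • (v : E3)) 0 - f p 0,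
      f (p + ρ • (v : E3)) 1 - f p 1, c * (S (p + ρ • (v : E3)) - S p)] : E3))
    (hfc.sub continuous_const) hmid ?_).trans (SphereHomotopic.of_segment hmid hend ?_)
  · intro v t ht h
    set q := p + ρ • (v : E3) with hq
    have h0 : (1 - t) * (f q 0 - f p 0) + t * (f q 0 - f p 0) = 0 :=
      congrFun (congrArg WithLp.ofLp h) 0
    have h1 : (1 - t) * (f q 1 - f p 1) + t * (f q 1 - f p 1) = 0 :=
      congrFun (congrArg WithLp.ofLp h) 1
    have h2 : (1 - t) * (f q 2 - f p 2) + t * (c * (S q - S p)) = 0 :=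
      congrFun (congrArg WithLp.ofLp h) 2
    have e0 : f q 0 = f p 0 := by linarith
    have e1 : f q 1 = f p 1 := by linarith
    rw [hfS q (hmem v), e1] at h2
    have e2 : f q 2 = f p 2 := by linarith
    refine hne v (hinj (hmem v) (mem_closedBall_self hρ.le) ?_)
    ext i
    fin_cases i
    · exact e0
    · exact e1
    · exact e2
  · intro v t ht h
    set q := p + ρ • (v : E3) with hq
    have h0 : (1 - t) * (f q 0 - f p 0) + t * (e * (U q - U p)) = 0 :=
      congrFun (congrArg WithLp.ofLp h) 0
    have h1 : (1 - t) * (f q 1 - f p 1) + t * -(v : E3) 2 = 0 :=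
      congrFun (congrArg WithLp.ofLp h) 1
    have h2 : (1 - t) * (c * (S q - S p)) + t * (S q - S p) = 0 :=
      congrFun (congrArg WithLp.ofLp h) 2
    have pos : ∀ k : ℝ, 0 < k → 0 < (1 - t) * k + t := by
      intro k hk
      have t0 := ht.1
      have t1 := ht.2
      rcases t0.eq_or_lt with t | t
      · rw [← t]; linarith
      · nlinarith [mul_nonneg (sub_nonneg.2 t1) hk.le]
    rw [hfU q (hmem v)] at h0
    have e0 : ((1 - t) * κ + t) * (e * (U q - U p)) = 0 := by linarith
    have e2 : ((1 - t) * c + t) * (S q - S p) = 0 := by linarith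
    have e0' : U q = U p := by
      have h3 := (mul_eq_zero.1 e0).resolve_left (pos κ hκ).ne'
      rcases he with rfl | rfl <;> linarith
    have e2' : S q = S p := by
      have := (mul_eq_zero.1 e2).resolve_left (pos c hc).ne'
      linarith
    -- With equal `U` and `S` the middle coordinates of both ends of the segment have the sign
    -- opposite to `v 2`, so they cannot cancel.
    have h3 := hmono q (hmem v) (hne v) e0' e2'
    have h4 : q 2 - p 2 = ρ * (v : E3) 2 := by
      rw [hq]
      simp
    rw [h4] at h3
    have h5 : (f q 1 - f p 1) * (v : E3) 2 < 0 := by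
      by_contra hcon
      push Not at hcon
      nlinarith
    have h6 : (1 - t) * ((f q 1 - f p 1) * (v : E3) 2) = t * (v : E3) 2 ^ 2 := by
      linear_combination (v : E3) 2 * h1
    have h7 : (v : E3) 2 ^ 2 ≠ 0 := by
      intro h8
      rw [pow_eq_zero_iff two_ne_zero] at h8
      rw [h8, mul_zero] at h5
      exact lt_irrefl _ h5
    have h8 : 0 < (v : E3) 2 ^ 2 := lt_of_le_of_ne (sq_nonneg _) h7.symm
    rcases ht.1.eq_or_lt with t | t
    · rw [← t] at h6; linarith
    · nlinarith [mul_pos t h8, mul_nonneg (sub_nonneg.2 ht.2) (neg_nonneg.2 h5.le)]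

/-! ### A flow box in the interior and the choice of the orientation -/

section

variable {Z : PiecewiseField} {M : Set E3} {φ : ℝ → ℝ → ℝ → E3} {A B : ℝ → ℝ → ℝ} {a b c e : ℝ}

/-- The coordinates of the preimage of a point in the upper half of `M`. -/
theorem coords_of_cylinderMap_eq (H : Cylinders Z M φ) (Me : Meridians Z M φ A B) (hab : a < b)
    (hc : 0 < c) (he : e = 1 ∨ e = -1) {P : E3} (hP : P ∈ normalRegion a b c) {θ u s : ℝ}
    (hu : u ∈ Icc (0 : ℝ) 1) (hs : s ∈ Ioc (0 : ℝ) 1) (hθ : θ ∈ Ioo (A u s) (B u s))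
    (h : φ θ u s = cylinderMap φ A B a b c e P) :
    0 < P 2 ∧ axisCoord a b e P = u ∧ radiusCoord c P = s ∧
      branchAngle 1 (A u s) (B u s) (arcCoord P) = θ := by
  have hz := Me.pos u hu s hs θ hθ
  have hPz : 0 < P 2 := by
    rcases lt_trichotomy (P 2) 0 with h1 | h1 | h1
    · have := cylinderMap_height_neg H Me hab hc he hP h1
      rw [← h] at this
      linarith
    · have := cylinderMap_height_zero H Me hab hc he hP h1
      rw [← h] at this
      linarith
    · exact h1
  have h' := h
  rw [cylinderMap_of_nonneg hPz.le] at h'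
  obtain ⟨e1, e2, e3⟩ := H.inj _ _ _ hu _ (axisCoord_mem hab he hP) _ ⟨hs.1.le, hs.2⟩ _
    (radiusCoord_mem hc hP) h'
  obtain ⟨n, hn⟩ := e3.resolve_left hs.1.ne'
  rw [← e1, ← e2] at hn
  have hs0 : radiusCoord c P ≠ 0 := by rw [← e2]; exact hs.1.ne'
  have hmem := branchAngle_mem_Icc (ε := 1) (Or.inl rfl) (Me.lt u hu s hs).le
    (abs_arcCoord_le hs0)
  have hn0 : n = 0 := int_eq_zero_of_mem_Icc ⟨hθ.1.le, hθ.2.le⟩ (hn ▸ hmem) (Me.lt' u hu s hs)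
  rw [hn0, Int.cast_zero, zero_mul, add_zero] at hn
  exact ⟨hPz, e1.symm, e2.symm, hn⟩

/-- A box of angles and cylinders on which the height increases along the orbits. -/
theorem exists_increasing_box (H : Cylinders Z M φ) (Me : Meridians Z M φ A B) :
    ∃ θ₁ : ℝ, ∃ δ > 0, ∀ θ u s, |θ - θ₁| < δ → |u - 1 / 2| < δ → |s - 1 / 2| < δ →
      u ∈ Icc (0 : ℝ) 1 ∧ s ∈ Ioc (0 : ℝ) 1 ∧ θ ∈ Ioo (A u s) (B u s) ∧
        0 < Z.X (φ θ u s) 2 := by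
  have hu : (1 / 2 : ℝ) ∈ Icc (0 : ℝ) 1 := by norm_num
  have hs : (1 / 2 : ℝ) ∈ Ioc (0 : ℝ) 1 := by norm_num
  set A₀ := A (1 / 2) (1 / 2) with hA₀
  set B₀ := B (1 / 2) (1 / 2) with hB₀
  have hX : ∀ᶠ x in 𝓝 ((A₀, 1 / 2, 1 / 2) : ℝ × ℝ × ℝ), 0 < Z.X (φ x.1 x.2.1 x.2.2) 2 := by
    have h0 : φ A₀ (1 / 2) (1 / 2) ∈ M ∩ side 1 := by
      refine ⟨H.mem _ _ _, ?_⟩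
      change 0 ≤ 1 * φ A₀ (1 / 2) (1 / 2) 2
      rw [Me.zeroA _ hu _ hs, mul_zero]
    have h2 : Continuous fun q : E3 => q 2 := by fun_prop
    have h1 : ContinuousAt (fun x : ℝ × ℝ × ℝ => Z.X (φ x.1 x.2.1 x.2.2) 2)
        (A₀, 1 / 2, 1 / 2) :=
      h2.continuousAt.comp (ContinuousAt.comp (f := fun x : ℝ × ℝ × ℝ => φ x.1 x.2.1 x.2.2)
        (g := Z.X) (H.regX.continuousAt h0) H.cont.continuousAt)
    exact h1.eventually_const_lt (Me.upA _ hu _ hs)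
  obtain ⟨ε, hε, hball⟩ := Metric.eventually_nhds_iff.1 (eventually_eventually_nhds.2 hX)
  have hlt := Me.lt _ hu _ hs
  rw [← hA₀, ← hB₀] at hlt
  -- Slightly after the upward crossing `A₀` the arc is already strictly above Σ, and `X.f` is still
  -- positive.
  set θ₁ := A₀ + min (ε / 2) ((B₀ - A₀) / 2) with hθ₁
  have hm0 : 0 < min (ε / 2) ((B₀ - A₀) / 2) := lt_min (by linarith) (by linarith)
  have hm1 : min (ε / 2) ((B₀ - A₀) / 2) ≤ ε / 2 := min_le_left _ _
  have hm2 : min (ε / 2) ((B₀ - A₀) / 2) ≤ (B₀ - A₀) / 2 := min_le_right _ _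
  have hX1 : ∀ᶠ x in 𝓝 ((θ₁, 1 / 2, 1 / 2) : ℝ × ℝ × ℝ), 0 < Z.X (φ x.1 x.2.1 x.2.2) 2 := by
    apply hball
    rw [Prod.dist_eq, dist_self, Real.dist_eq, hθ₁, add_sub_cancel_left, abs_of_pos hm0]
    exact max_lt (by linarith) hε
  have hdom : Icc (0 : ℝ) 1 ×ˢ Ioc (0 : ℝ) 1 ∈ 𝓝 ((1 / 2, 1 / 2) : ℝ × ℝ) :=
    prod_mem_nhds (Icc_mem_nhds (by norm_num) (by norm_num))
      (Ioc_mem_nhds (by norm_num) (by norm_num))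
  have hsnd : ContinuousAt (fun x : ℝ × ℝ × ℝ => x.2) (θ₁, 1 / 2, 1 / 2) :=
    continuous_snd.continuousAt
  have hAc : ContinuousAt (fun x : ℝ × ℝ × ℝ => A x.2.1 x.2.2) (θ₁, 1 / 2, 1 / 2) :=
    ContinuousAt.comp (f := fun x : ℝ × ℝ × ℝ => x.2) (g := fun p : ℝ × ℝ => A p.1 p.2)
      (Me.contA.continuousAt hdom) hsnd
  have hBc : ContinuousAt (fun x : ℝ × ℝ × ℝ => B x.2.1 x.2.2) (θ₁, 1 / 2, 1 / 2) :=
    ContinuousAt.comp (f := fun x : ℝ × ℝ × ℝ => x.2) (g := fun p : ℝ × ℝ => B p.1 p.2)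
      (Me.contB.continuousAt hdom) hsnd
  have hfst : ContinuousAt (fun x : ℝ × ℝ × ℝ => x.1) (θ₁, 1 / 2, 1 / 2) :=
    continuous_fst.continuousAt
  have hA1 := hAc.eventually_lt hfst (show A₀ < θ₁ by linarith)
  have hB1 := hfst.eventually_lt hBc (show θ₁ < B₀ by linarith)
  have hd1 := hsnd.eventually hdom
  obtain ⟨δ, hδ, hbox⟩ := Metric.eventually_nhds_iff.1 (((hX1.and hA1).and hB1).and hd1)
  refine ⟨θ₁, δ, hδ, fun θ u s h1 h2 h3 => ?_⟩
  obtain ⟨⟨⟨k1, k2⟩, k3⟩, k4⟩ := hbox (y := (θ, u, s)) (by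
    rw [Prod.dist_eq, Prod.dist_eq]
    exact max_lt h1 (max_lt h2 h3))
  exact ⟨k4.1, k4.2, ⟨k2, k3⟩, k1⟩

/-- Coordinates `U`, `S`, `Θ` on a ball in which the height increases along the orbits. -/
structure FlowBox (φ : ℝ → ℝ → ℝ → E3) (A B : ℝ → ℝ → ℝ) (U S Θ : E3 → ℝ) (p : E3) (ρ : ℝ) :
    Prop where
  contU : ContinuousOn U (closedBall p ρ)
  contS : ContinuousOn S (closedBall p ρ)
  memU : ∀ q ∈ closedBall p ρ, U q ∈ Icc (0 : ℝ) 1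
  memS : ∀ q ∈ closedBall p ρ, S q ∈ Ioc (0 : ℝ) 1
  memΘ : ∀ q ∈ closedBall p ρ, Θ q ∈ Ioo (A (U q) (S q)) (B (U q) (S q))
  eq : ∀ q ∈ closedBall p ρ, φ (Θ q) (U q) (S q) = q
  height_lt : ∀ q ∈ closedBall p ρ, ∀ q' ∈ closedBall p ρ, U q = U q' → S q = S q' →
    Θ q < Θ q' → q 2 < q' 2
  nhds : ∀ᶠ x in 𝓝 ((U p, S p) : ℝ × ℝ), ∃ q ∈ closedBall p ρ, q 2 = p 2 ∧ U q = x.1 ∧ S q = x.2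

/-- A homeomorphism onto the normal region, as a map of space. -/
theorem exists_extension (H : Cylinders Z M φ) (Me : Meridians Z M φ A B) (hab : a < b)
    (hc : 0 < c) (he : e = 1 ∨ e = -1) : ∃ (h : M ≃ₜ normalRegion a b c) (f : E3 → E3),
      (∀ q : M, f q = h q) ∧ ∀ q ∈ M, f q ∈ normalRegion a b c ∧
        q = cylinderMap φ A B a b c e (f q) := by
  classical
  obtain ⟨h, hh⟩ := exists_homeomorph H Me hab hc he
  set f : E3 → E3 := fun q => if hq : q ∈ M then (h ⟨q, hq⟩ : E3) else 0
  have hf : ∀ q : M, f q = h q := fun q => dif_pos q.2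
  refine ⟨h, f, hf, fun q hq => ?_⟩
  rw [hf ⟨q, hq⟩]
  exact ⟨(h ⟨q, hq⟩).2, hh ⟨q, hq⟩⟩

/-- The coordinates are read off from the homeomorphism onto an auxiliary normal region with `a =
0`, `b = c = 1`. They do not depend on the final region or on the sign `e`. -/
theorem exists_flowBox (H : Cylinders Z M φ) (Me : Meridians Z M φ A B)
    (hM : closure (interior M) = M) : ∃ U S Θ p ρ, 0 < ρ ∧ closedBall p ρ ⊆ interior M ∧
      FlowBox φ A B U S Θ p ρ := by
  obtain ⟨θ₁, δ, hδ, hbox⟩ := exists_increasing_box H Me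
  obtain ⟨h, f, hf, hfM⟩ := exists_extension H Me zero_lt_one zero_lt_one (e := 1) (Or.inl rfl)
  have hfc := continuousOn_of_homeomorph h hf
  set U : E3 → ℝ := fun q => axisCoord 0 1 1 (f q) with hU
  set S : E3 → ℝ := fun q => radiusCoord 1 (f q) with hS
  set Θ : E3 → ℝ := fun q => branchAngle 1 (A (U q) (S q)) (B (U q) (S q)) (arcCoord (f q)) with hΘ
  have hUc : ContinuousOn U M := (continuous_axisCoord 0 1 1).comp_continuousOn hfc
  have hSc : ContinuousOn S M := (continuous_radiusCoord 1).comp_continuousOn hfc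
  have coords : ∀ θ u s, |θ - θ₁| < δ → |u - 1 / 2| < δ → |s - 1 / 2| < δ →
      0 < f (φ θ u s) 2 ∧ U (φ θ u s) = u ∧ S (φ θ u s) = s ∧ Θ (φ θ u s) = θ := by
    intro θ u s h1 h2 h3
    obtain ⟨k1, k2, k3, -⟩ := hbox θ u s h1 h2 h3
    obtain ⟨m1, m2⟩ := hfM (φ θ u s) (H.mem _ _ _)
    obtain ⟨e0, e1, e2, e3⟩ := coords_of_cylinderMap_eq H Me zero_lt_one zero_lt_one (Or.inl rfl)
      m1 k1 k2 k3 m2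
    refine ⟨e0, e1, e2, ?_⟩
    rw [hΘ]
    simp only
    rw [show U (φ θ u s) = u from e1, show S (φ θ u s) = s from e2]
    exact e3
  set p₁ := φ θ₁ (1 / 2) (1 / 2) with hp₁
  have hp₁M : p₁ ∈ M := H.mem _ _ _
  obtain ⟨c0, c1, c2, c3⟩ := coords θ₁ (1 / 2) (1 / 2) (by simpa using hδ) (by simpa using hδ)
    (by simpa using hδ)
  rw [← hp₁] at c0 c1 c2 c3
  have hdom : Icc (0 : ℝ) 1 ×ˢ Ioc (0 : ℝ) 1 ∈ 𝓝 ((U p₁, S p₁) : ℝ × ℝ) := by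
    rw [c1, c2]
    exact prod_mem_nhds (Icc_mem_nhds (by norm_num) (by norm_num))
      (Ioc_mem_nhds (by norm_num) (by norm_num))
  have hUS : ContinuousWithinAt (fun q => (U q, S q)) M p₁ := (hUc p₁ hp₁M).prodMk (hSc p₁ hp₁M)
  have hAc : ContinuousWithinAt (fun q => A (U q) (S q)) M p₁ :=
    ContinuousAt.comp_continuousWithinAt (f := fun q => (U q, S q))
      (g := fun p : ℝ × ℝ => A p.1 p.2) (Me.contA.continuousAt hdom) hUS
  have hBc : ContinuousWithinAt (fun q => B (U q) (S q)) M p₁ :=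
    ContinuousAt.comp_continuousWithinAt (f := fun q => (U q, S q))
      (g := fun p : ℝ × ℝ => B p.1 p.2) (Me.contB.continuousAt hdom) hUS
  have hrc : ContinuousWithinAt (fun q => arcCoord (f q)) M p₁ :=
    ContinuousAt.comp_continuousWithinAt (f := f) (g := arcCoord)
      (continuousAt_arcCoord (c := 1) (show S p₁ ≠ 0 by rw [c2]; norm_num)) (hfc p₁ hp₁M)
  have hΘc : ContinuousWithinAt Θ M p₁ :=
    hAc.add ((hBc.sub hAc).mul ((continuousWithinAt_const.sub
      (continuousWithinAt_const.mul hrc)).div_const 2))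
  have hfz : ContinuousWithinAt (fun q => f q 2) M p₁ :=
    (show Continuous fun q : E3 => q 2 by fun_prop).continuousAt.comp_continuousWithinAt
      (hfc p₁ hp₁M)
  have near : ∀ (F : E3 → ℝ) (x : ℝ), ContinuousWithinAt F M p₁ → F p₁ = x →
      ∀ᶠ q in 𝓝[M] p₁, |F q - x| < δ := by
    intro F x hF hx
    have := Metric.tendsto_nhds.1 hF δ hδ
    rwa [hx] at this
  have hev := (((near U _ (hUc p₁ hp₁M) c1).and (near S _ (hSc p₁ hp₁M) c2)).and
    (near Θ _ hΘc c3)).and (hfz.eventually_const_lt c0)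
  obtain ⟨r, hr, hball⟩ := Metric.mem_nhdsWithin_iff.1 hev
  -- The point `p₁` is not known to be interior to `M`, but interior points come arbitrarily close
  -- to it.
  obtain ⟨p, hp, hpr⟩ := Metric.mem_closure_iff.1 (hM.symm ▸ hp₁M) r hr
  obtain ⟨ρ, hρ, hρM⟩ := Metric.nhds_basis_closedBall.mem_iff.1
    ((isOpen_interior.inter (isOpen_ball (x := p₁) (ε := r))).mem_nhds
      ⟨hp, by rw [mem_ball, dist_comm]; exact hpr⟩)
  have hin : ∀ q ∈ closedBall p ρ, |Θ q - θ₁| < δ ∧ |U q - 1 / 2| < δ ∧ |S q - 1 / 2| < δ ∧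
      0 < f q 2 := by
    intro q hq
    obtain ⟨⟨⟨k1, k2⟩, k3⟩, k4⟩ := hball ⟨(hρM hq).2, interior_subset (hρM hq).1⟩
    exact ⟨k3, k1, k2, k4⟩
  have hsub : closedBall p ρ ⊆ M := fun q hq => interior_subset (hρM hq).1
  have heq : ∀ q ∈ closedBall p ρ, φ (Θ q) (U q) (S q) = q := by
    intro q hq
    have h1 := (hfM q (hsub hq)).2
    rw [cylinderMap_of_nonneg (hin q hq).2.2.2.le] at h1
    exact h1.symm
  have hlt : ∀ u s θ θ', |u - 1 / 2| < δ → |s - 1 / 2| < δ → |θ - θ₁| < δ → |θ' - θ₁| < δ →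
      θ < θ' → φ θ u s 2 < φ θ' u s 2 := by
    intro u s θ θ' hu hs hθ hθ' hlt
    obtain ⟨k1, k2, k3, -⟩ := hbox θ u s hθ hu hs
    obtain ⟨-, -, k4, -⟩ := hbox θ' u s hθ' hu hs
    refine (Me.upper u k1 s k2).height_lt θ ⟨k3.1.le, k3.2.le⟩ θ' ⟨k4.1.le, k4.2.le⟩ hlt
      fun x hx => (hbox x u s ?_ hu hs).2.2.2
    rw [abs_lt] at hθ hθ' ⊢
    exact ⟨by linarith [hx.1], by linarith [hx.2]⟩
  have hpp : p ∈ closedBall p ρ := mem_closedBall_self hρ.le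
  refine ⟨U, S, Θ, p, ρ, hρ, fun q hq => (hρM hq).1, hUc.mono hsub, hSc.mono hsub, ?_, ?_, ?_, heq,
    ?_, ?_⟩
  · intro q hq
    obtain ⟨k1, k2, k3, -⟩ := hin q hq
    exact (hbox _ _ _ k1 k2 k3).1
  · intro q hq
    obtain ⟨k1, k2, k3, -⟩ := hin q hq
    exact (hbox _ _ _ k1 k2 k3).2.1
  · intro q hq
    obtain ⟨k1, k2, k3, -⟩ := hin q hq
    exact (hbox _ _ _ k1 k2 k3).2.2.1
  · intro q hq q' hq' hu hs hθ
    obtain ⟨k1, k2, k3, -⟩ := hin q hq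
    obtain ⟨k1', -⟩ := hin q' hq'
    have := hlt _ _ _ _ k2 k3 k1 k1' hθ
    rwa [heq q hq, hu, hs, heq q' hq'] at this
  · obtain ⟨k1, k2, k3, -⟩ := hin p hpp
    have hpe := heq p hpp
    have hθc : Continuous fun θ => φ θ (U p) (S p) :=
      H.cont.comp (f := fun θ : ℝ => (θ, U p, S p)) (by fun_prop)
    have hev1 : ∀ᶠ θ in 𝓝 (Θ p), φ θ (U p) (S p) ∈ ball p ρ ∧ |θ - θ₁| < δ := by
      refine Filter.Eventually.and ?_ ?_
      · refine hθc.continuousAt.eventually_mem ?_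
        rw [hpe]
        exact ball_mem_nhds p hρ
      · exact (show Continuous fun θ : ℝ => |θ - θ₁| by fun_prop).continuousAt.eventually_lt_const k1
    obtain ⟨η, hη, hηb⟩ := Metric.nhds_basis_closedBall.mem_iff.1 hev1
    have hηI : ∀ θ ∈ Icc (Θ p - η) (Θ p + η), φ θ (U p) (S p) ∈ ball p ρ ∧ |θ - θ₁| < δ := by
      intro θ hθ
      exact hηb (by rwa [Real.closedBall_eq_Icc])
    have hl : Θ p - η ∈ Icc (Θ p - η) (Θ p + η) := ⟨le_rfl, by linarith⟩
    have hr : Θ p + η ∈ Icc (Θ p - η) (Θ p + η) := ⟨by linarith, le_rfl⟩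
    -- Along the orbit of `p` the height at `Θ p - η` is below `p 2` and at `Θ p + η` above it. This
    -- persists for nearby `(u, s)`, so by the intermediate value theorem each nearby orbit meets
    -- the horizontal disc through `p`. No invariance of domain is needed.
    have hlow := hlt _ _ _ _ k2 k3 (hηI _ hl).2 k1 (by linarith)
    have hupp := hlt _ _ _ _ k2 k3 k1 (hηI _ hr).2 (by linarith)
    rw [hpe] at hlow hupp
    have hz : Continuous fun x : ℝ × ℝ × ℝ => φ x.1 x.2.1 x.2.2 2 :=
      (show Continuous fun q : E3 => q 2 by fun_prop).comp H.cont
    have hev2 : ∀ᶠ x in 𝓝 ((U p, S p) : ℝ × ℝ), φ (Θ p - η) x.1 x.2 2 < p 2 :=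
      (hz.comp (f := fun x : ℝ × ℝ => (Θ p - η, x.1, x.2))
        (by fun_prop)).continuousAt.eventually_lt_const hlow
    have hev3 : ∀ᶠ x in 𝓝 ((U p, S p) : ℝ × ℝ), p 2 < φ (Θ p + η) x.1 x.2 2 :=
      (hz.comp (f := fun x : ℝ × ℝ => (Θ p + η, x.1, x.2))
        (by fun_prop)).continuousAt.eventually_const_lt hupp
    have hev4 : ∀ᶠ x in 𝓝 ((U p, S p) : ℝ × ℝ), ∀ θ ∈ Icc (Θ p - η) (Θ p + η),
        φ θ x.1 x.2 ∈ ball p ρ := by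
      refine isCompact_Icc.eventually_forall_of_forall_eventually fun θ hθ => ?_
      have hcc : Continuous fun y : (ℝ × ℝ) × ℝ => φ y.2 y.1.1 y.1.2 :=
        H.cont.comp (f := fun y : (ℝ × ℝ) × ℝ => (y.2, y.1.1, y.1.2)) (by fun_prop)
      exact hcc.continuousAt.eventually_mem (isOpen_ball.mem_nhds (hηI θ hθ).1)
    have hev5 : ∀ᶠ x in 𝓝 ((U p, S p) : ℝ × ℝ), |x.1 - 1 / 2| < δ :=
      (show Continuous fun x : ℝ × ℝ => |x.1 - 1 / 2| by fun_prop).continuousAt.eventually_lt_const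
        k2
    have hev6 : ∀ᶠ x in 𝓝 ((U p, S p) : ℝ × ℝ), |x.2 - 1 / 2| < δ :=
      (show Continuous fun x : ℝ × ℝ => |x.2 - 1 / 2| by fun_prop).continuousAt.eventually_lt_const
        k3
    filter_upwards [hev2, hev3, hev4, hev5, hev6] with x x2 x3 x4 x5 x6
    have hxc : Continuous fun θ => φ θ x.1 x.2 2 :=
      hz.comp (f := fun θ : ℝ => (θ, x.1, x.2)) (by fun_prop)
    obtain ⟨θ, hθ, hθz⟩ := intermediate_value_Icc (by linarith : Θ p - η ≤ Θ p + η)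
      hxc.continuousOn ⟨x2.le, x3.le⟩
    obtain ⟨-, g1, g2, -⟩ := coords θ x.1 x.2 (hηI θ hθ).2 x5 x6
    exact ⟨φ θ x.1 x.2, ball_subset_closedBall (x4 θ hθ), hθz, g1, g2⟩

/-- Of the two homeomorphisms onto the normal region, one preserves the orientation. -/
theorem exists_orientationPreserving (H : Cylinders Z M φ) (Me : Meridians Z M φ A B)
    (hM : IsCompactRegion M) (hab : a < b) (hc : 0 < c) :
    ∃ e : ℝ, (e = 1 ∨ e = -1) ∧ ∃ h : M ≃ₜ normalRegion a b c,
      (∀ p : M, (p : E3) = cylinderMap φ A B a b c e (h p)) ∧ OrientationPreserving h := by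
  obtain ⟨U, S, Θ, p, ρ, hρ, hsub, F⟩ := exists_flowBox H Me hM.2.1
  have hsubM : closedBall p ρ ⊆ M := hsub.trans interior_subset
  have hpp : p ∈ closedBall p ρ := mem_closedBall_self hρ.le
  have eq_of_height : ∀ q ∈ closedBall p ρ, ∀ q' ∈ closedBall p ρ, U q = U q' → S q = S q' →
      Θ q = Θ q' → q = q' := by
    intro q hq q' hq' hu hs hθ
    rw [← F.eq q hq, hu, hs, hθ, F.eq q' hq']
  have hdisk2 : ∀ w, diskPoint p ρ w 2 = p 2 := by
    intro w
    simp [diskPoint]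
  have hdisk : ∀ w ∈ closedBall (0 : ℂ) 1, diskPoint p ρ w ∈ closedBall p ρ :=
    fun w hw => diskPoint_mem_closedBall hρ hw
  -- On the horizontal disc `(U, S)` is injective: for equal `U` and `S` the height increases
  -- strictly with `Θ`.
  obtain ⟨e, he, hse⟩ := exists_sign_sphereHomotopic hρ F.contU F.contS (by
    intro w hw w' hw' hww
    obtain ⟨hu, hs⟩ := Complex.ext_iff.1 hww
    simp only at hu hs
    have m := hdisk w hw
    have m' := hdisk w' hw'
    have hqq : diskPoint p ρ w = diskPoint p ρ w' := by
      refine eq_of_height _ m _ m' hu hs ?_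
      rcases lt_trichotomy (Θ (diskPoint p ρ w)) (Θ (diskPoint p ρ w')) with h | h | h
      · have := F.height_lt _ m _ m' hu hs h
        rw [hdisk2, hdisk2] at this
        exact absurd this (lt_irrefl _)
      · exact h
      · have := F.height_lt _ m' _ m hu.symm hs.symm h
        rw [hdisk2, hdisk2] at this
        exact absurd this (lt_irrefl _)
    have h1 := smul_right_injective E3 hρ.ne' (add_left_cancel hqq)
    exact Complex.ext (congrFun (congrArg WithLp.ofLp h1) 0)
      (congrFun (congrArg WithLp.ofLp h1) 1)) (by
    have hpair : ContinuousAt (fun z : ℂ => (z.re, z.im)) ⟨U p, S p⟩ :=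
      (Complex.continuous_re.prodMk Complex.continuous_im).continuousAt
    filter_upwards [hpair.eventually F.nhds] with z hz
    obtain ⟨q, hq, hq2, hqU, hqS⟩ := hz
    obtain ⟨w, hw, hwq⟩ := exists_diskPoint_eq hρ hq hq2
    refine ⟨w, hw, ?_⟩
    simp only [hwq, hqU, hqS])
  -- The sign `e` came from the flow box alone, so the homeomorphism can now be built with it.
  obtain ⟨h, f, hf, hfM⟩ := exists_extension H Me hab hc he
  have hfc := continuousOn_of_homeomorph h hf
  have hfi := injOn_of_homeomorph h hf
  have hcoord : ∀ q ∈ closedBall p ρ, 0 < f q 2 ∧ axisCoord a b e (f q) = U q ∧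
      radiusCoord c (f q) = S q ∧
      branchAngle 1 (A (U q) (S q)) (B (U q) (S q)) (arcCoord (f q)) = Θ q := by
    intro q hq
    refine coords_of_cylinderMap_eq H Me hab hc he (hfM q (hsubM hq)).1 (F.memU q hq) (F.memS q hq)
      (F.memΘ q hq) ?_
    rw [F.eq q hq]
    exact (hfM q (hsubM hq)).2
  have hsec : SphereHomotopic (fun v => f (p + ρ • (v : E3)) - f p) (fun v => (v : E3)) := by
    refine (sphereHomotopic_spatial (U := U) (S := S) (κ := b - a) hρ (by linarith) hc he
      (hfc.mono hsubM) F.contU F.contS (hfi.mono hsubM) ?_ ?_ ?_).trans hse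
    · intro q hq
      obtain ⟨-, h1, -⟩ := hcoord q hq
      obtain ⟨-, h2, -⟩ := hcoord p hpp
      rw [← h1, ← h2]
      unfold axisCoord
      have hba : b - a ≠ 0 := by linarith
      rcases he with rfl | rfl <;> field_simp <;> ring
    · intro q hq
      obtain ⟨z1, -, h1, -⟩ := hcoord q hq
      obtain ⟨z2, -, h2, -⟩ := hcoord p hpp
      rw [← h1, ← h2]
      unfold radiusCoord
      rw [abs_of_pos z1, abs_of_pos z2]
      field_simp
      ring
    -- Later on an upper arc means larger `Θ`, hence greater height in the flow box and smaller `y`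
    -- in the normal form: the two heights of the comparison run oppositely, as `hmono` demands.
    · have key : ∀ q ∈ closedBall p ρ, ∀ q' ∈ closedBall p ρ, U q = U q' → S q = S q' →
          Θ q < Θ q' → f q' 1 < f q 1 := by
        intro q hq q' hq' hu hs hθ
        obtain ⟨-, -, h1, h2⟩ := hcoord q hq
        obtain ⟨-, -, h1', h2'⟩ := hcoord q' hq'
        have h0 : radiusCoord c (f q) ≠ 0 := by rw [h1]; exact (F.memS q hq).1.ne'
        rw [← h2, ← h2', ← hu, ← hs, ← not_le, branchAngle_le_iff
          (Me.lt _ (F.memU q hq) _ (F.memS q hq)), arcCoord_le_iff hc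
          (by rw [h1', ← hs, ← h1]; exact h0) (by rw [h1, h1', hs]), one_mul, one_mul, not_le] at hθ
        exact hθ
      intro q hq hqp hu hs
      rcases lt_trichotomy (Θ q) (Θ p) with h | h | h
      · have h1 := F.height_lt q hq p hpp hu hs h
        have h2 := key q hq p hpp hu hs h
        exact mul_neg_of_pos_of_neg (by linarith) (by linarith)
      · exact absurd (eq_of_height q hq p hpp hu hs h) hqp
      · have h1 := F.height_lt p hpp q hq hu.symm hs.symm h
        have h2 := key p hpp q hq hu.symm hs.symm h
        exact mul_neg_of_neg_of_pos (by linarith) (by linarith)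
  refine ⟨e, he, h, fun q => ?_, ?_⟩
  · rw [← hf]
    exact (hfM q q.2).2
  -- The degree found at `p` is carried to every interior point by connectedness.
  · refine orientationPreserving_of_sphere h hf fun q hq => ?_
    obtain ⟨r, hr, hqr⟩ := Metric.nhds_basis_closedBall.mem_iff.1 (mem_interior_iff_mem_nhds.1 hq)
    exact ⟨r, hr, hqr, (sphereHomotopic_of_mem_interior hfc hfi hM.2.2 hq (hsub hpp) hr hρ hqr
      hsubM).trans hsec⟩

end

end PSVF

end

theorem proposition1 (r : WithTop ℕ∞) (hr : 1 ≤ r) (Z : PSVF.PiecewiseField) (M : Set PSVF.E3)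
    (hM : PSVF.IsCompactRegion M)
    (hZ : Z.SmoothOn r M)
    (hcross : ∀ p ∈ M ∩ PSVF.switching, Z.IsCrossing p ∨ Z.IsInvisibleTwoFold p)
    (hcyl : Z.HasCylinderContinuum M)
    (a b c : ℝ) (hab : a < b) (hc : 0 < c) :
    PSVF.SigmaEquivalent Z M PSVF.normalForm (PSVF.normalRegion a b c) := by
  obtain ⟨φ, A, B, H, Me⟩ := PSVF.exists_cylinders_meridians hr hM hZ hcross hcyl
  obtain ⟨e, he, h, hh, ho⟩ := PSVF.exists_orientationPreserving H Me hM hab hc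
  exact PSVF.sigmaEquivalent_of_homeomorph H Me hab hc he h hh ho
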